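/- Let $\mathcal R\subset\mathbb R^N$ be a (finite, possibly empty, not necessarily spanning) reduced root system, i.e. a finite set of vectors with $\|\alpha\|^2=2$, $-\alpha\in\mathcal R$, $\mathbb R\alpha\cap\mathcal R=\{\pm\alpha\}$ and $\sigma_\alpha(\mathcal R)=\mathcal R$ for all $\alpha\in\mathcal R$, where $\sigma_\alpha$ is the orthogonal reflection in $\alpha^\perp$. Let $G$ be the group generated by the $\sigma_\alpha$, and let $\mu:\mathcal R\to[0,\infty)$ be $G$-invariant. Let $$T_{\xi}f(x)=\partial_\xi f(x)+\tfrac12\sum_{\alpha\in\mathcal R}\mu(\alpha)\langle\alpha,\xi\rangle\frac{f(x)-f(\sigma_\alpha x)}{\langle\alpha,x\rangle}$$ be the Dunkl operators on $C^1(\mathbb R^N)$ (the quotient being extended continuously across $\langle\alpha,x\rangle=0$), and let $E_\mu:\mathbb C^N\times\mathbb C^N\to\mathbb C$ be the Dunkl kernel, i.e. the unique holomorphic function that is real-valued on $\mathbb R^N\times\mathbb R^N$ and satisfies there $T^x_\xi E_\mu(x,y)=\langle\xi,y\rangle E_\mu(x,y)$ and $E_\mu(0,y)=1$ for all $x,y,\xi\in\mathbb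 R^N$. Put $\gamma_\mu=\frac12\sum_{\alpha\in\mathcal R}\mu(\alpha)$, $\tilde\omega_{\mu,t}(x)=t^{-(\gamma_\mu+N/2)}\prod_{\alpha\in\mathcal R}|\langle\alpha,x\rangle|^{\mu(\alpha)}$, $c_\mu=\int_{\mathbb R^N}\tilde\omega_{\mu,1}(x)e^{-\|x\|^2/2}\,dx$ and $\omega_{\mu,t}=c_\mu^{-1}\tilde\omega_{\mu,t}$, and write $L^2(\omega_{\mu,t})=L^2(\mathbb R^N,\omega_{\mu,t}(x)\,dx)$ (complex-valued functions). For $t>0$ let $\mathcal B_{\mu,t}$ be the reproducing kernel Hilbert space of functions on $\mathbb C^N$ with reproducing kernel $\mathbb K_{\mu,t}(z,w)=E_\mu(z^*/t^{1/2},w/t^{1/2})$, where $z^*$ is the complex conjugate of $z$ and $w\mapsto\mathbb K_{\mu,t}(z,w)$ is the kernel function at $z$. With $z^2=\sum_j z_j^2$, let $$A_{\mu,t}\psi(z)=\int_{\mathbb R^N}A_{\mu,t}(z,q)\,\psi(q)\,\omega_{\mu,t}(q)\,dq,\qquad A_{\mu,t}(z,q)=e^{-z^2/2t-q^2/4t}\,E_\mu\!\left(\frac{z}{t^{1/2}},\frac{q}{t^{1/2}}\right)$$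 for $\psi\in L^2(\omega_{\mu,t})$ and $z\in\mathbb C^N$. For $\lambda>0$ let $\delta_\lambda\psi(x)=\psi(\lambda x)$ for functions $\psi$ on $\mathbb R^N$ and $D_\lambda f(z)=f(\lambda z)$ for functions $f$ on $\mathbb C^N$. **Theorem.** Let $s,t>0$. The integrals defining $A_{\mu,t}$ and $A_{\mu,s}$ converge absolutely, these formulas define bounded linear operators $$A_{\mu,t}:L^2(\omega_{\mu,t})\to\mathcal B_{\mu,t},\quad A_{\mu,s}:L^2(\omega_{\mu,s})\to\mathcal B_{\mu,s},\quad \delta_{(t/s)^{1/2}}:L^2(\omega_{\mu,t})\to L^2(\omega_{\mu,s}),\quad D_{(t/s)^{1/2}}:\mathcal B_{\mu,t}\to\mathcal B_{\mu,s},$$ and the diagram they form commutes: $$D_{(t/s)^{1/2}}\,A_{\mu,t}=A_{\mu,s}\,\delta_{(t/s)^{1/2}}\quad\text{as maps } L^2(\omega_{\mu,t})\to\mathcal B_{\mu,s}.$$ -/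

import Mathlib

open MeasureTheory
open scoped ComplexConjugate ENNReal

namespace Dunkl

/-- The configuration space `ℝᴺ`. -/
abbrev RSpace (N : ℕ) := EuclideanSpace ℝ (Fin N)

/-- The phase space `ℂᴺ`. -/
abbrev CSpace (N : ℕ) := EuclideanSpace ℂ (Fin N)

variable {N : ℕ}

/-- The inclusion of `ℝᴺ` into `ℂᴺ`. -/
noncomputable def toC (x : RSpace N) : CSpace N := WithLp.toLp 2 fun i => (x i : ℂ)

/-- Coordinatewise complex conjugation on `ℂᴺ`. -/
noncomputable def conjC (z : CSpace N) : CSpace N := WithLp.toLp 2 fun i => conj (z i)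

/-- The holomorphic function `z² = ∑ zⱼ²` on `ℂᴺ`. -/
noncomputable def sqC (z : CSpace N) : ℂ := ∑ i, z i ^ 2

/-- The orthogonal reflection `σ_α` in the hyperplane orthogonal to `α`. -/
noncomputable def rootRefl (α : RSpace N) : RSpace N ≃ₗᵢ[ℝ] RSpace N :=
  (Submodule.span ℝ {α})ᗮ.reflection

/-- Root systems in `ℝᴺ`, normalized by `‖α‖² = 2`. The empty set is allowed, and the roots need
not span. -/
structure IsRootSystem (R : Finset (RSpace N)) : Prop where
  ne_zero : ∀ α ∈ R, α ≠ 0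
  neg_mem : ∀ α ∈ R, -α ∈ R
  reduced : ∀ α ∈ R, ∀ r : ℝ, r • α ∈ R → r = 1 ∨ r = -1
  refl_image : ∀ α ∈ R, rootRefl α '' (R : Set (RSpace N)) = R
  norm_sq : ∀ α ∈ R, ‖α‖ ^ 2 = 2

/-- The Coxeter group generated by the reflections in the roots. -/
noncomputable def coxeterGroup (R : Finset (RSpace N)) : Subgroup (RSpace N ≃ₗᵢ[ℝ] RSpace N) :=
  Subgroup.closure {g | ∃ α ∈ R, g = rootRefl α}

/-- Non-negative multiplicity functions `μ : R → [0, ∞)`, invariant under the Coxeter group.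
The values of `μ` outside `R` are never used. -/
structure IsMultiplicity (R : Finset (RSpace N)) (μ : RSpace N → ℝ) : Prop where
  nonneg : ∀ α ∈ R, 0 ≤ μ α
  invariant : ∀ g ∈ coxeterGroup R, ∀ α ∈ R, μ (g α) = μ α

open Classical in
/-- The quotient `(f x - f (σ_α x)) / ⟨α, x⟩` for a `C¹` function `f`. On the hyperplane
`⟨α, x⟩ = 0` its value is the one of the continuous extension,
the limit being `(2 / ‖α‖²) ∂_α f x`. -/
noncomputable def diffQuot (α : RSpace N) (f : RSpace N → ℂ) (x : RSpace N) : ℂ :=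
  if inner ℝ α x = 0 then ((2 / ‖α‖ ^ 2 : ℝ) : ℂ) * fderiv ℝ f x α
  else (f x - f (rootRefl α x)) / ((inner ℝ α x : ℝ) : ℂ)

/-- The Dunkl operator `T_{ξ,μ}` on `C¹` functions. -/
noncomputable def dunklOp (R : Finset (RSpace N)) (μ : RSpace N → ℝ) (ξ : RSpace N)
    (f : RSpace N → ℂ) (x : RSpace N) : ℂ :=
  fderiv ℝ f x ξ +
    (1 / 2) * ∑ α ∈ R, (μ α : ℂ) * ((inner ℝ α ξ : ℝ) : ℂ) * diffQuot α f x

/-- `E` is the Dunkl kernel: it is holomorphic on `ℂᴺ × ℂᴺ`, and its restriction to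
`ℝᴺ × ℝᴺ` is real valued and solves `T^x_ξ E(x,y) = ⟨ξ,y⟩ E(x,y)`, `E(0,y) = 1`. -/
structure IsDunklKernel (R : Finset (RSpace N)) (μ : RSpace N → ℝ)
    (E : CSpace N → CSpace N → ℂ) : Prop where
  holomorphic : Differentiable ℂ fun p : CSpace N × CSpace N => E p.1 p.2
  real_valued : ∀ x y : RSpace N, (E (toC x) (toC y)).im = 0
  eigen : ∀ x y ξ : RSpace N,
    dunklOp R μ ξ (fun x' => E (toC x') (toC y)) x
      = ((inner ℝ ξ y : ℝ) : ℂ) * E (toC x) (toC y)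
  normalized : ∀ y : RSpace N, E 0 (toC y) = 1

open Classical in
/-- The Dunkl kernel function `E_μ : ℂᴺ × ℂᴺ → ℂ`, the unique function with `IsDunklKernel`.
(For a root system and `μ ≥ 0` it exists; the `else` branch only makes the definition total.) -/
noncomputable def dunklKernel (R : Finset (RSpace N)) (μ : RSpace N → ℝ) :
    CSpace N → CSpace N → ℂ :=
  if h : ∃ E, IsDunklKernel R μ E then h.choose else 0

/-- `γ_μ = ½ ∑_{α ∈ R} μ(α)`. -/
noncomputable def gammaConst (R : Finset (RSpace N)) (μ : RSpace N → ℝ) : ℝ :=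
  (1 / 2) * ∑ α ∈ R, μ α

/-- The unnormalized weight `t^{-(γ_μ + N/2)} ∏_{α ∈ R} |⟨α, x⟩|^{μ(α)}`. -/
noncomputable def weightTilde (R : Finset (RSpace N)) (μ : RSpace N → ℝ) (t : ℝ)
    (x : RSpace N) : ℝ :=
  t ^ (-(gammaConst R μ + (N : ℝ) / 2)) * ∏ α ∈ R, |(inner ℝ α x : ℝ)| ^ μ α

/-- The Macdonald-Mehta-Selberg constant `c_μ`. -/
noncomputable def mmsConst (R : Finset (RSpace N)) (μ : RSpace N → ℝ) : ℝ :=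
  ∫ x : RSpace N, weightTilde R μ 1 x * Real.exp (-‖x‖ ^ 2 / 2)

/-- The weight function `ω_{μ,t}`. -/
noncomputable def weight (R : Finset (RSpace N)) (μ : RSpace N → ℝ) (t : ℝ)
    (x : RSpace N) : ℝ :=
  (mmsConst R μ)⁻¹ * weightTilde R μ t x

/-- The measure `dω_{μ,t}(x) = ω_{μ,t}(x) dᴺx` on `ℝᴺ`. -/
noncomputable def weightMeasure (R : Finset (RSpace N)) (μ : RSpace N → ℝ) (t : ℝ) :
    Measure (RSpace N) :=
  volume.withDensity fun x => ENNReal.ofReal (weight R μ t x)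

/-- The Hilbert space `L²(ω_{μ,t})`. -/
noncomputable abbrev L2Weight (R : Finset (RSpace N)) (μ : RSpace N → ℝ) (t : ℝ) :=
  Lp ℂ 2 (weightMeasure R μ t)

/-- The kernel `𝕂_{μ,t}(z,w) = E_μ(z* / t^{1/2}, w / t^{1/2})`. -/
noncomputable def sbKernel (R : Finset (RSpace N)) (μ : RSpace N → ℝ) (t : ℝ)
    (z w : CSpace N) : ℂ :=
  dunklKernel R μ (((Real.sqrt t)⁻¹ : ℂ) • conjC z) (((Real.sqrt t)⁻¹ : ℂ) • w)

/-- The kernel `𝕂_{μ,t}` in the form used for Mathlib's reproducing kernel Hilbert spaces: the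
entry at `(w, z)` is (multiplication by) `𝕂_{μ,t}(z,w)`, so that `w ↦ 𝕂_{μ,t}(z,w)` is the
kernel function at the point `z`. -/
noncomputable def sbMatrix (R : Finset (RSpace N)) (μ : RSpace N → ℝ) (t : ℝ) :
    Matrix (CSpace N) (CSpace N) (ℂ →L[ℂ] ℂ) :=
  Matrix.of fun w z => sbKernel R μ t z w • ContinuousLinearMap.id ℂ ℂ

open Classical in
/-- `sbMatrix`, made total. (For a root system, `μ ≥ 0` and `t > 0` the kernel `𝕂_{μ,t}` is
positive semidefinite, so that this is `sbMatrix`.) -/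
noncomputable def sbMatrixTotal (R : Finset (RSpace N)) (μ : RSpace N → ℝ) (t : ℝ) :
    Matrix (CSpace N) (CSpace N) (ℂ →L[ℂ] ℂ) :=
  if (sbMatrix R μ t).PosSemidef then sbMatrix R μ t else 0

instance factPosSemidef (R : Finset (RSpace N)) (μ : RSpace N → ℝ) (t : ℝ) :
    Fact (sbMatrixTotal R μ t).PosSemidef := by
  constructor
  unfold sbMatrixTotal
  split_ifs with h
  · exact h
  · exact Matrix.PosSemidef.zero

/-- The Segal-Bargmann space `𝓑_{μ,t}`: the Hilbert space of functions on `ℂᴺ` with reproducing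
kernel `𝕂_{μ,t}`. -/
noncomputable def SegalBargmann (R : Finset (RSpace N)) (μ : RSpace N → ℝ) (t : ℝ) : Type :=
  RKHS.OfKernel (sbMatrixTotal R μ t)

noncomputable instance (R : Finset (RSpace N)) (μ : RSpace N → ℝ) (t : ℝ) :
    NormedAddCommGroup (SegalBargmann R μ t) :=
  inferInstanceAs (NormedAddCommGroup (RKHS.OfKernel (sbMatrixTotal R μ t)))

noncomputable instance (R : Finset (RSpace N)) (μ : RSpace N → ℝ) (t : ℝ) :
    InnerProductSpace ℂ (SegalBargmann R μ t) :=
  inferInstanceAs (InnerProductSpace ℂ (RKHS.OfKernel (sbMatrixTotal R μ t)))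

instance (R : Finset (RSpace N)) (μ : RSpace N → ℝ) (t : ℝ) :
    CompleteSpace (SegalBargmann R μ t) :=
  inferInstanceAs (CompleteSpace (RKHS.OfKernel (sbMatrixTotal R μ t)))

/-- The elements of `𝓑_{μ,t}` are functions `ℂᴺ → ℂ`. -/
noncomputable instance (R : Finset (RSpace N)) (μ : RSpace N → ℝ) (t : ℝ) :
    RKHS ℂ (SegalBargmann R μ t) (CSpace N) ℂ :=
  inferInstanceAs (RKHS ℂ (RKHS.OfKernel (sbMatrixTotal R μ t)) (CSpace N) ℂ)

/-- The reproducing kernel of `𝓑_{μ,t}`. -/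
theorem kernel_segalBargmann (R : Finset (RSpace N)) (μ : RSpace N → ℝ) (t : ℝ) :
    RKHS.kernel (SegalBargmann R μ t) = sbMatrixTotal R μ t :=
  RKHS.OfKernel.kernel_ofKernel (K := sbMatrixTotal R μ t)

/-- The integral kernel
`A_{μ,t}(z,q) = exp(-z²/2t - q²/4t) E_μ(z / t^{1/2}, q / t^{1/2})`. -/
noncomputable def kernelA (R : Finset (RSpace N)) (μ : RSpace N → ℝ) (t : ℝ)
    (z : CSpace N) (q : RSpace N) : ℂ :=
  Complex.exp (-sqC z / (2 * t) - (‖q‖ : ℂ) ^ 2 / (4 * t)) *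
    dunklKernel R μ (((Real.sqrt t)⁻¹ : ℂ) • z) (((Real.sqrt t)⁻¹ : ℂ) • toC q)

/-- The Version A Segal-Bargmann transform
`A_{μ,t} ψ (z) = ∫ A_{μ,t}(z,q) ψ(q) dω_{μ,t}(q)`. -/
noncomputable def transformA (R : Finset (RSpace N)) (μ : RSpace N → ℝ) (t : ℝ)
    (ψ : RSpace N → ℂ) (z : CSpace N) : ℂ :=
  ∫ q, kernelA R μ t z q * ψ q ∂(weightMeasure R μ t)

/-- The dilation operator `δ_c ψ (x) = ψ(c x)` on functions on `ℝᴺ`. -/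
def dilReal (c : ℝ) (ψ : RSpace N → ℂ) (x : RSpace N) : ℂ := ψ (c • x)

/-- The dilation operator `D_c f (z) = f(c z)` on functions on `ℂᴺ`. -/
def dilComplex (c : ℂ) (f : CSpace N → ℂ) (z : CSpace N) : ℂ := f (c • z)

end Dunkl

/-!
Contracting `T_ξ E(·, y) = ⟨ξ, y⟩ E(·, y)` with `ξ = x` cancels the denominators and leaves the
Euler equation `∂ₓE + ½ ∑ μ(α) (E - E ∘ σ_α) = ⟨x, y⟩ E`, which determines `E` degree by degree: on
the part of degree `n` the left side is `n + ½ ∑ μ(α) (1 - σ_α)`, injective because `μ ≥ 0` and the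
reflections permute the points where the maximum modulus is attained. Hence the kernel is unique,
and the parts so obtained sum to an entire function of exponential type. That it is an eigenfunction
of every `T_ξ` follows from the commutation of Dunkl operators and the same maximum principle.

Integration by parts against the Gaussian weight shows that
`w ↦ e^{-w²/2} ∫ E(q, z) E(q, w) e^{-q²/2} ω_{μ,1}(q) dq` solves the Euler equation with `y = z`, so
the integral is `e^{(z² + w²)/2} E(z, w)`. Thus the vectors `q ↦ A_{μ,t}(z*, q)` of `L²(ω_{μ,t})`
have Gram matrix `𝕂_{μ,t}`, and `A_{μ,t}` is a bounded operator into `𝓑_{μ,t}`. It intertwines the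
dilations because `A_{μ,t}(z, q)`, `𝕂_{μ,t}` and the measure `ω_{μ,t}(q) dq` depend on `t` only
through `z / √t` and `q / √t`.
-/

namespace Dunkl

open Filter Topology

/-! ### Holomorphic functions -/

section Holomorphic

variable {V F : Type*} [NormedAddCommGroup V] [NormedSpace ℂ V] [NormedAddCommGroup F]
  [NormedSpace ℂ F]

lemma tendsto_one_div_add_one_nhdsNE_zero :
    Tendsto (fun n : ℕ => 1 / ((n : ℂ) + 1)) atTop (𝓝[≠] 0) := by
  refine tendsto_nhdsWithin_iff.2 ⟨tendsto_one_div_add_atTop_nhds_zero_nat,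
    Eventually.of_forall fun n => ?_⟩
  exact one_div_ne_zero (by exact_mod_cast n.succ_ne_zero)

lemma iteratedDeriv_succ_id_mul {𝕜 : Type*} [NontriviallyNormedField 𝕜] {g : 𝕜 → 𝕜} {n : ℕ}
    {x : 𝕜} (hg : ContDiffAt 𝕜 ↑(n + 1) g x) :
    iteratedDeriv (n + 1) (fun y => y * g y) x =
      x * iteratedDeriv (n + 1) g x + (n + 1) * iteratedDeriv n g x := by
  rw [iteratedDeriv_fun_mul contDiffAt_fun_id hg, Finset.sum_range_succ', Finset.sum_range_succ']
  simp [iteratedDeriv_fun_id, add_comm]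

lemma aestronglyMeasurable_deriv_param {A : Type*} [MeasurableSpace A] {m : Measure A}
    {f : ℂ → A → F} (hf : ∀ a, Differentiable ℂ fun l => f l a)
    (hm : ∀ l, AEStronglyMeasurable (f l) m) (l : ℂ) :
    AEStronglyMeasurable (fun a => deriv (fun l => f l a) l) m := by
  refine aestronglyMeasurable_of_tendsto_ae (u := atTop)
    (f := fun (n : ℕ) a => (1 / ((n : ℂ) + 1))⁻¹ • (f (l + 1 / ((n : ℂ) + 1)) a - f l a))
    (fun n => ((hm _).sub (hm l)).const_smul _) (Eventually.of_forall fun a => ?_)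
  exact (hasDerivAt_iff_tendsto_slope_zero.1 (hf a l).hasDerivAt).comp
    tendsto_one_div_add_one_nhdsNE_zero

lemma hasDerivAt_integral_of_entire {A : Type*} [MeasurableSpace A]
    {m : Measure A} {f : ℂ → A → F} (hf : ∀ a, Differentiable ℂ fun l => f l a)
    (hm : ∀ l, AEStronglyMeasurable (f l) m) (l₀ : ℂ) {bound : A → ℝ}
    (hbound : Integrable bound m) (hle : ∀ a l, ‖l - l₀‖ ≤ 2 → ‖f l a‖ ≤ bound a) :
    HasDerivAt (fun l => ∫ a, f l a ∂m) (∫ a, deriv (fun l => f l a) l₀ ∂m) l₀ := by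
  have norm_deriv_le (a : A) (l : ℂ) (hl : l ∈ Metric.closedBall l₀ 1) :
      ‖deriv (fun l => f l a) l‖ ≤ bound a := by
    have hsphere (x : ℂ) (hx : x ∈ Metric.sphere l 1) : ‖f x a‖ ≤ bound a := by
      refine hle a x ?_
      rw [mem_closedBall_iff_norm] at hl
      rw [mem_sphere_iff_norm] at hx
      linarith [norm_sub_le_norm_sub_add_norm_sub x l l₀]
    simpa using Complex.norm_deriv_le_of_forall_mem_sphere_norm_le one_pos
      (hf a).diffContOnCl hsphere
  exact (hasDerivAt_integral_of_dominated_loc_of_deriv_le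
    (F' := fun l a => deriv (fun l => f l a) l) (Metric.closedBall_mem_nhds l₀ one_pos)
    (Eventually.of_forall hm)
    (hbound.mono' (hm l₀) (Eventually.of_forall fun a => hle a l₀ (by simp)))
    (aestronglyMeasurable_deriv_param hf hm l₀)
    (Eventually.of_forall norm_deriv_le) hbound
    (Eventually.of_forall fun a l _ => (hf a l).hasDerivAt)).2

lemma deriv_eq_integral_circleMap [CompleteSpace F] {f : ℂ → F} (hf : Differentiable ℂ f)
    (c : ℂ) :
    deriv f c = (2 * Real.pi * Complex.I : ℂ)⁻¹ • ∫ θ in Set.Ioc 0 (2 * Real.pi),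
      (deriv (circleMap c 1) θ * (1 / (circleMap c 1 θ - c) ^ 2)) • f (circleMap c 1 θ) := by
  have cauchy := DiffContOnCl.deriv_eq_smul_circleIntegral (c := c) one_pos hf.diffContOnCl
  rw [circleIntegral, intervalIntegral.integral_of_le (by positivity)] at cauchy
  simp only [smul_smul] at cauchy
  rw [cauchy, inv_smul_smul₀ Complex.two_pi_I_ne_zero]

lemma continuous_cauchyKernel_circleMap (c : ℂ) :
    Continuous fun θ => deriv (circleMap c 1) θ * (1 / (circleMap c 1 θ - c) ^ 2) := by
  simp only [deriv_circleMap, circleMap_sub_center]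
  exact ((continuous_circleMap 0 1).mul continuous_const).mul (continuous_const.div
    ((continuous_circleMap 0 1).pow 2) fun θ => pow_ne_zero 2 (circleMap_ne_center one_ne_zero))

lemma differentiable_deriv_of_prod [CompleteSpace F] {g : ℂ × ℂ → F} (hg : Differentiable ℂ g)
    (c : ℂ) : Differentiable ℂ fun s => deriv (fun l => g (l, s)) c := by
  intro s₀
  have hfst (s : ℂ) : Differentiable ℂ fun l => g (l, s) := by fun_prop
  simp only [fun s => deriv_eq_integral_circleMap (hfst s) c]
  obtain ⟨C, hC⟩ := ((isCompact_closedBall c 1).prod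
    (isCompact_closedBall s₀ 2)).exists_bound_of_continuousOn hg.continuous.continuousOn
  refine (hasDerivAt_integral_of_entire (bound := fun _ => C) (fun θ => by fun_prop) (fun s => ?_)
    s₀ (integrable_const C) fun θ s hs => ?_).differentiableAt.const_smul _
  · exact ((continuous_cauchyKernel_circleMap c).smul (hg.continuous.comp
      ((continuous_circleMap c 1).prodMk continuous_const))).aestronglyMeasurable
  · have := hC (circleMap c 1 θ, s) ⟨by simp [dist_eq_norm], mem_closedBall_iff_norm.2 hs⟩
    simpa [norm_smul, deriv_circleMap] using this

lemma hasDerivAt_comp_line {f : V → F} (hf : Differentiable ℂ f) (a b : V) (l : ℂ) :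
    HasDerivAt (fun l : ℂ => f (a + l • b)) (fderiv ℂ f (a + l • b) b) l := by
  have h := (hf (a + l • b)).hasFDerivAt.comp_hasDerivAt l
    (((hasDerivAt_id l).smul_const b).const_add a)
  simpa [Function.comp_def] using! h

lemma norm_fderiv_le_of_entire {f : V → F} (hf : Differentiable ℂ f) {p : V} {C : ℝ}
    (hC : ∀ q, ‖q‖ ≤ ‖p‖ + 1 → ‖f q‖ ≤ C) : ‖fderiv ℂ f p‖ ≤ C := by
  have hC0 : 0 ≤ C := (norm_nonneg _).trans (hC p (by linarith))
  refine ContinuousLinearMap.opNorm_le_bound _ hC0 fun v => ?_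
  rcases eq_or_ne v 0 with rfl | hv
  · simp
  have hv' : 0 < ‖v‖ := norm_pos_iff.2 hv
  have hsphere (l : ℂ) (hl : l ∈ Metric.sphere 0 ‖v‖⁻¹) : ‖f (p + l • v)‖ ≤ C := by
    refine hC _ ((norm_add_le _ _).trans ?_)
    rw [norm_smul, mem_sphere_zero_iff_norm.1 hl, inv_mul_cancel₀ hv'.ne']
  have h := Complex.norm_deriv_le_of_forall_mem_sphere_norm_le (inv_pos.2 hv')
    (Differentiable.diffContOnCl (by fun_prop)) hsphere
  rwa [(hasDerivAt_comp_line hf p v 0).deriv, zero_smul, add_zero, div_inv_eq_mul] at h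

lemma summable_fderiv_and_hasFDerivAt_tsum_of_entire [CompleteSpace F] {ι : Type*} {f : ι → V → F}
    (hf : ∀ i, Differentiable ℂ (f i)) {u : ℝ → ι → ℝ} (hu : ∀ r, Summable (u r))
    (hle : ∀ r i p, ‖p‖ ≤ r → ‖f i p‖ ≤ u r i) (p : V) :
    Summable (fun i => fderiv ℂ (f i) p) ∧
      HasFDerivAt (fun q => ∑' i, f i q) (∑' i, fderiv ℂ (f i) p) p := by
  have norm_fderiv_le (i : ι) (q : V) (hq : q ∈ Metric.ball p 1) :
      ‖fderiv ℂ (f i) q‖ ≤ u (‖p‖ + 2) i := by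
    refine norm_fderiv_le_of_entire (hf i) fun q' hq' => hle _ i q' (hq'.trans ?_)
    rw [mem_ball_iff_norm] at hq
    linarith [norm_sub_norm_le q p]
  have hp : p ∈ Metric.ball p 1 := Metric.mem_ball_self one_pos
  exact ⟨.of_norm_bounded (hu _) fun i => norm_fderiv_le i p hp,
    hasFDerivAt_tsum_of_isPreconnected (hu (‖p‖ + 2)) Metric.isOpen_ball
      (convex_ball p 1).isPreconnected (fun i q _ => (hf i q).hasFDerivAt) norm_fderiv_le hp
      (.of_norm_bounded (hu ‖p‖) fun i => hle _ i p le_rfl) hp⟩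

end Holomorphic

section EntireOnLines

variable {V : Type*} [AddCommGroup V] [Module ℂ V] {G H : V → ℂ}

/-- Holomorphy in the sense of Gâteaux, without continuity in the full variable. It is all that
the identity theorem needs, and it is evidently preserved by directional derivatives. -/
def EntireOnLines (G : V → ℂ) : Prop := ∀ a b, Differentiable ℂ fun l : ℂ => G (a + l • b)

lemma EntireOnLines.add (hG : EntireOnLines G) (hH : EntireOnLines H) :
    EntireOnLines fun z => G z + H z := fun a b => (hG a b).add (hH a b)

lemma EntireOnLines.sub (hG : EntireOnLines G) (hH : EntireOnLines H) :
    EntireOnLines fun z => G z - H z := fun a b => (hG a b).sub (hH a b)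

lemma EntireOnLines.mul (hG : EntireOnLines G) (hH : EntireOnLines H) :
    EntireOnLines fun z => G z * H z := fun a b => (hG a b).mul (hH a b)

lemma EntireOnLines.const_mul (hG : EntireOnLines G) (c : ℂ) :
    EntireOnLines fun z => c * G z := fun a b => (hG a b).const_mul c

lemma EntireOnLines.div_const (hG : EntireOnLines G) (c : ℂ) :
    EntireOnLines fun z => G z / c := fun a b => (hG a b).div_const c

lemma EntireOnLines.sum {ι : Type*} {s : Finset ι} {G : ι → V → ℂ}
    (hG : ∀ i ∈ s, EntireOnLines (G i)) : EntireOnLines fun z => ∑ i ∈ s, G i z :=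
  fun a b => Differentiable.fun_sum fun i hi => hG i hi a b

lemma EntireOnLines.of_differentiable {V : Type*} [NormedAddCommGroup V] [NormedSpace ℂ V]
    {G : V → ℂ} (hG : Differentiable ℂ G) : EntireOnLines G := fun a b => by fun_prop

end EntireOnLines

/-! ### A maximum principle -/

/-- At a point where `‖f‖` is maximal, the differences `f x - f (σ i x)` can only increase the
norm of `n • f x`. As `‖f‖` need not attain its supremum, the proof argues with the supremum. -/
lemma norm_le_of_norm_smul_add_sum_sub_le {ι X E : Type*} [NormedAddCommGroup E] [NormedSpace ℝ E]
    {s : Finset ι} {k : ι → ℝ} (hk : ∀ i ∈ s, 0 ≤ k i) {σ : ι → X → X} {S : Set X}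
    (hσ : ∀ i ∈ s, Set.MapsTo (σ i) S S) {f : X → E} (hf : BddAbove ((fun x => ‖f x‖) '' S))
    {n C : ℝ} (hn : 0 < n)
    (h : ∀ x ∈ S, ‖n • f x + ∑ i ∈ s, k i • (f x - f (σ i x))‖ ≤ n * C) {x : X} (hx : x ∈ S) :
    ‖f x‖ ≤ C := by
  set M := sSup ((fun x => ‖f x‖) '' S)
  set K := ∑ i ∈ s, k i with hK
  have hK0 : 0 ≤ K := Finset.sum_nonneg hk
  have le_M (y : X) (hy : y ∈ S) : ‖f y‖ ≤ M := le_csSup hf ⟨y, hy, rfl⟩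
  have le_mean (y : X) (hy : y ∈ S) : ‖f y‖ ≤ (n * C + K * M) / (n + K) := by
    rw [le_div_iff₀ (by positivity)]
    have split : (n + K) • f y =
        (n • f y + ∑ i ∈ s, k i • (f y - f (σ i y))) + ∑ i ∈ s, k i • f (σ i y) := by
      simp only [smul_sub, Finset.sum_sub_distrib, ← Finset.sum_smul, hK, add_smul]
      abel
    have sum_le : ‖∑ i ∈ s, k i • f (σ i y)‖ ≤ K * M := by
      rw [hK, Finset.sum_mul]
      refine (norm_sum_le _ _).trans (Finset.sum_le_sum fun i hi => ?_)
      rw [norm_smul, Real.norm_of_nonneg (hk i hi)]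
      exact mul_le_mul_of_nonneg_left (le_M _ (hσ i hi hy)) (hk i hi)
    calc ‖f y‖ * (n + K) = ‖(n + K) • f y‖ := by
          rw [norm_smul, Real.norm_of_nonneg (by positivity), mul_comm]
      _ ≤ n * C + K * M := split ▸ (norm_add_le _ _).trans (add_le_add (h y hy) sum_le)
  have M_le : M ≤ (n * C + K * M) / (n + K) :=
    csSup_le ⟨_, x, hx, rfl⟩ (Set.forall_mem_image.2 le_mean)
  rw [le_div_iff₀ (by positivity)] at M_le
  exact (le_M x hx).trans (le_of_mul_le_mul_left (by linarith) hn)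

/-! ### Functions of exponential growth -/

section ExpGrowth

variable {V F : Type*} [NormedAddCommGroup V] [NormedAddCommGroup F] {f g : V → F}

/-- Functions of at most exponential growth, the class to which integration by parts against the
Gaussian weight applies. -/
def HasExpGrowth (f : V → F) : Prop :=
  ∃ C a : ℝ, 0 ≤ C ∧ 0 ≤ a ∧ ∀ x, ‖f x‖ ≤ C * Real.exp (a * ‖x‖)

lemma HasExpGrowth.mono {F' : Type*} [NormedAddCommGroup F'] {g : V → F'} (hf : HasExpGrowth f)
    (hle : ∀ x, ‖g x‖ ≤ ‖f x‖) : HasExpGrowth g :=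
  let ⟨C, a, hC, ha, hf⟩ := hf
  ⟨C, a, hC, ha, fun x => (hle x).trans (hf x)⟩

lemma HasExpGrowth.norm (hf : HasExpGrowth f) : HasExpGrowth fun x => ‖f x‖ :=
  hf.mono fun _ => (norm_norm _).le

lemma HasExpGrowth.const (c : F) : HasExpGrowth fun _ : V => c :=
  ⟨‖c‖, 0, norm_nonneg _, le_rfl, fun x => by simp⟩

lemma HasExpGrowth.smul {𝕜 : Type*} [NormedField 𝕜] [NormedSpace 𝕜 F] {c : V → 𝕜}
    (hc : HasExpGrowth c) (hf : HasExpGrowth f) : HasExpGrowth fun x => c x • f x := by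
  obtain ⟨C, a, hC, ha, hc⟩ := hc
  obtain ⟨D, b, hD, hb, hf⟩ := hf
  refine ⟨C * D, a + b, by positivity, by positivity, fun x => ?_⟩
  calc ‖c x • f x‖ ≤ (C * Real.exp (a * ‖x‖)) * (D * Real.exp (b * ‖x‖)) := by
        rw [norm_smul]; gcongr; exacts [hc x, hf x]
    _ = C * D * Real.exp ((a + b) * ‖x‖) := by rw [add_mul, Real.exp_add]; ring

lemma HasExpGrowth.mul {𝕜 : Type*} [NormedField 𝕜] {f g : V → 𝕜} (hf : HasExpGrowth f)
    (hg : HasExpGrowth g) : HasExpGrowth fun x => f x * g x := hf.smul hg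

lemma HasExpGrowth.add (hf : HasExpGrowth f) (hg : HasExpGrowth g) :
    HasExpGrowth fun x => f x + g x := by
  obtain ⟨C, a, hC, ha, hf⟩ := hf
  obtain ⟨D, b, hD, hb, hg⟩ := hg
  refine ⟨C + D, a + b, by positivity, by positivity, fun x => ?_⟩
  calc ‖f x + g x‖ ≤ C * Real.exp (a * ‖x‖) + D * Real.exp (b * ‖x‖) :=
        (norm_add_le _ _).trans (add_le_add (hf x) (hg x))
    _ ≤ C * Real.exp ((a + b) * ‖x‖) + D * Real.exp ((a + b) * ‖x‖) := by
        gcongr <;> linarith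
    _ = (C + D) * Real.exp ((a + b) * ‖x‖) := by ring

lemma HasExpGrowth.sub (hf : HasExpGrowth f) (hg : HasExpGrowth g) :
    HasExpGrowth fun x => f x - g x := by
  simp only [sub_eq_add_neg]
  exact hf.add (hg.mono fun x => (norm_neg _).le)

lemma HasExpGrowth.sum {ι : Type*} {s : Finset ι} {f : ι → V → F}
    (hf : ∀ i ∈ s, HasExpGrowth (f i)) : HasExpGrowth fun x => ∑ i ∈ s, f i x := by
  classical
  induction s using Finset.induction_on with
  | empty => simpa using HasExpGrowth.const (0 : F)
  | insert i s hi ih =>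
    simp only [Finset.sum_insert hi]
    exact (hf i (by simp)).add (ih fun j hj => hf j (by simp [hj]))

lemma HasExpGrowth.comp_norm_eq (hf : HasExpGrowth f) {σ : V → V} (hσ : ∀ x, ‖σ x‖ = ‖x‖) :
    HasExpGrowth fun x => f (σ x) := by
  obtain ⟨C, a, hC, ha, hf⟩ := hf
  exact ⟨C, a, hC, ha, fun x => by simpa [hσ] using hf (σ x)⟩

end ExpGrowth

section GaussianGrowth

variable {V : Type*} [NormedAddCommGroup V] [InnerProductSpace ℝ V]

lemma hasExpGrowth_inner (ξ : V) : HasExpGrowth fun x => (inner ℝ ξ x : ℂ) := by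
  refine ⟨‖ξ‖, 1, norm_nonneg _, zero_le_one, fun x => ?_⟩
  calc ‖(inner ℝ ξ x : ℂ)‖ ≤ ‖ξ‖ * ‖x‖ := by
        rw [Complex.norm_real]; exact norm_inner_le_norm ξ x
    _ ≤ ‖ξ‖ * Real.exp (1 * ‖x‖) := by rw [one_mul]; gcongr; linarith [Real.add_one_le_exp ‖x‖]

lemma integrable_exp_mul_norm_mul_exp_neg_norm_sq [FiniteDimensional ℝ V] [MeasurableSpace V]
    [BorelSpace V] (a : ℝ) :
    Integrable fun x : V => Real.exp (a * ‖x‖) * Real.exp (-‖x‖ ^ 2 / 2) := by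
  have gauss := (GaussianFourier.integrable_cexp_neg_mul_sq_norm_add (V := V) (b := 1 / 4)
    (by norm_num) 0 0).norm.const_mul (Real.exp (a ^ 2))
  refine gauss.mono' (by fun_prop) (Eventually.of_forall fun x => ?_)
  have hre : (-(1 / 4 : ℂ) * (‖x‖ : ℂ) ^ 2 + 0 * (inner ℝ (0 : V) x : ℂ)).re
      = -(1 / 4) * ‖x‖ ^ 2 := by
    rw [zero_mul, add_zero, ← Complex.ofReal_re (-(1 / 4) * ‖x‖ ^ 2)]
    push_cast
    rfl
  rw [Complex.norm_exp, hre, ← Real.exp_add, ← Real.exp_add, Real.norm_eq_abs, Real.abs_exp,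
    Real.exp_le_exp]
  nlinarith [sq_nonneg (a - ‖x‖ / 2)]

end GaussianGrowth

/-! ### Gram matrices and reproducing kernels -/

section Gram

variable {𝕜 X K : Type*} [RCLike 𝕜] [NormedAddCommGroup K] [InnerProductSpace 𝕜 K]

lemma posSemidef_gram_smul_id (k : X → K) : (Matrix.of fun x y =>
    (inner 𝕜 (k x) (k y) : 𝕜) • ContinuousLinearMap.id 𝕜 𝕜).PosSemidef := by
  have criterion := (RKHS.posSemidef_tfae (K := Matrix.of fun x y =>
    (inner 𝕜 (k x) (k y) : 𝕜) • ContinuousLinearMap.id 𝕜 𝕜)).out 0 2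
  refine criterion.2 ⟨?_, fun c => ?_⟩
  · ext x y
    have adjoint_id : ContinuousLinearMap.adjoint (ContinuousLinearMap.id 𝕜 𝕜) = 1 :=
      star_one (𝕜 →L[𝕜] 𝕜)
    simp [Matrix.conjTranspose_apply, ContinuousLinearMap.star_eq_adjoint, adjoint_id]
  · suffices (c.sum fun x v => c.sum fun y w => inner 𝕜 ((Matrix.of fun x y =>
        (inner 𝕜 (k x) (k y) : 𝕜) • ContinuousLinearMap.id 𝕜 𝕜) y x v) w) =
        inner 𝕜 (c.sum fun x v => v • k x) (c.sum fun x v => v • k x) by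
      rw [this]
      exact inner_self_nonneg
    rw [Finsupp.sum_inner]
    refine Finsupp.sum_congr fun x _ => ?_
    rw [Finsupp.inner_sum]
    refine Finsupp.sum_congr fun y _ => ?_
    change inner 𝕜 ((inner 𝕜 (k y) (k x) : 𝕜) * c x) (c y) = _
    rw [inner_smul_left, inner_smul_right, RCLike.inner_apply, map_mul, inner_conj_symm]
    ring

lemma norm_linearCombination_eq_of_gram_eq {K' : Type*} [NormedAddCommGroup K']
    [InnerProductSpace 𝕜 K'] {k : X → K} {k' : X → K'}
    (h : ∀ x y, inner 𝕜 (k x) (k y) = inner 𝕜 (k' x) (k' y)) (a : X →₀ 𝕜) :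
    ‖Finsupp.linearCombination 𝕜 k a‖ = ‖Finsupp.linearCombination 𝕜 k' a‖ := by
  simp only [norm_eq_sqrt_re_inner (𝕜 := 𝕜), Finsupp.linearCombination_apply, Finsupp.sum_inner,
    Finsupp.inner_sum, inner_smul_left, inner_smul_right, h]

variable {H : Type*} [NormedAddCommGroup H] [InnerProductSpace 𝕜 H] [CompleteSpace H]
  [RKHS 𝕜 H X 𝕜]

variable (𝕜 H X) in
lemma denseRange_linearCombination_kerFun :
    DenseRange (Finsupp.linearCombination 𝕜 fun x : X => RKHS.kerFun H x (1 : 𝕜)) := by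
  rw [DenseRange, ← LinearMap.coe_range,
    Submodule.dense_iff_topologicalClosure_eq_top, eq_top_iff, ← RKHS.kerFun_dense H]
  refine Submodule.topologicalClosure_mono (Submodule.span_le.2 ?_)
  rintro _ ⟨x, v, rfl⟩
  exact ⟨Finsupp.single x v, by simp [← map_smul]⟩

/-- `k x ↦ kerFun H x` is isometric on linear combinations; the operator is the adjoint of the
extension of its inverse. -/
lemma exists_clm_apply_eq_inner [CompleteSpace K] (k : X → K)
    (hk : ∀ x y, inner 𝕜 (k x) (k y) = RKHS.kernel H x y 1) :
    ∃ A : K →L[𝕜] H, ∀ ψ x, A ψ x = inner 𝕜 (k x) ψ := by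
  set e : (X →₀ 𝕜) →ₗ[𝕜] H := Finsupp.linearCombination 𝕜 fun x => RKHS.kerFun H x (1 : 𝕜) with he
  set f : (X →₀ 𝕜) →ₗ[𝕜] K := Finsupp.linearCombination 𝕜 k with hf
  have gram_eq (x y : X) : inner 𝕜 (k x) (k y) =
      inner 𝕜 (RKHS.kerFun H x (1 : 𝕜)) (RKHS.kerFun H y (1 : 𝕜)) := by
    rw [hk, RKHS.kerFun_inner, RKHS.kerFun_apply]
    simp
  have norm_le : ∃ C, ∀ a, ‖f a‖ ≤ C * ‖e a‖ :=
    ⟨1, fun a => by rw [one_mul, norm_linearCombination_eq_of_gram_eq gram_eq]⟩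
  have extend_kerFun (x : X) : f.extendOfNorm e (RKHS.kerFun H x (1 : 𝕜)) = k x := by
    have := LinearMap.extendOfNorm_eq (denseRange_linearCombination_kerFun 𝕜 X H) norm_le
      (Finsupp.single x 1)
    simpa [he, hf] using this
  refine ⟨(f.extendOfNorm e).adjoint, fun ψ x => ?_⟩
  have := RKHS.kerFun_inner (H := H) x (1 : 𝕜) ((f.extendOfNorm e).adjoint ψ)
  rw [ContinuousLinearMap.adjoint_inner_right, extend_kerFun] at this
  simpa using this.symm

end Gram

variable {N : ℕ}

/-! ### Complexification of the root system -/

/-- The complex bilinear extension `∑ᵢ zᵢ wᵢ` of the Euclidean inner product. -/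
noncomputable def bilin (z : CSpace N) : CSpace N →L[ℂ] ℂ := ∑ i, z i • EuclideanSpace.proj i

lemma bilin_apply (z w : CSpace N) : bilin z w = ∑ i, z i * w i := by
  simp [bilin]

lemma bilin_comm (z w : CSpace N) : bilin z w = bilin w z := by
  simp [bilin_apply, mul_comm]

lemma bilin_add_left (z z' w : CSpace N) : bilin (z + z') w = bilin z w + bilin z' w := by
  rw [bilin_comm, map_add, bilin_comm w, bilin_comm w]

lemma bilin_smul_left (c : ℂ) (z w : CSpace N) : bilin (c • z) w = c * bilin z w := by
  rw [bilin_comm, map_smul, bilin_comm w, smul_eq_mul]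

lemma bilin_sub_left (z z' w : CSpace N) : bilin (z - z') w = bilin z w - bilin z' w := by
  rw [bilin_comm, map_sub, bilin_comm w, bilin_comm w]

@[simp] lemma toC_apply (x : RSpace N) (i : Fin N) : toC x i = (x i : ℂ) := rfl

@[simp] lemma conjC_apply (z : CSpace N) (i : Fin N) : conjC z i = conj (z i) := rfl

lemma toC_add (x y : RSpace N) : toC (x + y) = toC x + toC y := by ext; simp
lemma toC_sub (x y : RSpace N) : toC (x - y) = toC x - toC y := by ext; simp
lemma toC_smul (c : ℝ) (x : RSpace N) : toC (c • x) = (c : ℂ) • toC x := by ext; simp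

@[simp] lemma conjC_toC (x : RSpace N) : conjC (toC x) = toC x := by ext; simp
@[simp] lemma conjC_conjC (z : CSpace N) : conjC (conjC z) = z := by ext; simp
lemma conjC_smul (c : ℂ) (z : CSpace N) : conjC (c • z) = conj c • conjC z := by ext; simp
lemma conjC_sub (z w : CSpace N) : conjC (z - w) = conjC z - conjC w := by ext; simp
@[simp] lemma conjC_zero : conjC (0 : CSpace N) = 0 := by ext; simp

/-- `toC` as a continuous real-linear map. -/
noncomputable def toCL : RSpace N →L[ℝ] CSpace N :=
  LinearMap.toContinuousLinearMap
    { toFun := toC, map_add' := toC_add, map_smul' := fun c x => by simp [toC_smul] }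

@[simp] lemma toCL_apply (x : RSpace N) : toCL x = toC x := rfl

@[simp] lemma norm_toC (x : RSpace N) : ‖toC x‖ = ‖x‖ := by
  simp [EuclideanSpace.norm_eq]

@[simp] lemma norm_conjC (z : CSpace N) : ‖conjC z‖ = ‖z‖ := by
  simp [EuclideanSpace.norm_eq]

lemma bilin_toC (x y : RSpace N) : bilin (toC x) (toC y) = (inner ℝ x y : ℂ) := by
  simp [bilin_apply, PiLp.inner_apply, mul_comm]

lemma bilin_eq_inner (z w : CSpace N) : bilin z w = inner ℂ (conjC z) w := by
  simp [bilin_apply, PiLp.inner_apply, mul_comm]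

lemma norm_bilin_le (z w : CSpace N) : ‖bilin z w‖ ≤ ‖z‖ * ‖w‖ := by
  rw [bilin_eq_inner]
  simpa using norm_inner_le_norm (𝕜 := ℂ) (conjC z) w

lemma conj_bilin (z w : CSpace N) : conj (bilin z w) = bilin (conjC z) (conjC w) := by
  simp [bilin_apply]

lemma bilin_conjC_self (z : CSpace N) : bilin (conjC z) z = (‖z‖ : ℂ) ^ 2 := by
  rw [bilin_eq_inner, conjC_conjC, inner_self_eq_norm_sq_to_K]; rfl

lemma exists_toC_add (z : CSpace N) : ∃ x y : RSpace N, z = toC x + Complex.I • toC y := by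
  refine ⟨WithLp.toLp 2 fun i => (z i).re, WithLp.toLp 2 fun i => (z i).im, ?_⟩
  ext i
  simp [mul_comm Complex.I, Complex.re_add_im]

/-- The complexified reflection, for roots normalized by `‖α‖² = 2`. -/
noncomputable def reflC (α : RSpace N) : CSpace N →L[ℂ] CSpace N :=
  ContinuousLinearMap.id ℂ _ - (bilin (toC α)).smulRight (toC α)

lemma reflC_apply (α : RSpace N) (z : CSpace N) : reflC α z = z - bilin (toC α) z • toC α := by
  simp [reflC]

lemma rootRefl_apply {α : RSpace N} (hα : ‖α‖ ^ 2 = 2) (x : RSpace N) :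
    rootRefl α x = x - (inner ℝ α x : ℝ) • α := by
  rw [rootRefl, Submodule.reflection_orthogonal_apply, Submodule.reflection_singleton_apply]
  simp only [RCLike.ofReal_real_eq_id, id, hα]
  rw [← Nat.cast_smul_eq_nsmul ℝ, smul_smul]
  rw [neg_sub, Nat.cast_ofNat, mul_div_cancel₀ _ (two_ne_zero' ℝ)]

lemma toC_rootRefl {α : RSpace N} (hα : ‖α‖ ^ 2 = 2) (x : RSpace N) :
    toC (rootRefl α x) = reflC α (toC x) := by
  rw [rootRefl_apply hα, reflC_apply, toC_sub, toC_smul, bilin_toC]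

lemma bilin_self_of_norm_sq {α : RSpace N} (hα : ‖α‖ ^ 2 = 2) : bilin (toC α) (toC α) = 2 := by
  rw [bilin_toC, real_inner_self_eq_norm_sq, hα]; norm_num

lemma bilin_reflC_reflC {α : RSpace N} (hα : ‖α‖ ^ 2 = 2) (z w : CSpace N) :
    bilin (reflC α z) (reflC α w) = bilin z w := by
  simp only [reflC_apply, map_sub, map_smul, bilin_sub_left, bilin_smul_left, smul_eq_mul,
    bilin_self_of_norm_sq hα, bilin_comm z (toC α)]
  ring

lemma reflC_reflC {α : RSpace N} (hα : ‖α‖ ^ 2 = 2) (z : CSpace N) :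
    reflC α (reflC α z) = z := by
  simp only [reflC_apply, map_sub, map_smul, bilin_self_of_norm_sq hα]
  module

lemma conjC_reflC (α : RSpace N) (z : CSpace N) : conjC (reflC α z) = reflC α (conjC z) := by
  simp [reflC_apply, conjC_sub, conjC_smul, conj_bilin]

lemma norm_reflC {α : RSpace N} (hα : ‖α‖ ^ 2 = 2) (z : CSpace N) : ‖reflC α z‖ = ‖z‖ := by
  have h : (‖reflC α z‖ : ℂ) ^ 2 = (‖z‖ : ℂ) ^ 2 := by
    rw [← bilin_conjC_self, conjC_reflC, bilin_reflC_reflC hα, bilin_conjC_self]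
  have h' : ‖reflC α z‖ ^ 2 = ‖z‖ ^ 2 := by exact_mod_cast h
  exact (sq_eq_sq₀ (norm_nonneg _) (norm_nonneg _)).1 h'

lemma reflC_comp_reflC {α β : RSpace N} (hβ : ‖β‖ ^ 2 = 2) (z : CSpace N) :
    reflC (rootRefl β α) (reflC β z) = reflC β (reflC α z) := by
  simp only [reflC_apply _ (reflC β z), toC_rootRefl hβ, bilin_reflC_reflC hβ]
  rw [reflC_apply α z, map_sub, map_smul]

lemma rootRefl_involutive (α : RSpace N) (x : RSpace N) : rootRefl α (rootRefl α x) = x :=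
  Submodule.reflection_reflection _ x

section RootSystem

variable {R : Finset (RSpace N)} {μ : RSpace N → ℝ}

lemma IsRootSystem.rootRefl_mem (hR : IsRootSystem R) {α β : RSpace N} (hβ : β ∈ R)
    (hα : α ∈ R) : rootRefl β α ∈ R := by
  have h := hR.refl_image β hβ
  exact_mod_cast h ▸ Set.mem_image_of_mem (rootRefl β) (Finset.mem_coe.2 hα)

lemma IsMultiplicity.rootRefl_eq (hμ : IsMultiplicity R μ) {α β : RSpace N} (hβ : β ∈ R)
    (hα : α ∈ R) : μ (rootRefl β α) = μ α :=
  hμ.invariant _ (Subgroup.subset_closure ⟨β, hβ, rfl⟩) α hα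

lemma sum_rootRefl {M : Type*} [AddCommMonoid M] (hR : IsRootSystem R) {β : RSpace N}
    (hβ : β ∈ R) (f : RSpace N → M) : ∑ α ∈ R, f (rootRefl β α) = ∑ α ∈ R, f α :=
  Finset.sum_nbij' (rootRefl β) (rootRefl β) (fun _ h => hR.rootRefl_mem hβ h)
    (fun _ h => hR.rootRefl_mem hβ h) (fun _ _ => rootRefl_involutive β _)
    (fun _ _ => rootRefl_involutive β _) (fun _ _ => rfl)

end RootSystem

lemma EntireOnLines.eq_of_toC {G H : CSpace N → ℂ} (hG : EntireOnLines G) (hH : EntireOnLines H)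
    (h : ∀ x, G (toC x) = H (toC x)) (z : CSpace N) : G z = H z := by
  obtain ⟨x, y, rfl⟩ := exists_toC_add z
  have frequently_eq : ∃ᶠ l in 𝓝[≠] (0 : ℂ), G (toC x + l • toC y) = H (toC x + l • toC y) := by
    refine tendsto_one_div_add_one_nhdsNE_zero.frequently (Frequently.of_forall fun n => ?_)
    simpa [toC_add, toC_smul] using h (x + (1 / ((n : ℝ) + 1)) • y)
  exact congrFun (AnalyticOnNhd.eq_of_frequently_eq
    ((hG (toC x) (toC y)).differentiableOn.analyticOnNhd isOpen_univ)
    ((hH (toC x) (toC y)).differentiableOn.analyticOnNhd isOpen_univ) frequently_eq) Complex.I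

lemma entireOnLines_bilin (z : CSpace N) : EntireOnLines fun w => bilin z w :=
  .of_differentiable (bilin z).differentiable

lemma fderiv_comp_toC {f : CSpace N → ℂ} (hf : Differentiable ℂ f) (x ξ : RSpace N) :
    fderiv ℝ (fun x => f (toC x)) x ξ = fderiv ℂ f (toC x) (toC ξ) := by
  have h : HasFDerivAt (fun x => f (toC x)) _ x :=
    ((hf (toC x)).hasFDerivAt.restrictScalars ℝ).comp x (toCL (N := N)).hasFDerivAt
  rw [h.fderiv]
  simp

lemma inner_mul_diffQuot {α : RSpace N} (hα : ‖α‖ ^ 2 = 2) (f : RSpace N → ℂ) (x : RSpace N) :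
    (inner ℝ α x : ℂ) * diffQuot α f x = f x - f (rootRefl α x) := by
  unfold diffQuot
  split_ifs with h
  · simp [h, rootRefl_apply hα]
  · rw [mul_div_cancel₀]
    exact_mod_cast h

lemma diffQuot_comp_toC {α : RSpace N} (hα : ‖α‖ ^ 2 = 2) {f : CSpace N → ℂ}
    (hf : Differentiable ℂ f) (x : RSpace N) :
    diffQuot α (fun x => f (toC x)) x = if (inner ℝ α x : ℝ) = 0 then fderiv ℂ f (toC x) (toC α)
      else (f (toC x) - f (reflC α (toC x))) / (inner ℝ α x : ℂ) := by
  unfold diffQuot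
  simp only [fderiv_comp_toC hf, hα, toC_rootRefl hα]
  simp

/-! ### The Euler equation -/

section Euler

variable {R : Finset (RSpace N)} {μ : RSpace N → ℝ} {w : CSpace N} {f g : CSpace N → ℂ}

/-- The Dunkl operator `T_ξ` at the point `z`, in the direction `ξ = z`. There the denominators
`⟨α, z⟩` cancel, so that it makes sense for functions on `ℂᴺ` that are holomorphic on complex lines
through the origin. -/
noncomputable def eulerOp (R : Finset (RSpace N)) (μ : RSpace N → ℝ) (f : CSpace N → ℂ)
    (z : CSpace N) : ℂ :=
  deriv (fun l : ℂ => f (l • z)) 1 + (1 / 2) * ∑ α ∈ R, (μ α : ℂ) * (f z - f (reflC α z))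

/-- `n!` times the homogeneous part of degree `n` of `f` at the origin. -/
noncomputable def radialDeriv (n : ℕ) (f : CSpace N → ℂ) (z : CSpace N) : ℂ :=
  iteratedDeriv n (fun l : ℂ => f (l • z)) 0

/-- The solutions of the joint eigenvalue equation `T_ξ f = ⟨ξ, w⟩ f` satisfy its contraction
`eulerOp R μ f z = ⟨z, w⟩ f z`, and this contraction already has unique solutions. -/
structure IsEulerSolution (R : Finset (RSpace N)) (μ : RSpace N → ℝ) (w : CSpace N)
    (f : CSpace N → ℂ) : Prop where
  differentiable : ∀ z, Differentiable ℂ fun l : ℂ => f (l • z)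
  bounded : ∀ r : ℝ, ∃ C, ∀ z, ‖z‖ ≤ r → ‖f z‖ ≤ C
  equation : ∀ z, eulerOp R μ f z = bilin z w * f z

lemma deriv_comp_smul_smul (f : CSpace N → ℂ) (c : ℂ) (z : CSpace N) :
    deriv (fun l : ℂ => f (l • c • z)) 1 = c * deriv (fun l : ℂ => f (l • z)) c := by
  simpa [smul_smul, mul_comm c] using deriv_comp_mul_left c (fun l : ℂ => f (l • z)) 1

lemma eulerOp_smul (f : CSpace N → ℂ) (c : ℂ) (z : CSpace N) :
    eulerOp R μ (fun z => f (c • z)) z = eulerOp R μ f (c • z) := by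
  simp only [eulerOp, map_smul, smul_comm c]

lemma deriv_comp_smul_one (hf : Differentiable ℂ f) (z : CSpace N) :
    deriv (fun l : ℂ => f (l • z)) 1 = fderiv ℂ f z z := by
  simpa using (hasDerivAt_comp_line hf 0 z 1).deriv

lemma dunklOp_comp_toC_self (hR : IsRootSystem R) (hf : Differentiable ℂ f) (x : RSpace N) :
    dunklOp R μ x (fun x => f (toC x)) x = eulerOp R μ f (toC x) := by
  rw [dunklOp, eulerOp, fderiv_comp_toC hf, deriv_comp_smul_one hf]
  congr 2
  refine Finset.sum_congr rfl fun α hα => ?_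
  rw [mul_assoc, inner_mul_diffQuot (hR.norm_sq α hα), toC_rootRefl (hR.norm_sq α hα)]

lemma EntireOnLines.eulerOp (hf : Differentiable ℂ f) : EntireOnLines (eulerOp R μ f) := by
  have hrefl (α : RSpace N) : Differentiable ℂ fun z => f (reflC α z) :=
    hf.comp (reflC α).differentiable
  refine .add (fun a b => ?_) (.const_mul (.sum fun α _ =>
    .const_mul (.sub (.of_differentiable hf) (.of_differentiable (hrefl α))) _) _)
  exact differentiable_deriv_of_prod (g := fun p : ℂ × ℂ => f (p.1 • (a + p.2 • b)))
    (by fun_prop) 1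

namespace IsEulerSolution

lemma of_differentiable (hf : Differentiable ℂ f)
    (h : ∀ z, Dunkl.eulerOp R μ f z = bilin z w * f z) : IsEulerSolution R μ w f where
  differentiable z := by fun_prop
  bounded r := by
    obtain ⟨C, hC⟩ := (isCompact_closedBall (0 : CSpace N) r).exists_bound_of_continuousOn
      hf.continuous.continuousOn
    exact ⟨C, fun z hz => hC z (by simpa using hz)⟩
  equation := h

lemma equation_smul (hf : IsEulerSolution R μ w f) (z : CSpace N) (l : ℂ) :
    l * deriv (fun l : ℂ => f (l • z)) l +
      (1 / 2) * ∑ α ∈ R, (μ α : ℂ) * (f (l • z) - f (l • reflC α z)) =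
        bilin z w * (l * f (l • z)) := by
  have h := hf.equation (l • z)
  simp only [eulerOp, deriv_comp_smul_smul, map_smul, bilin_smul_left] at h
  rw [h]
  ring

lemma contDiffAt_smul (hf : IsEulerSolution R μ w f) (z : CSpace N) (n : ℕ) (l : ℂ) :
    ContDiffAt ℂ n (fun l : ℂ => f (l • z)) l :=
  (hf.differentiable z).contDiff.contDiffAt

lemma radialDeriv_succ (hf : IsEulerSolution R μ w f) (n : ℕ) (z : CSpace N) :
    (n + 1) * radialDeriv (n + 1) f z + (1 / 2) * ∑ α ∈ R, (μ α : ℂ) *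
      (radialDeriv (n + 1) f z - radialDeriv (n + 1) f (reflC α z)) =
        bilin z w * ((n + 1) * radialDeriv n f z) := by
  have hderiv : ContDiffAt ℂ (n + 1 : ℕ) (deriv fun l : ℂ => f (l • z)) 0 :=
    (hf.differentiable z).deriv.contDiff.contDiffAt
  have hsub (α : RSpace N) : ContDiffAt ℂ (n + 1 : ℕ)
      (fun l : ℂ => f (l • z) - f (l • reflC α z)) 0 :=
    (hf.contDiffAt_smul z _ 0).sub (hf.contDiffAt_smul _ _ 0)
  have h := congrArg (fun g => iteratedDeriv (n + 1) g 0) (funext (hf.equation_smul z))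
  rw [iteratedDeriv_fun_add (contDiffAt_fun_id.mul hderiv)
      (contDiffAt_const.mul (.sum fun α _ => contDiffAt_const.mul (hsub α))),
    iteratedDeriv_const_mul_field, iteratedDeriv_const_mul_field,
    iteratedDeriv_fun_sum fun α _ => contDiffAt_const.mul (hsub α),
    iteratedDeriv_succ_id_mul hderiv, iteratedDeriv_succ_id_mul (hf.contDiffAt_smul z _ 0)] at h
  have hterm (α : RSpace N) : iteratedDeriv (n + 1)
      (fun l : ℂ => (μ α : ℂ) * (f (l • z) - f (l • reflC α z))) 0 =
        μ α * (radialDeriv (n + 1) f z - radialDeriv (n + 1) f (reflC α z)) := by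
    rw [iteratedDeriv_const_mul_field, iteratedDeriv_fun_sub (hf.contDiffAt_smul z _ 0)
      (hf.contDiffAt_smul _ _ 0)]
    rfl
  simp only [hterm, zero_mul, zero_add, ← iteratedDeriv_succ'] at h
  exact_mod_cast h

lemma norm_radialDeriv_le_of_norm_le {f : CSpace N → ℂ} {z : CSpace N}
    (hf : Differentiable ℂ fun l : ℂ => f (l • z)) {C : ℝ} (hC : ∀ y, ‖y‖ = ‖z‖ → ‖f y‖ ≤ C)
    (n : ℕ) : ‖radialDeriv n f z‖ ≤ n.factorial * C := by
  have hsphere (l : ℂ) (hl : l ∈ Metric.sphere 0 1) : ‖f (l • z)‖ ≤ C :=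
    hC _ (by rw [norm_smul, mem_sphere_zero_iff_norm.1 hl, one_mul])
  simpa [radialDeriv] using Complex.norm_iteratedDeriv_le_of_forall_mem_sphere_norm_le n one_pos
    hf.diffContOnCl hsphere

lemma norm_radialDeriv_le (hR : IsRootSystem R) (hμ : IsMultiplicity R μ)
    (hf : IsEulerSolution R μ w f) (n : ℕ) (z : CSpace N) :
    ‖radialDeriv n f z‖ ≤ (‖z‖ * ‖w‖) ^ n * ‖f 0‖ := by
  induction n generalizing z with
  | zero => simp [radialDeriv]
  | succ n ih =>
    obtain ⟨C, hC⟩ := hf.bounded ‖z‖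
    refine norm_le_of_norm_smul_add_sum_sub_le (s := R) (k := fun α => μ α / 2)
      (σ := fun α => reflC α) (S := {y | ‖y‖ = ‖z‖}) (n := n + 1)
      (fun α hα => div_nonneg (hμ.nonneg α hα) zero_le_two)
      (fun α hα y hy => (norm_reflC (hR.norm_sq α hα) y).trans hy)
      ⟨(n + 1).factorial * C, Set.forall_mem_image.2 fun y hy => norm_radialDeriv_le_of_norm_le
        (hf.differentiable y) (fun x hx => hC x (hx.trans hy).le) _⟩
      (by positivity) (fun y hy => ?_) rfl
    have h := hf.radialDeriv_succ n y
    rw [Finset.mul_sum] at h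
    calc _ = ‖bilin y w * ((n + 1) * radialDeriv n f y)‖ := by
          rw [← h]
          congr 2
          · simp
          · exact Finset.sum_congr rfl fun α _ => by rw [Complex.real_smul]; push_cast; ring
      _ ≤ (‖y‖ * ‖w‖) * ((n + 1) * ((‖y‖ * ‖w‖) ^ n * ‖f 0‖)) := by
          rw [norm_mul, norm_mul, show ‖(n + 1 : ℂ)‖ = n + 1 by
            exact_mod_cast Complex.norm_natCast (n + 1)]
          gcongr
          exacts [norm_bilin_le y w, ih y]
      _ = (n + 1) * ((‖z‖ * ‖w‖) ^ (n + 1) * ‖f 0‖) := by rw [show ‖y‖ = ‖z‖ from hy]; ring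

lemma norm_le (hR : IsRootSystem R) (hμ : IsMultiplicity R μ) (hf : IsEulerSolution R μ w f)
    (z : CSpace N) : ‖f z‖ ≤ ‖f 0‖ * Real.exp (‖z‖ * ‖w‖) := by
  have taylor := Complex.hasSum_taylorSeries_of_entire (hf.differentiable z) 0 1
  have exp_series := (NormedSpace.expSeries_div_hasSum_exp (𝔸 := ℝ) (‖z‖ * ‖w‖)).mul_left ‖f 0‖
  rw [← Real.exp_eq_exp_ℝ] at exp_series
  suffices ∀ n : ℕ, ‖((n.factorial : ℂ)⁻¹ • ((1 : ℂ) - 0) ^ n • radialDeriv n f z)‖ ≤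
      ‖f 0‖ * ((‖z‖ * ‖w‖) ^ n / n.factorial) by
    simpa using taylor.norm_le_of_bounded exp_series this
  intro n
  calc _ = (n.factorial : ℝ)⁻¹ * ‖radialDeriv n f z‖ := by simp
    _ ≤ (n.factorial : ℝ)⁻¹ * ((‖z‖ * ‖w‖) ^ n * ‖f 0‖) := by
        gcongr; exact hf.norm_radialDeriv_le hR hμ n z
    _ = ‖f 0‖ * ((‖z‖ * ‖w‖) ^ n / n.factorial) := by ring

lemma sub (hf : IsEulerSolution R μ w f) (hg : IsEulerSolution R μ w g) :
    IsEulerSolution R μ w (fun z => f z - g z) where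
  differentiable z := (hf.differentiable z).sub (hg.differentiable z)
  bounded r := by
    obtain ⟨C, hC⟩ := hf.bounded r
    obtain ⟨D, hD⟩ := hg.bounded r
    exact ⟨C + D, fun z hz => (norm_sub_le _ _).trans (add_le_add (hC z hz) (hD z hz))⟩
  equation z := by
    have hfz := hf.equation z
    have hgz := hg.equation z
    simp only [eulerOp, mul_sub, Finset.sum_sub_distrib] at hfz hgz ⊢
    rw [deriv_fun_sub (hf.differentiable z 1) (hg.differentiable z 1)]
    linear_combination hfz - hgz

lemma const_mul (hf : IsEulerSolution R μ w f) (c : ℂ) :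
    IsEulerSolution R μ w (fun z => c * f z) where
  differentiable z := (hf.differentiable z).const_mul c
  bounded r := by
    obtain ⟨C, hC⟩ := hf.bounded r
    exact ⟨‖c‖ * C, fun z hz => by rw [norm_mul]; gcongr; exact hC z hz⟩
  equation z := by
    rw [mul_left_comm, ← hf.equation z, eulerOp, deriv_const_mul _ (hf.differentiable z 1)]
    simp only [← mul_sub, mul_left_comm _ c, ← Finset.mul_sum, ← mul_add, eulerOp]

lemma eq_of_apply_zero_eq (hR : IsRootSystem R) (hμ : IsMultiplicity R μ)
    (hf : IsEulerSolution R μ w f) (hg : IsEulerSolution R μ w g) (h0 : f 0 = g 0) : f = g := by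
  ext z
  simpa [h0, sub_eq_zero] using (hf.sub hg).norm_le hR hμ z

lemma comp_smul (hf : IsEulerSolution R μ w f) (c : ℂ) :
    IsEulerSolution R μ (c • w) (fun z => f (c • z)) where
  differentiable z := by simpa only [smul_comm c] using hf.differentiable (c • z)
  bounded r := by
    obtain ⟨C, hC⟩ := hf.bounded (‖c‖ * r)
    exact ⟨C, fun z hz => hC _ (by rw [norm_smul]; gcongr)⟩
  equation z := by
    rw [eulerOp_smul, hf.equation, bilin_smul_left, map_smul, smul_eq_mul]

lemma comp_reflC (hR : IsRootSystem R) (hμ : IsMultiplicity R μ) (hf : IsEulerSolution R μ w f)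
    {β : RSpace N} (hβ : β ∈ R) : IsEulerSolution R μ (reflC β w) (fun z => f (reflC β z)) where
  differentiable z := by simpa only [map_smul] using hf.differentiable (reflC β z)
  bounded r := by
    obtain ⟨C, hC⟩ := hf.bounded r
    exact ⟨C, fun z hz => hC _ (by rwa [norm_reflC (hR.norm_sq β hβ)])⟩
  equation z := by
    have hβ2 := hR.norm_sq β hβ
    have h := hf.equation (reflC β z)
    rw [← bilin_reflC_reflC hβ2, reflC_reflC hβ2, eulerOp, ← sum_rootRefl hR hβ] at h
    rw [← h, eulerOp]
    simp only [map_smul]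
    congr 2
    refine Finset.sum_congr rfl fun α hα => ?_
    rw [hμ.rootRefl_eq hβ hα, reflC_comp_reflC hβ2]

lemma conj_comp_conjC (hf : IsEulerSolution R μ w f) :
    IsEulerSolution R μ (conjC w) (fun z => conj (f (conjC z))) := by
  have hderiv (z : CSpace N) (l : ℂ) : HasDerivAt (fun l : ℂ => conj (f (conjC (l • z))))
      (conj (deriv (fun l : ℂ => f (l • conjC z)) (conj l))) l := by
    simpa [Function.comp_def, conjC_smul] using
      (hf.differentiable (conjC z) (conj l)).hasDerivAt.conj_conj
  refine ⟨fun z l => (hderiv z l).differentiableAt, fun r => ?_, fun z => ?_⟩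
  · obtain ⟨C, hC⟩ := hf.bounded r
    exact ⟨C, fun z hz => by rw [RCLike.norm_conj]; exact hC _ (by rwa [norm_conjC])⟩
  · have h := congrArg conj (hf.equation (conjC z))
    rw [eulerOp] at h ⊢
    rw [(hderiv z 1).deriv]
    simpa [conjC_reflC, conj_bilin, Complex.conj_ofNat] using h

end IsEulerSolution

end Euler

/-! ### The Dunkl kernel -/

section Kernel

variable {R : Finset (RSpace N)} {μ : RSpace N → ℝ} {E : CSpace N → CSpace N → ℂ}

/-- Holomorphic kernels satisfying the contracted eigenvalue equation on all of `ℂᴺ × ℂᴺ`. -/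
structure IsEulerKernel (R : Finset (RSpace N)) (μ : RSpace N → ℝ)
    (E : CSpace N → CSpace N → ℂ) : Prop where
  holomorphic : Differentiable ℂ fun p : CSpace N × CSpace N => E p.1 p.2
  equation : ∀ z w, eulerOp R μ (fun z => E z w) z = bilin z w * E z w
  normalized : ∀ w, E 0 w = 1

lemma differentiable_left (hE : Differentiable ℂ fun p : CSpace N × CSpace N => E p.1 p.2)
    (w : CSpace N) : Differentiable ℂ fun z => E z w :=
  hE.comp (differentiable_id.prodMk (differentiable_const w))

lemma differentiable_right (hE : Differentiable ℂ fun p : CSpace N × CSpace N => E p.1 p.2)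
    (z : CSpace N) : Differentiable ℂ fun w => E z w :=
  hE.comp ((differentiable_const z).prodMk differentiable_id)

lemma entireOnLines_fderiv_left (hE : Differentiable ℂ fun p : CSpace N × CSpace N => E p.1 p.2)
    (z v : CSpace N) : EntireOnLines fun w => fderiv ℂ (fun z => E z w) z v := by
  have hderiv (w : CSpace N) :
      fderiv ℂ (fun z => E z w) z v = deriv (fun l : ℂ => E (z + l • v) w) 0 := by
    simpa using (hasDerivAt_comp_line (differentiable_left hE w) z v 0).deriv.symm
  intro a b
  simp only [hderiv]
  exact differentiable_deriv_of_prod (g := fun p => E (z + p.1 • v) (a + p.2 • b))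
    (hE.comp (f := fun p : ℂ × ℂ => (z + p.1 • v, a + p.2 • b)) (by fun_prop)) 0

lemma entireOnLines_eulerOp_left (hE : Differentiable ℂ fun p : CSpace N × CSpace N => E p.1 p.2)
    (z : CSpace N) : EntireOnLines fun w => eulerOp R μ (fun z => E z w) z := by
  have hEz (z : CSpace N) : EntireOnLines fun w => E z w :=
    .of_differentiable (differentiable_right hE z)
  simp only [eulerOp, deriv_comp_smul_one (differentiable_left hE _)]
  exact (entireOnLines_fderiv_left hE z z).add
    (.const_mul (.sum fun α _ => ((hEz z).sub (hEz _)).const_mul _) _)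

lemma isEulerKernel_of_eigen (hR : IsRootSystem R)
    (hE : Differentiable ℂ fun p : CSpace N × CSpace N => E p.1 p.2)
    (eigen : ∀ x y ξ : RSpace N, dunklOp R μ ξ (fun x' => E (toC x') (toC y)) x
      = (inner ℝ ξ y : ℂ) * E (toC x) (toC y))
    (normalized : ∀ y : RSpace N, E 0 (toC y) = 1) : IsEulerKernel R μ E := by
  have hEz (z : CSpace N) : EntireOnLines fun w => E z w :=
    .of_differentiable (differentiable_right hE z)
  have equation_toC_toC (x y : RSpace N) : eulerOp R μ (fun z => E z (toC y)) (toC x) =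
      bilin (toC x) (toC y) * E (toC x) (toC y) := by
    rw [← dunklOp_comp_toC_self hR (differentiable_left hE _), eigen, bilin_toC]
  have equation_toC (x : RSpace N) : ∀ w, eulerOp R μ (fun z => E z w) (toC x) =
      bilin (toC x) w * E (toC x) w :=
    (entireOnLines_eulerOp_left hE _).eq_of_toC ((entireOnLines_bilin _).mul (hEz _))
      (equation_toC_toC x)
  refine ⟨hE, fun z w => ?_, ?_⟩
  · refine EntireOnLines.eq_of_toC (G := eulerOp R μ fun z => E z w)
      (H := fun z => bilin z w * E z w) (.eulerOp (differentiable_left hE w)) (.mul ?_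
      (.of_differentiable (differentiable_left hE w))) (fun x => equation_toC x w) z
    simpa only [bilin_comm w] using entireOnLines_bilin w
  · exact (hEz 0).eq_of_toC (.of_differentiable (differentiable_const 1)) normalized

lemma IsDunklKernel.isEulerKernel (hR : IsRootSystem R) (hE : IsDunklKernel R μ E) :
    IsEulerKernel R μ E :=
  isEulerKernel_of_eigen hR hE.holomorphic hE.eigen hE.normalized

lemma IsDunklKernel.dunklOp_eq (hR : IsRootSystem R) (hE : IsDunklKernel R μ E) (x ξ : RSpace N)
    (w : CSpace N) : dunklOp R μ ξ (fun x => E (toC x) w) x = bilin (toC ξ) w * E (toC x) w := by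
  have hEz (z : CSpace N) : EntireOnLines fun w => E z w :=
    .of_differentiable (differentiable_right hE.holomorphic z)
  have hdiffQuot (α : RSpace N) (hα : α ∈ R) :
      EntireOnLines fun w => diffQuot α (fun x => E (toC x) w) x := by
    simp only [diffQuot_comp_toC (hR.norm_sq α hα) (differentiable_left hE.holomorphic _)]
    split_ifs
    · exact entireOnLines_fderiv_left hE.holomorphic _ _
    · exact ((hEz _).sub (hEz _)).div_const _
  refine EntireOnLines.eq_of_toC (G := fun w => dunklOp R μ ξ (fun x => E (toC x) w) x) ?_
    ((entireOnLines_bilin _).mul (hEz _)) (fun y => by rw [hE.eigen, bilin_toC]) w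
  simp only [dunklOp, fderiv_comp_toC (differentiable_left hE.holomorphic _)]
  exact (entireOnLines_fderiv_left hE.holomorphic _ _).add
    (.const_mul (.sum fun α hα => (hdiffQuot α hα).const_mul _) _)

namespace IsEulerKernel

lemma isEulerSolution (hE : IsEulerKernel R μ E) (w : CSpace N) :
    IsEulerSolution R μ w (fun z => E z w) :=
  .of_differentiable (differentiable_left hE.holomorphic w) fun z => hE.equation z w

lemma norm_le (hR : IsRootSystem R) (hμ : IsMultiplicity R μ) (hE : IsEulerKernel R μ E)
    (z w : CSpace N) : ‖E z w‖ ≤ Real.exp (‖z‖ * ‖w‖) := by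
  simpa [hE.normalized] using (hE.isEulerSolution w).norm_le hR hμ z

lemma eq_of_isEulerSolution (hR : IsRootSystem R) (hμ : IsMultiplicity R μ)
    (hE : IsEulerKernel R μ E) {w : CSpace N} {f : CSpace N → ℂ} (hf : IsEulerSolution R μ w f)
    (z : CSpace N) : f z = f 0 * E z w := by
  refine congrFun (hf.eq_of_apply_zero_eq hR hμ ((hE.isEulerSolution w).const_mul (f 0)) ?_) z
  rw [hE.normalized, mul_one]

lemma smul_left (hR : IsRootSystem R) (hμ : IsMultiplicity R μ) (hE : IsEulerKernel R μ E)
    (c : ℂ) (z w : CSpace N) : E (c • z) w = E z (c • w) := by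
  simpa [hE.normalized] using
    hE.eq_of_isEulerSolution hR hμ ((hE.isEulerSolution w).comp_smul c) z

lemma apply_reflC_reflC (hR : IsRootSystem R) (hμ : IsMultiplicity R μ) (hE : IsEulerKernel R μ E)
    {β : RSpace N} (hβ : β ∈ R) (z w : CSpace N) : E (reflC β z) (reflC β w) = E z w := by
  simpa [hE.normalized, reflC_reflC (hR.norm_sq β hβ)] using
    hE.eq_of_isEulerSolution hR hμ ((hE.isEulerSolution (reflC β w)).comp_reflC hR hμ hβ) z

lemma apply_zero_right (hR : IsRootSystem R) (hμ : IsMultiplicity R μ) (hE : IsEulerKernel R μ E)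
    (z : CSpace N) : E z 0 = 1 := by
  simpa [hE.normalized] using (hE.smul_left hR hμ 0 z 0).symm

lemma isEulerSolution_right (hR : IsRootSystem R) (hμ : IsMultiplicity R μ)
    (hE : IsEulerKernel R μ E) (w : CSpace N) : IsEulerSolution R μ w (fun z => E w z) := by
  refine .of_differentiable (differentiable_right hE.holomorphic w) fun z => ?_
  rw [bilin_comm, ← hE.equation, eulerOp, eulerOp]
  simp only [hE.smul_left hR hμ]
  congr 2
  refine Finset.sum_congr rfl fun α hα => ?_
  rw [← hE.apply_reflC_reflC hR hμ hα (reflC α w) z, reflC_reflC (hR.norm_sq α hα)]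

lemma symm (hR : IsRootSystem R) (hμ : IsMultiplicity R μ) (hE : IsEulerKernel R μ E)
    (z w : CSpace N) : E z w = E w z := by
  simpa [hE.apply_zero_right hR hμ] using
    (hE.eq_of_isEulerSolution hR hμ (hE.isEulerSolution_right hR hμ w) z).symm

lemma conj_eq (hR : IsRootSystem R) (hμ : IsMultiplicity R μ) (hE : IsEulerKernel R μ E)
    (z w : CSpace N) : conj (E z w) = E (conjC z) (conjC w) := by
  simpa [hE.normalized] using
    hE.eq_of_isEulerSolution hR hμ (hE.isEulerSolution w).conj_comp_conjC (conjC z)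

end IsEulerKernel

end Kernel

/-! ### Integration by parts for the Dunkl operators -/

section IntegrationByParts

variable {R : Finset (RSpace N)} {μ : RSpace N → ℝ} {α β : RSpace N} {f g : RSpace N → ℂ} {ε : ℝ}

lemma inner_rootRefl_rootRefl (β x y : RSpace N) :
    (inner ℝ (rootRefl β x) (rootRefl β y) : ℝ) = inner ℝ x y :=
  (rootRefl β).inner_map_map x y

lemma inner_rootRefl_self_right (hα : ‖α‖ ^ 2 = 2) (x : RSpace N) :
    (inner ℝ α (rootRefl α x) : ℝ) = -inner ℝ α x := by
  rw [rootRefl_apply hα, inner_sub_right, inner_smul_right, real_inner_self_eq_norm_sq, hα]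
  ring

lemma rootRefl_eq_self (hα : ‖α‖ ^ 2 = 2) {x : RSpace N} (hx : (inner ℝ α x : ℝ) = 0) :
    rootRefl α x = x := by
  rw [rootRefl_apply hα, hx, zero_smul, sub_zero]

lemma integral_eq_zero_of_rootRefl_eq_neg {F : RSpace N → ℂ} (α : RSpace N)
    (hF : ∀ x, F (rootRefl α x) = -F x) : ∫ x, F x = 0 := by
  rw [← self_eq_neg, ← integral_neg]
  simp only [← hF]
  exact ((rootRefl α).measurePreserving.integral_comp' (f := (rootRefl α).toMeasurableEquiv) F).symm

/-- The Gaussian density times the weight `∏ |⟨α, x⟩|^{μ(α)}`, the latter made smooth by a parameter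
`ε > 0`; for `ε = 0` there is no regularization. -/
noncomputable def gaussWeight (R : Finset (RSpace N)) (μ : RSpace N → ℝ) (ε : ℝ)
    (x : RSpace N) : ℝ :=
  Real.exp (-‖x‖ ^ 2 / 2) * ∏ α ∈ R, ((inner ℝ α x : ℝ) ^ 2 + ε) ^ (μ α / 2)

lemma gaussWeight_nonneg (hε : 0 ≤ ε) (x : RSpace N) : 0 ≤ gaussWeight R μ ε x :=
  mul_nonneg (Real.exp_nonneg _) (Finset.prod_nonneg fun _ _ => by positivity)

lemma gaussWeight_rootRefl (hR : IsRootSystem R) (hμ : IsMultiplicity R μ) (hβ : β ∈ R) (ε : ℝ)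
    (x : RSpace N) : gaussWeight R μ ε (rootRefl β x) = gaussWeight R μ ε x := by
  unfold gaussWeight
  rw [LinearIsometryEquiv.norm_map]
  congr 1
  refine Finset.prod_nbij' (rootRefl β) (rootRefl β) (fun _ h => hR.rootRefl_mem hβ h)
    (fun _ h => hR.rootRefl_mem hβ h) (fun _ _ => rootRefl_involutive β _)
    (fun _ _ => rootRefl_involutive β _) (fun α hα => ?_)
  rw [hμ.rootRefl_eq hβ hα, ← inner_rootRefl_rootRefl β α (rootRefl β x), rootRefl_involutive]

lemma continuous_gaussWeight (hμ : IsMultiplicity R μ) :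
    Continuous fun p : ℝ × RSpace N => gaussWeight R μ p.1 p.2 := by
  refine Continuous.mul (by fun_prop) (continuous_finsetProd _ fun α hα => ?_)
  exact Continuous.rpow_const (by fun_prop) fun _ => .inr (div_nonneg (hμ.nonneg α hα) zero_le_two)

lemma continuous_ofReal_gaussWeight (hμ : IsMultiplicity R μ) (ε : ℝ) :
    Continuous fun x => (gaussWeight R μ ε x : ℂ) := by
  have h := (continuous_gaussWeight (N := N) hμ).comp (Continuous.prodMk_right ε)
  exact Complex.continuous_ofReal.comp h

lemma gaussWeight_le (hR : IsRootSystem R) (hμ : IsMultiplicity R μ) (hε : 0 ≤ ε) (hε1 : ε ≤ 1)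
    (x : RSpace N) :
    gaussWeight R μ ε x ≤ Real.exp (-‖x‖ ^ 2 / 2) * Real.exp ((2 * ∑ α ∈ R, μ α) * ‖x‖) := by
  rw [Finset.mul_sum, Finset.sum_mul, Real.exp_sum]
  refine mul_le_mul_of_nonneg_left (Finset.prod_le_prod (fun _ _ => by positivity)
    fun α hα => ?_) (Real.exp_nonneg _)
  have inner_sq_le : (inner ℝ α x : ℝ) ^ 2 ≤ 2 * ‖x‖ ^ 2 := by
    rw [← hR.norm_sq α hα, ← mul_pow, ← sq_abs]
    gcongr
    exact abs_real_inner_le_norm α x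
  have base_le : (inner ℝ α x : ℝ) ^ 2 + ε ≤ Real.exp (4 * ‖x‖) := by
    have := Real.quadratic_le_exp_of_nonneg (x := 4 * ‖x‖) (by positivity)
    nlinarith [norm_nonneg x]
  calc ((inner ℝ α x : ℝ) ^ 2 + ε) ^ (μ α / 2) ≤ (Real.exp (4 * ‖x‖)) ^ (μ α / 2) :=
        Real.rpow_le_rpow (by positivity) base_le (div_nonneg (hμ.nonneg α hα) zero_le_two)
    _ = Real.exp (2 * μ α * ‖x‖) := by rw [← Real.exp_mul]; ring_nf

lemma HasExpGrowth.exists_integrable_bound {F : Type*} [NormedAddCommGroup F]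
    (hR : IsRootSystem R) (hμ : IsMultiplicity R μ) {h : RSpace N → F} (hh : HasExpGrowth h) :
    ∃ b : RSpace N → ℝ, Integrable b ∧
      ∀ ε, 0 ≤ ε → ε ≤ 1 → ∀ x, ‖h x‖ * gaussWeight R μ ε x ≤ b x := by
  obtain ⟨C, a, hC, _, hle⟩ := hh
  refine ⟨_, (integrable_exp_mul_norm_mul_exp_neg_norm_sq (a + 2 * ∑ α ∈ R, μ α)).const_mul C,
    fun ε hε hε1 x => ?_⟩
  calc ‖h x‖ * gaussWeight R μ ε x
      ≤ (C * Real.exp (a * ‖x‖)) *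
        (Real.exp (-‖x‖ ^ 2 / 2) * Real.exp ((2 * ∑ α ∈ R, μ α) * ‖x‖)) := by
        have := gaussWeight_nonneg (R := R) (μ := μ) hε x
        gcongr
        exacts [hle x, gaussWeight_le hR hμ hε hε1 x]
    _ = _ := by rw [add_mul, Real.exp_add]; ring

lemma norm_mul_gaussWeight (hε : 0 ≤ ε) (c : ℂ) (x : RSpace N) :
    ‖c * (gaussWeight R μ ε x : ℂ)‖ = ‖c‖ * gaussWeight R μ ε x := by
  rw [norm_mul, Complex.norm_real, Real.norm_of_nonneg (gaussWeight_nonneg hε x)]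

lemma HasExpGrowth.integrable_mul_gaussWeight (hR : IsRootSystem R) (hμ : IsMultiplicity R μ)
    {h : RSpace N → ℂ} (hh : HasExpGrowth h) (hm : AEStronglyMeasurable h) (hε : 0 ≤ ε)
    (hε1 : ε ≤ 1) : Integrable fun x => h x * (gaussWeight R μ ε x : ℂ) := by
  obtain ⟨b, hb, hle⟩ := hh.exists_integrable_bound hR hμ
  refine hb.mono' (hm.mul (continuous_ofReal_gaussWeight hμ ε).aestronglyMeasurable)
    (.of_forall fun x => ?_)
  rw [norm_mul_gaussWeight hε]
  exact hle ε hε hε1 x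

/-- A bounded odd regularization of `a ↦ a⁻¹`, which is the logarithmic derivative of
`(a² + ε)^(1/2)`. -/
noncomputable def regInv (ε a : ℝ) : ℝ := a / (a ^ 2 + ε)

lemma regInv_neg (ε a : ℝ) : regInv ε (-a) = -regInv ε a := by
  rw [regInv, regInv, neg_sq, neg_div]

lemma abs_regInv_le (hε : 0 < ε) (a : ℝ) : |regInv ε a| ≤ |ε⁻¹| * |a| := by
  rw [regInv, abs_div, abs_of_pos (show 0 < a ^ 2 + ε by positivity), abs_of_pos (inv_pos.2 hε),
    inv_mul_eq_div]
  gcongr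
  nlinarith [sq_nonneg a]

lemma abs_regInv_mul_self_le (hε : 0 ≤ ε) (a : ℝ) : |regInv ε a * a| ≤ 1 := by
  rw [regInv, div_mul_eq_mul_div, ← sq, abs_of_nonneg (by positivity)]
  exact div_le_one_of_le₀ (by linarith) (by positivity)

lemma continuous_regInv (hε : 0 < ε) : Continuous (regInv ε) :=
  continuous_id.div (by fun_prop) fun a => by positivity

lemma tendsto_regInv_mul_self {a : ℝ} (ha : a ≠ 0) :
    Tendsto (fun ε => regInv ε a * a) (𝓝[>] 0) (𝓝 1) := by
  have h : ContinuousAt (fun ε => regInv ε a * a) 0 :=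
    (continuousAt_const.div (by fun_prop) (by simpa using ha)).mul continuousAt_const
  convert! h.tendsto.mono_left nhdsWithin_le_nhds using 2
  rw [regInv]
  field_simp
  simp

lemma hasExpGrowth_regInv_inner (hε : 0 < ε) (α : RSpace N) :
    HasExpGrowth fun x => (regInv ε (inner ℝ α x) : ℂ) := by
  refine ((HasExpGrowth.const ((ε⁻¹ : ℝ) : ℂ)).mul (hasExpGrowth_inner α)).mono fun x => ?_
  simpa only [norm_mul, Complex.norm_real, Real.norm_eq_abs] using abs_regInv_le hε _

lemma continuous_regInv_inner (hε : 0 < ε) (α : RSpace N) :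
    Continuous fun x => (regInv ε (inner ℝ α x) : ℂ) :=
  Complex.continuous_ofReal.comp ((continuous_regInv hε).comp (by fun_prop))

lemma hasLineDerivAt_gaussWeight (hε : 0 < ε) (x ξ : RSpace N) :
    HasLineDerivAt ℝ (gaussWeight R μ ε) (gaussWeight R μ ε x * (-(inner ℝ ξ x : ℝ) +
      ∑ α ∈ R, μ α * (inner ℝ α ξ : ℝ) * regInv ε (inner ℝ α x))) x ξ := by
  have eq_exp (y : RSpace N) : gaussWeight R μ ε y = Real.exp (-(inner ℝ y y : ℝ) / 2 +
      ∑ α ∈ R, Real.log ((inner ℝ α y : ℝ) ^ 2 + ε) * (μ α / 2)) := by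
    rw [Real.exp_add, Real.exp_sum, gaussWeight, real_inner_self_eq_norm_sq]
    congr 1
    exact Finset.prod_congr rfl fun α _ => Real.rpow_def_of_pos (by positivity) _
  have hline : HasDerivAt (fun t : ℝ => x + t • ξ) ξ 0 := by
    simpa using ((hasDerivAt_id (0 : ℝ)).smul_const ξ).const_add x
  have hsq : HasDerivAt (fun t : ℝ => (inner ℝ (x + t • ξ) (x + t • ξ) : ℝ))
      (2 * (inner ℝ ξ x : ℝ)) 0 := by
    convert! hline.inner ℝ hline using 1
    simp only [zero_smul, add_zero, real_inner_comm ξ x]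
    ring
  have hlog (α : RSpace N) : HasDerivAt (fun t : ℝ =>
      Real.log ((inner ℝ α (x + t • ξ) : ℝ) ^ 2 + ε) * (μ α / 2))
      (μ α * (inner ℝ α ξ : ℝ) * regInv ε (inner ℝ α x)) 0 := by
    have hpos : 0 < (inner ℝ α (x + (0 : ℝ) • ξ) : ℝ) ^ 2 + ε := by positivity
    have hinner : HasDerivAt (fun t : ℝ => (inner ℝ α (x + t • ξ) : ℝ)) (inner ℝ α ξ) 0 := by
      simpa using (hasDerivAt_const (0 : ℝ) α).inner ℝ hline
    have h := (((hinner.pow 2).add_const ε).log hpos.ne').mul_const (μ α / 2)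
    simp only [zero_smul, add_zero, Pi.pow_apply] at h
    convert! h using 1
    rw [regInv]
    field_simp
    ring
  have h := ((hsq.neg.div_const 2).add (HasDerivAt.fun_sum fun α (_ : α ∈ R) => hlog α)).exp
  unfold HasLineDerivAt
  rw [funext fun t : ℝ => eq_exp (x + t • ξ), eq_exp x]
  convert! h using 1
  simp only [zero_smul, add_zero, Pi.add_apply, Pi.neg_apply]
  ring

/-- Differentiable functions which grow at most exponentially, together with their derivative.
These are the test functions for integration by parts against the Gaussian weight. -/
structure IsExpTestFun (f : RSpace N → ℂ) : Prop where
  differentiable : Differentiable ℝ f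
  hasExpGrowth : HasExpGrowth f
  hasExpGrowth_fderiv : HasExpGrowth (fderiv ℝ f)

namespace IsExpTestFun

lemma mul (hf : IsExpTestFun f) (hg : IsExpTestFun g) : IsExpTestFun fun x => f x * g x where
  differentiable := hf.differentiable.mul hg.differentiable
  hasExpGrowth := hf.hasExpGrowth.mul hg.hasExpGrowth
  hasExpGrowth_fderiv := by
    simp only [funext fun x => fderiv_fun_mul (hf.differentiable x) (hg.differentiable x)]
    exact (hf.hasExpGrowth.smul hg.hasExpGrowth_fderiv).add
      (hg.hasExpGrowth.smul hf.hasExpGrowth_fderiv)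

lemma hasExpGrowth_fderiv_apply (hf : IsExpTestFun f) (ξ : RSpace N) :
    HasExpGrowth fun x => fderiv ℝ f x ξ :=
  ((HasExpGrowth.const ‖ξ‖).smul hf.hasExpGrowth_fderiv).mono fun x => by
    rw [norm_smul, norm_norm, mul_comm]
    exact (fderiv ℝ f x).le_opNorm ξ

lemma hasExpGrowth_comp_rootRefl (hf : IsExpTestFun f) (α : RSpace N) :
    HasExpGrowth fun x => f (rootRefl α x) :=
  hf.hasExpGrowth.comp_norm_eq (rootRefl α).norm_map

lemma continuous_comp_rootRefl (hf : IsExpTestFun f) (α : RSpace N) :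
    Continuous fun x => f (rootRefl α x) :=
  hf.differentiable.continuous.comp (rootRefl α).continuous

lemma hasExpGrowth_diffQuot (hf : IsExpTestFun f) (hα : ‖α‖ ^ 2 = 2) :
    HasExpGrowth (diffQuot α f) := by
  obtain ⟨C, a, hC, ha, hle⟩ := hf.hasExpGrowth_fderiv
  refine ⟨C * ‖α‖, a, by positivity, ha, fun x => ?_⟩
  by_cases hx : (inner ℝ α x : ℝ) = 0
  · simp only [diffQuot, hx, if_true, hα, div_self (two_ne_zero' ℝ), Complex.ofReal_one, one_mul]
    calc ‖fderiv ℝ f x α‖ ≤ ‖fderiv ℝ f x‖ * ‖α‖ := (fderiv ℝ f x).le_opNorm α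
      _ ≤ (C * Real.exp (a * ‖x‖)) * ‖α‖ := by gcongr; exact hle x
      _ = C * ‖α‖ * Real.exp (a * ‖x‖) := by ring
  · have fderiv_le : ∀ y ∈ Metric.closedBall 0 ‖x‖, ‖fderiv ℝ f y‖ ≤ C * Real.exp (a * ‖x‖) := by
      intro y hy
      have : ‖y‖ ≤ ‖x‖ := by simpa using hy
      exact (hle y).trans (by gcongr)
    have mean_value := (convex_closedBall (0 : RSpace N) ‖x‖).norm_image_sub_le_of_norm_fderiv_le
      (fun y _ => hf.differentiable y) fderiv_le (x := rootRefl α x) (y := x) (by simp) (by simp)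
    simp only [diffQuot, hx, if_false]
    rw [norm_div, Complex.norm_real, div_le_iff₀ (norm_pos_iff.2 hx)]
    refine mean_value.trans (le_of_eq ?_)
    rw [rootRefl_apply hα, sub_sub_cancel, norm_smul]
    ring

lemma measurable_diffQuot (hf : IsExpTestFun f) (α : RSpace N) : Measurable (diffQuot α f) := by
  unfold diffQuot
  refine Measurable.ite (isClosed_eq (by fun_prop) continuous_const).measurableSet
    ((measurable_fderiv_apply_const ℝ f α).const_mul _) (Measurable.div ?_ (by fun_prop))
  exact (hf.differentiable.continuous.sub (hf.continuous_comp_rootRefl α)).measurable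

lemma hasExpGrowth_dunklOp (hR : IsRootSystem R) (hf : IsExpTestFun f) (ξ : RSpace N) :
    HasExpGrowth (dunklOp R μ ξ f) :=
  (hf.hasExpGrowth_fderiv_apply ξ).add ((HasExpGrowth.const _).mul (.sum fun α hα =>
    (HasExpGrowth.const _).mul (hf.hasExpGrowth_diffQuot (hR.norm_sq α hα))))

lemma measurable_dunklOp (hf : IsExpTestFun f) (ξ : RSpace N) : Measurable (dunklOp R μ ξ f) :=
  (measurable_fderiv_apply_const ℝ f ξ).add ((Finset.measurable_fun_sum _ fun α _ =>
    (hf.measurable_diffQuot α).const_mul _).const_mul _)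

end IsExpTestFun

/-- The Dunkl operator `T_ξ` with the singular factors `1 / ⟨α, x⟩` regularized. -/
noncomputable def regDunklOp (R : Finset (RSpace N)) (μ : RSpace N → ℝ) (ε : ℝ) (ξ : RSpace N)
    (f : RSpace N → ℂ) (x : RSpace N) : ℂ :=
  fderiv ℝ f x ξ + (1 / 2) * ∑ α ∈ R, (μ α : ℂ) * (inner ℝ α ξ : ℂ) *
    ((regInv ε (inner ℝ α x) : ℂ) * (f x - f (rootRefl α x)))

lemma regInv_mul_sub_eq (hα : ‖α‖ ^ 2 = 2) (ε : ℝ) (f : RSpace N → ℂ) (x : RSpace N) :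
    (regInv ε (inner ℝ α x) : ℂ) * (f x - f (rootRefl α x)) =
      ((regInv ε (inner ℝ α x) * inner ℝ α x : ℝ) : ℂ) * diffQuot α f x := by
  rw [← inner_mul_diffQuot hα]
  push_cast
  ring

lemma integral_fderiv_mul_gaussWeight (hR : IsRootSystem R) (hμ : IsMultiplicity R μ)
    (hf : IsExpTestFun f) (ξ : RSpace N) (hε : 0 < ε) (hε1 : ε ≤ 1) :
    ∫ x, (fderiv ℝ f x ξ + f x * ∑ α ∈ R, (μ α : ℂ) * (inner ℝ α ξ : ℂ) *
      (regInv ε (inner ℝ α x) : ℂ) - (inner ℝ ξ x : ℂ) * f x) *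
      (gaussWeight R μ ε x : ℂ) = 0 := by
  have integrable_of {h : RSpace N → ℂ} (hh : HasExpGrowth h) (hm : AEStronglyMeasurable h) :
      Integrable fun x => h x * (gaussWeight R μ ε x : ℂ) :=
    hh.integrable_mul_gaussWeight hR hμ hm hε.le hε1
  have hfc := hf.differentiable.continuous
  have hfξ := integrable_of (hf.hasExpGrowth_fderiv_apply ξ)
    (measurable_fderiv_apply_const ℝ f ξ).aestronglyMeasurable
  have hdensity : Integrable fun x => f x * ((gaussWeight R μ ε x * (-(inner ℝ ξ x : ℝ) +
      ∑ α ∈ R, μ α * (inner ℝ α ξ : ℝ) * regInv ε (inner ℝ α x)) : ℝ) : ℂ) := by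
    refine (integrable_of (h := fun x => f x * ∑ α ∈ R, (μ α : ℂ) * (inner ℝ α ξ : ℂ) *
      (regInv ε (inner ℝ α x) : ℂ) - (inner ℝ ξ x : ℂ) * f x)
      (.sub (hf.hasExpGrowth.mul (.sum fun α _ => (HasExpGrowth.const _).mul
        (hasExpGrowth_regInv_inner hε α))) ((hasExpGrowth_inner ξ).mul hf.hasExpGrowth))
      (Continuous.aestronglyMeasurable (.sub (hfc.mul (continuous_finsetSum _ fun α _ =>
        continuous_const.mul (continuous_regInv_inner hε α))) (by fun_prop)))).congr
      (.of_forall fun x => ?_)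
    push_cast
    ring
  have by_parts := integral_bilinear_hasLineDerivAt_right_eq_neg_left_of_integrable
    (B := ContinuousLinearMap.mul ℝ ℂ) hfξ hdensity
    (integrable_of hf.hasExpGrowth hfc.aestronglyMeasurable)
    (fun x _ => (hf.differentiable x).hasFDerivAt.hasLineDerivAt ξ)
    (fun x _ => (hasLineDerivAt_gaussWeight hε x ξ).ofReal_comp)
  simp only [ContinuousLinearMap.mul_apply'] at by_parts
  rw [eq_neg_iff_add_eq_zero, ← integral_add hdensity hfξ] at by_parts
  rw [← by_parts]
  congr with x
  push_cast
  ring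

lemma regDunklOp_eq_sub_sum (R : Finset (RSpace N)) (μ : RSpace N → ℝ) (ε : ℝ) (ξ : RSpace N)
    (f : RSpace N → ℂ) (x : RSpace N) :
    regDunklOp R μ ε ξ f x = fderiv ℝ f x ξ +
      f x * ∑ α ∈ R, (μ α : ℂ) * (inner ℝ α ξ : ℂ) * (regInv ε (inner ℝ α x) : ℂ) -
      ∑ α ∈ R, (1 / 2) * ((μ α : ℂ) * (inner ℝ α ξ : ℂ)) *
        ((regInv ε (inner ℝ α x) : ℂ) * (f x + f (rootRefl α x))) := by
  rw [regDunklOp, Finset.mul_sum, Finset.mul_sum, add_sub_assoc, ← Finset.sum_sub_distrib]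
  congr 2 with α
  ring

lemma integral_regDunklOp_mul_gaussWeight (hR : IsRootSystem R) (hμ : IsMultiplicity R μ)
    (hf : IsExpTestFun f) (ξ : RSpace N) (hε : 0 < ε) (hε1 : ε ≤ 1) :
    ∫ x, (regDunklOp R μ ε ξ f x - (inner ℝ ξ x : ℂ) * f x) *
      (gaussWeight R μ ε x : ℂ) = 0 := by
  have integrable_of {h : RSpace N → ℂ} (hh : HasExpGrowth h) (hm : AEStronglyMeasurable h) :
      Integrable fun x => h x * (gaussWeight R μ ε x : ℂ) :=
    hh.integrable_mul_gaussWeight hR hμ hm hε.le hε1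
  have hfc := hf.differentiable.continuous
  have hderiv := integrable_of (((hf.hasExpGrowth_fderiv_apply ξ).add (hf.hasExpGrowth.mul
      (.sum fun α (_ : α ∈ R) => (HasExpGrowth.const ((μ α : ℂ) * (inner ℝ α ξ : ℂ))).mul
        (hasExpGrowth_regInv_inner hε α)))).sub ((hasExpGrowth_inner ξ).mul hf.hasExpGrowth))
    (((measurable_fderiv_apply_const ℝ f ξ).aestronglyMeasurable.add
      (Continuous.aestronglyMeasurable (hfc.mul (continuous_finsetSum _ fun α _ =>
        continuous_const.mul (continuous_regInv_inner hε α))))).sub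
      (Continuous.aestronglyMeasurable (by fun_prop)))
  set oddTerm : RSpace N → RSpace N → ℂ := fun α x =>
    (1 / 2) * ((μ α : ℂ) * (inner ℝ α ξ : ℂ)) *
      ((regInv ε (inner ℝ α x) : ℂ) * (f x + f (rootRefl α x))) with oddTerm_def
  have integrable_oddTerm (α : RSpace N) :=
    integrable_of (h := oddTerm α) ((HasExpGrowth.const _).mul ((hasExpGrowth_regInv_inner hε α).mul
      (hf.hasExpGrowth.add (hf.hasExpGrowth_comp_rootRefl α))))
      (continuous_const.mul ((continuous_regInv_inner hε α).mul
        (hfc.add (hf.continuous_comp_rootRefl α)))).aestronglyMeasurable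
  have integral_oddTerm {α : RSpace N} (hα : α ∈ R) :
      ∫ x, oddTerm α x * (gaussWeight R μ ε x : ℂ) = 0 := by
    refine integral_eq_zero_of_rootRefl_eq_neg α fun x => ?_
    rw [oddTerm_def, gaussWeight_rootRefl hR hμ hα]
    simp only [inner_rootRefl_self_right (hR.norm_sq α hα), regInv_neg, rootRefl_involutive]
    push_cast
    ring
  have split (x : RSpace N) : (regDunklOp R μ ε ξ f x - (inner ℝ ξ x : ℂ) * f x) *
      (gaussWeight R μ ε x : ℂ) = (fderiv ℝ f x ξ + f x * ∑ α ∈ R, (μ α : ℂ) *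
        (inner ℝ α ξ : ℂ) * (regInv ε (inner ℝ α x) : ℂ) - (inner ℝ ξ x : ℂ) * f x) *
      (gaussWeight R μ ε x : ℂ) - ∑ α ∈ R, oddTerm α x * (gaussWeight R μ ε x : ℂ) := by
    rw [regDunklOp_eq_sub_sum, ← Finset.sum_mul]
    ring
  simp only [split]
  rw [integral_sub hderiv (integrable_finsetSum R fun α _ => integrable_oddTerm α),
    integral_fderiv_mul_gaussWeight hR hμ hf ξ hε hε1,
    integral_finsetSum R fun α _ => integrable_oddTerm α,
    Finset.sum_eq_zero fun α hα => integral_oddTerm hα, sub_zero]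

lemma tendsto_gaussWeight (hμ : IsMultiplicity R μ) (x : RSpace N) :
    Tendsto (fun ε => (gaussWeight R μ ε x : ℂ)) (𝓝[>] 0) (𝓝 (gaussWeight R μ 0 x : ℂ)) := by
  have h := (continuous_gaussWeight (N := N) hμ).comp (Continuous.prodMk_left x)
  exact (Complex.continuous_ofReal.comp h).continuousWithinAt

lemma tendsto_regDunklOp_mul_gaussWeight (hR : IsRootSystem R) (hμ : IsMultiplicity R μ)
    (f : RSpace N → ℂ) (ξ x : RSpace N) :
    Tendsto (fun ε => regDunklOp R μ ε ξ f x * (gaussWeight R μ ε x : ℂ)) (𝓝[>] 0)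
      (𝓝 (dunklOp R μ ξ f x * (gaussWeight R μ 0 x : ℂ))) := by
  simp only [regDunklOp, dunklOp, add_mul, mul_assoc (1 / 2 : ℂ), Finset.sum_mul]
  refine ((tendsto_gaussWeight hμ x).const_mul _).add
    ((tendsto_finsetSum R fun α hα => ?_).const_mul _)
  simp only [regInv_mul_sub_eq (hR.norm_sq α hα)]
  by_cases hx : (inner ℝ α x : ℝ) = 0
  · rcases eq_or_ne (μ α) 0 with hμα | hμα
    · simp [hμα]
    have gaussWeight_eq_zero : gaussWeight R μ 0 x = 0 := by
      rw [gaussWeight, Finset.prod_eq_zero hα, mul_zero]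
      simp [hx, hμα]
    simp [hx, gaussWeight_eq_zero]
  · refine Tendsto.mul (Tendsto.const_mul _ ?_) (tendsto_gaussWeight hμ x)
    simpa only [Complex.ofReal_one, one_mul] using
      (tendsto_regInv_mul_self hx).ofReal.mul_const (diffQuot α f x)

lemma norm_regDunklOp_le (hR : IsRootSystem R) (hε : 0 ≤ ε) (ξ : RSpace N) (f : RSpace N → ℂ)
    (x : RSpace N) : ‖regDunklOp R μ ε ξ f x‖ ≤ ‖fderiv ℝ f x ξ‖ + (1 / 2) * ∑ α ∈ R,
      ‖(μ α : ℂ) * (inner ℝ α ξ : ℂ)‖ * ‖diffQuot α f x‖ := by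
  rw [regDunklOp]
  refine (norm_add_le _ _).trans ?_
  gcongr
  rw [norm_mul, show ‖(1 / 2 : ℂ)‖ = 1 / 2 by norm_num]
  refine mul_le_mul_of_nonneg_left (norm_sum_le_of_le R fun α hα => ?_) (by norm_num)
  rw [regInv_mul_sub_eq (hR.norm_sq α hα), norm_mul]
  gcongr
  rw [norm_mul, Complex.norm_real]
  exact mul_le_of_le_one_left (norm_nonneg _) (abs_regInv_mul_self_le hε _)

lemma measurable_regDunklOp (hf : IsExpTestFun f) (hε : 0 < ε) (ξ : RSpace N) :
    Measurable (regDunklOp R μ ε ξ f) :=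
  (measurable_fderiv_apply_const ℝ f ξ).add ((Finset.measurable_fun_sum _ fun α _ =>
    (((continuous_regInv_inner hε α).mul (hf.differentiable.continuous.sub
      (hf.continuous_comp_rootRefl α))).measurable.const_mul _)).const_mul _)

lemma integral_dunklOp_sub_mul_gaussWeight (hR : IsRootSystem R) (hμ : IsMultiplicity R μ)
    (hf : IsExpTestFun f) (ξ : RSpace N) :
    ∫ x, (dunklOp R μ ξ f x - (inner ℝ ξ x : ℂ) * f x) *
      (gaussWeight R μ 0 x : ℂ) = 0 := by
  have bound_growth : HasExpGrowth fun x => (‖fderiv ℝ f x ξ‖ + (1 / 2) * ∑ α ∈ R,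
      ‖(μ α : ℂ) * (inner ℝ α ξ : ℂ)‖ * ‖diffQuot α f x‖) +
      ‖(inner ℝ ξ x : ℂ) * f x‖ :=
    ((hf.hasExpGrowth_fderiv_apply ξ).norm.add ((HasExpGrowth.const _).mul (.sum fun α hα =>
      (HasExpGrowth.const _).mul (hf.hasExpGrowth_diffQuot (hR.norm_sq α hα)).norm))).add
      ((hasExpGrowth_inner ξ).mul hf.hasExpGrowth).norm
  obtain ⟨b, hb, hle⟩ := bound_growth.exists_integrable_bound hR hμ
  have small : ∀ᶠ ε : ℝ in 𝓝[>] 0, 0 < ε ∧ ε ≤ 1 := Ioc_mem_nhdsGT one_pos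
  have fc := hf.differentiable.continuous
  have limit : Tendsto (fun ε => ∫ x, (regDunklOp R μ ε ξ f x - (inner ℝ ξ x : ℂ) * f x) *
      (gaussWeight R μ ε x : ℂ)) (𝓝[>] 0) (𝓝 (∫ x, (dunklOp R μ ξ f x -
        (inner ℝ ξ x : ℂ) * f x) * (gaussWeight R μ 0 x : ℂ))) := by
    refine tendsto_integral_filter_of_dominated_convergence b ?_ ?_ hb (.of_forall fun x => ?_)
    · filter_upwards [small] with ε hε
      exact ((measurable_regDunklOp hf hε.1 ξ).aestronglyMeasurable.sub
        (Continuous.aestronglyMeasurable (by fun_prop))).mul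
        (continuous_ofReal_gaussWeight hμ ε).aestronglyMeasurable
    · filter_upwards [small] with ε hε
      refine .of_forall fun x => ?_
      rw [norm_mul_gaussWeight hε.1.le]
      refine le_trans ?_ (hle ε hε.1.le hε.2 x)
      gcongr
      · exact gaussWeight_nonneg hε.1.le x
      · refine (norm_sub_le _ _).trans (le_trans ?_ (Real.le_norm_self _))
        gcongr
        exact norm_regDunklOp_le hR hε.1.le ξ f x
    · simp only [sub_mul]
      exact (tendsto_regDunklOp_mul_gaussWeight hR hμ f ξ x).sub
        ((tendsto_gaussWeight hμ x).const_mul _)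
  refine tendsto_nhds_unique (limit.congr' ?_) tendsto_const_nhds
  filter_upwards [small] with ε hε using
    integral_regDunklOp_mul_gaussWeight hR hμ hf ξ hε.1 hε.2

lemma diffQuot_mul (hα : ‖α‖ ^ 2 = 2) {x : RSpace N} (hf : DifferentiableAt ℝ f x)
    (hg : DifferentiableAt ℝ g x) :
    diffQuot α (fun x => f x * g x) x = diffQuot α f x * g x + f x * diffQuot α g x -
      diffQuot α f x * (g x - g (rootRefl α x)) := by
  unfold diffQuot
  split_ifs with hx
  · rw [fderiv_fun_mul hf hg, rootRefl_eq_self hα hx]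
    simp only [add_apply, smul_apply, smul_eq_mul]
    ring
  · have : (inner ℝ α x : ℂ) ≠ 0 := by exact_mod_cast hx
    field_simp
    ring

lemma dunklOp_mul (hR : IsRootSystem R) {x : RSpace N} (hf : DifferentiableAt ℝ f x)
    (hg : DifferentiableAt ℝ g x) (ξ : RSpace N) :
    dunklOp R μ ξ (fun x => f x * g x) x = dunklOp R μ ξ f x * g x + f x * dunklOp R μ ξ g x -
      ∑ α ∈ R, (1 / 2) * ((μ α : ℂ) * (inner ℝ α ξ : ℂ)) *
        (diffQuot α f x * (g x - g (rootRefl α x))) := by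
  unfold dunklOp
  rw [Finset.sum_congr rfl fun α hα => by rw [diffQuot_mul (hR.norm_sq α hα) hf hg],
    fderiv_fun_mul hf hg]
  simp only [add_apply, smul_apply, smul_eq_mul, mul_add,
    mul_sub, Finset.sum_add_distrib, Finset.sum_sub_distrib, add_mul, Finset.sum_mul,
    Finset.mul_sum]
  ring_nf

lemma diffQuot_rootRefl (hα : ‖α‖ ^ 2 = 2) {x : RSpace N} (hx : (inner ℝ α x : ℝ) ≠ 0)
    (f : RSpace N → ℂ) : diffQuot α f (rootRefl α x) = diffQuot α f x := by
  rw [diffQuot, diffQuot, inner_rootRefl_self_right hα, if_neg (neg_ne_zero.2 hx), if_neg hx,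
    rootRefl_involutive, ← neg_sub, Complex.ofReal_neg, neg_div_neg_eq]

lemma integral_dunklOp_mul (hR : IsRootSystem R) (hμ : IsMultiplicity R μ)
    (hf : IsExpTestFun f) (hg : IsExpTestFun g) (ξ : RSpace N) :
    ∫ x, (dunklOp R μ ξ f x * g x + f x * dunklOp R μ ξ g x - (inner ℝ ξ x : ℂ) *
      (f x * g x)) * (gaussWeight R μ 0 x : ℂ) = 0 := by
  have integrable_of {h : RSpace N → ℂ} (hh : HasExpGrowth h) (hm : AEStronglyMeasurable h) :
      Integrable fun x => h x * (gaussWeight R μ 0 x : ℂ) :=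
    hh.integrable_mul_gaussWeight hR hμ hm le_rfl zero_le_one
  have hfg := hf.mul hg
  have fc := hf.differentiable.continuous
  have gc := hg.differentiable.continuous
  have hdunkl := integrable_of ((hfg.hasExpGrowth_dunklOp hR ξ).sub
      ((hasExpGrowth_inner ξ).mul hfg.hasExpGrowth))
    ((hfg.measurable_dunklOp (R := R) (μ := μ) ξ).aestronglyMeasurable.sub
      (Continuous.aestronglyMeasurable (by fun_prop)))
  set oddTerm : RSpace N → RSpace N → ℂ := fun α x =>
    (1 / 2) * ((μ α : ℂ) * (inner ℝ α ξ : ℂ)) *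
      (diffQuot α f x * (g x - g (rootRefl α x))) with oddTerm_def
  have integrable_oddTerm {α : RSpace N} (hα : α ∈ R) :=
    integrable_of (h := oddTerm α) ((HasExpGrowth.const _).mul
      ((hf.hasExpGrowth_diffQuot (hR.norm_sq α hα)).mul
        (hg.hasExpGrowth.sub (hg.hasExpGrowth_comp_rootRefl α))))
      (((hf.measurable_diffQuot α).mul
        (gc.sub (hg.continuous_comp_rootRefl α)).measurable).const_mul _).aestronglyMeasurable
  have integral_oddTerm {α : RSpace N} (hα : α ∈ R) :
      ∫ x, oddTerm α x * (gaussWeight R μ 0 x : ℂ) = 0 := by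
    refine integral_eq_zero_of_rootRefl_eq_neg α fun x => ?_
    rw [oddTerm_def, gaussWeight_rootRefl hR hμ hα]
    by_cases hx : (inner ℝ α x : ℝ) = 0
    · simp [rootRefl_eq_self (hR.norm_sq α hα) hx]
    · simp only [diffQuot_rootRefl (hR.norm_sq α hα) hx, rootRefl_involutive]
      ring
  have split (x : RSpace N) : (dunklOp R μ ξ f x * g x + f x * dunklOp R μ ξ g x -
      (inner ℝ ξ x : ℂ) * (f x * g x)) * (gaussWeight R μ 0 x : ℂ) =
      (dunklOp R μ ξ (fun x => f x * g x) x - (inner ℝ ξ x : ℂ) * (f x * g x)) *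
        (gaussWeight R μ 0 x : ℂ) + ∑ α ∈ R, oddTerm α x * (gaussWeight R μ 0 x : ℂ) := by
    rw [dunklOp_mul hR (hf.differentiable x) (hg.differentiable x), ← Finset.sum_mul]
    ring
  simp only [split]
  rw [integral_add hdunkl (integrable_finsetSum R fun α hα => integrable_oddTerm hα),
    integral_dunklOp_sub_mul_gaussWeight hR hμ hfg ξ,
    integral_finsetSum R fun α hα => integrable_oddTerm hα,
    Finset.sum_eq_zero fun α hα => integral_oddTerm hα, add_zero]

end IntegrationByParts

/-! ### The Gaussian pairing of Dunkl kernels -/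

section GaussPairing

variable {R : Finset (RSpace N)} {μ : RSpace N → ℝ} {E : CSpace N → CSpace N → ℂ}

lemma IsEulerKernel.isExpTestFun (hR : IsRootSystem R) (hμ : IsMultiplicity R μ)
    (hE : IsEulerKernel R μ E) (w : CSpace N) : IsExpTestFun fun x => E (toC x) w where
  differentiable x := ((differentiable_left hE.holomorphic w (toC x)).restrictScalars ℝ).comp x
    (toCL (N := N)).differentiableAt
  hasExpGrowth := ⟨1, ‖w‖, zero_le_one, norm_nonneg _, fun x => by
    simpa [mul_comm] using hE.norm_le hR hμ (toC x) w⟩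
  hasExpGrowth_fderiv := by
    refine ⟨Real.exp ‖w‖, ‖w‖, (Real.exp_pos _).le, norm_nonneg _, fun x => ?_⟩
    have hE' := differentiable_left hE.holomorphic w
    have norm_fderiv_le : ‖fderiv ℂ (fun z => E z w) (toC x)‖ ≤
        Real.exp ‖w‖ * Real.exp (‖w‖ * ‖x‖) := by
      refine norm_fderiv_le_of_entire hE' fun z hz => (hE.norm_le hR hμ z w).trans ?_
      rw [← Real.exp_add, Real.exp_le_exp]
      rw [norm_toC] at hz
      nlinarith [norm_nonneg w]
    refine ContinuousLinearMap.opNorm_le_bound _ (by positivity) fun ξ => ?_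
    rw [fderiv_comp_toC hE', ← norm_toC ξ]
    exact ContinuousLinearMap.le_of_opNorm_le _ norm_fderiv_le _

/-- The integral of `E(q, z) E(q, w)` against the Gaussian weight on `ℝᴺ`. -/
noncomputable def gaussPairing (R : Finset (RSpace N)) (μ : RSpace N → ℝ)
    (E : CSpace N → CSpace N → ℂ) (z w : CSpace N) : ℂ :=
  ∫ q : RSpace N, E (toC q) z * E (toC q) w * (gaussWeight R μ 0 q : ℂ)

lemma gaussPairing_comm (z w : CSpace N) : gaussPairing R μ E z w = gaussPairing R μ E w z := by
  simp only [gaussPairing, mul_comm (E _ z)]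

lemma continuous_toC : Continuous (toC : RSpace N → CSpace N) := (toCL (N := N)).continuous

lemma hasExpGrowth_bilin_toC (v : CSpace N) : HasExpGrowth fun q : RSpace N => bilin v (toC q) := by
  refine ⟨‖v‖, 1, norm_nonneg v, zero_le_one, fun q => (norm_bilin_le v _).trans ?_⟩
  rw [norm_toC, one_mul]
  gcongr
  linarith [Real.add_one_le_exp ‖q‖]

lemma IsEulerKernel.integrable_gaussPairing (hR : IsRootSystem R) (hμ : IsMultiplicity R μ)
    (hE : IsEulerKernel R μ E) (z w : CSpace N) :
    Integrable fun q => E (toC q) z * E (toC q) w * (gaussWeight R μ 0 q : ℂ) := by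
  have hzw := (hE.isExpTestFun hR hμ z).mul (hE.isExpTestFun hR hμ w)
  exact hzw.hasExpGrowth.integrable_mul_gaussWeight hR hμ
    hzw.differentiable.continuous.aestronglyMeasurable le_rfl zero_le_one

lemma IsEulerKernel.integrable_bilin_mul (hR : IsRootSystem R) (hμ : IsMultiplicity R μ)
    (hE : IsEulerKernel R μ E) (v z w : CSpace N) : Integrable fun q =>
      bilin v (toC q) * (E (toC q) z * E (toC q) w * (gaussWeight R μ 0 q : ℂ)) := by
  have hzw := (hE.isExpTestFun hR hμ z).mul (hE.isExpTestFun hR hμ w)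
  simpa only [mul_assoc] using
    ((hasExpGrowth_bilin_toC v).mul hzw.hasExpGrowth).integrable_mul_gaussWeight hR hμ
      (((bilin v).continuous.comp continuous_toC).mul
        hzw.differentiable.continuous).aestronglyMeasurable le_rfl zero_le_one

lemma IsDunklKernel.integral_bilin_toC_mul (hR : IsRootSystem R) (hμ : IsMultiplicity R μ)
    (hE : IsDunklKernel R μ E) (ξ : RSpace N) (z w : CSpace N) :
    ∫ q : RSpace N, bilin (toC ξ) (toC q) *
      (E (toC q) z * E (toC q) w * (gaussWeight R μ 0 q : ℂ)) =
        bilin (toC ξ) (z + w) * gaussPairing R μ E z w := by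
  have hE' := hE.isEulerKernel hR
  have integration_by_parts := integral_dunklOp_mul hR hμ (hE'.isExpTestFun hR hμ z)
    (hE'.isExpTestFun hR hμ w) ξ
  have integrand_eq (q : RSpace N) : (dunklOp R μ ξ (fun x => E (toC x) z) q * E (toC q) w +
      E (toC q) z * dunklOp R μ ξ (fun x => E (toC x) w) q -
        (inner ℝ ξ q : ℂ) * (E (toC q) z * E (toC q) w)) * (gaussWeight R μ 0 q : ℂ) =
      bilin (toC ξ) (z + w) * (E (toC q) z * E (toC q) w * (gaussWeight R μ 0 q : ℂ)) -
        bilin (toC ξ) (toC q) * (E (toC q) z * E (toC q) w * (gaussWeight R μ 0 q : ℂ)) := by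
    rw [hE.dunklOp_eq hR, hE.dunklOp_eq hR, bilin_toC, map_add]
    ring
  simp only [integrand_eq] at integration_by_parts
  rw [integral_sub ((hE'.integrable_gaussPairing hR hμ z w).const_mul _)
    (hE'.integrable_bilin_mul hR hμ _ z w), integral_const_mul, sub_eq_zero] at integration_by_parts
  exact integration_by_parts.symm

lemma IsDunklKernel.integral_bilin_mul (hR : IsRootSystem R) (hμ : IsMultiplicity R μ)
    (hE : IsDunklKernel R μ E) (v z w : CSpace N) :
    ∫ q : RSpace N, bilin v (toC q) * (E (toC q) z * E (toC q) w * (gaussWeight R μ 0 q : ℂ)) =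
      bilin v (z + w) * gaussPairing R μ E z w := by
  have hint (v : CSpace N) := (hE.isEulerKernel hR).integrable_bilin_mul hR hμ v z w
  obtain ⟨x, y, rfl⟩ := exists_toC_add v
  simp only [bilin_add_left, bilin_smul_left, add_mul, mul_assoc Complex.I]
  rw [integral_add (hint _) ((hint _).const_mul _), integral_const_mul,
    hE.integral_bilin_toC_mul hR hμ, hE.integral_bilin_toC_mul hR hμ]

namespace IsEulerKernel

lemma exists_gaussPairing_bound (hR : IsRootSystem R) (hμ : IsMultiplicity R μ)
    (hE : IsEulerKernel R μ E) (z : CSpace N) (r : ℝ) : ∃ b : RSpace N → ℝ, Integrable b ∧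
      ∀ q w, ‖w‖ ≤ r → ‖E (toC q) z * E (toC q) w * (gaussWeight R μ 0 q : ℂ)‖ ≤ b q := by
  have hgrowth : HasExpGrowth fun q : RSpace N => Real.exp ((‖z‖ + |r|) * ‖q‖) :=
    ⟨1, ‖z‖ + |r|, zero_le_one, by positivity, fun q => by
      rw [Real.norm_eq_abs, Real.abs_exp, one_mul]⟩
  obtain ⟨b, hb, hle⟩ := hgrowth.exists_integrable_bound hR hμ
  refine ⟨b, hb, fun q w hw => le_trans ?_ (hle 0 le_rfl zero_le_one q)⟩
  rw [norm_mul_gaussWeight le_rfl, norm_mul, Real.norm_eq_abs, Real.abs_exp, add_mul, Real.exp_add]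
  have hz := hE.norm_le hR hμ (toC q) z
  have hw' := hE.norm_le hR hμ (toC q) w
  rw [norm_toC, mul_comm] at hz hw'
  have := gaussWeight_nonneg (R := R) (μ := μ) le_rfl q
  gcongr
  refine hw'.trans ?_
  gcongr
  exact hw.trans (le_abs_self r)

lemma hasDerivAt_gaussPairing (hR : IsRootSystem R) (hμ : IsMultiplicity R μ)
    (hE : IsEulerKernel R μ E) (z w : CSpace N) (l : ℂ) :
    HasDerivAt (fun l : ℂ => gaussPairing R μ E z (l • w))
      (∫ q : RSpace N, E (toC q) z * deriv (fun l : ℂ => E (toC q) (l • w)) l *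
        (gaussWeight R μ 0 q : ℂ)) l := by
  have hderiv (q : RSpace N) (l : ℂ) := ((((hE.isEulerSolution_right hR hμ (toC q)).differentiable
    w l).hasDerivAt.const_mul (E (toC q) z)).mul_const (gaussWeight R μ 0 q : ℂ))
  obtain ⟨b, hb, hle⟩ := hE.exists_gaussPairing_bound hR hμ z ((‖l‖ + 2) * ‖w‖)
  have norm_smul_le (l' : ℂ) (hl' : ‖l' - l‖ ≤ 2) : ‖l' • w‖ ≤ (‖l‖ + 2) * ‖w‖ := by
    rw [norm_smul]
    gcongr
    linarith [norm_sub_norm_le l' l]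
  simpa only [(hderiv _ l).deriv] using! hasDerivAt_integral_of_entire
    (f := fun l q => E (toC q) z * E (toC q) (l • w) * (gaussWeight R μ 0 q : ℂ))
    (fun q l => (hderiv q l).differentiableAt)
    (fun l => (hE.integrable_gaussPairing hR hμ z _).aestronglyMeasurable) l hb
    (fun q l' hl' => hle q _ (norm_smul_le l' hl'))

lemma norm_gaussPairing_le (hR : IsRootSystem R) (hμ : IsMultiplicity R μ)
    (hE : IsEulerKernel R μ E) (z : CSpace N) (r : ℝ) :
    ∃ C, ∀ w, ‖w‖ ≤ r → ‖gaussPairing R μ E z w‖ ≤ C := by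
  obtain ⟨b, hb, hle⟩ := hE.exists_gaussPairing_bound hR hμ z r
  exact ⟨∫ q, b q, fun w hw =>
    norm_integral_le_of_norm_le hb (Eventually.of_forall fun q => hle q w hw)⟩

end IsEulerKernel

lemma IsDunklKernel.eulerOp_gaussPairing (hR : IsRootSystem R) (hμ : IsMultiplicity R μ)
    (hE : IsDunklKernel R μ E) (z w : CSpace N) :
    eulerOp R μ (gaussPairing R μ E z) w = bilin w (z + w) * gaussPairing R μ E z w := by
  have hE' := hE.isEulerKernel hR
  have hint (w : CSpace N) := hE'.integrable_gaussPairing hR hμ z w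
  have hsum : ∀ α ∈ R, Integrable fun q : RSpace N => (μ α : ℂ) *
      (E (toC q) z * E (toC q) w * (gaussWeight R μ 0 q : ℂ) -
        E (toC q) z * E (toC q) (reflC α w) * (gaussWeight R μ 0 q : ℂ)) :=
    fun α _ => ((hint _).sub (hint _)).const_mul _
  have euler_under_integral (q : RSpace N) :
      E (toC q) z * deriv (fun l : ℂ => E (toC q) (l • w)) 1 * (gaussWeight R μ 0 q : ℂ) =
      bilin w (toC q) * (E (toC q) z * E (toC q) w * (gaussWeight R μ 0 q : ℂ)) -
        (1 / 2) * ∑ α ∈ R, (μ α : ℂ) *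
          (E (toC q) z * E (toC q) w * (gaussWeight R μ 0 q : ℂ) -
            E (toC q) z * E (toC q) (reflC α w) * (gaussWeight R μ 0 q : ℂ)) := by
    have equation := (hE'.isEulerSolution_right hR hμ (toC q)).equation w
    have factor : ∑ α ∈ R, (μ α : ℂ) *
        (E (toC q) z * E (toC q) w * (gaussWeight R μ 0 q : ℂ) -
          E (toC q) z * E (toC q) (reflC α w) * (gaussWeight R μ 0 q : ℂ)) =
        E (toC q) z * (gaussWeight R μ 0 q : ℂ) *
          ∑ α ∈ R, (μ α : ℂ) * (E (toC q) w - E (toC q) (reflC α w)) := by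
      rw [Finset.mul_sum]
      exact Finset.sum_congr rfl fun α _ => by ring
    rw [eulerOp] at equation
    rw [factor]
    linear_combination E (toC q) z * (gaussWeight R μ 0 q : ℂ) * equation
  rw [eulerOp, (hE'.hasDerivAt_gaussPairing hR hμ z w 1).deriv,
    ← hE.integral_bilin_mul hR hμ w z w]
  simp only [euler_under_integral]
  rw [integral_sub (hE'.integrable_bilin_mul hR hμ _ z w)
    ((integrable_finsetSum R hsum).const_mul _), integral_const_mul, integral_finsetSum R hsum]
  simp only [integral_const_mul, integral_sub (hint _) (hint _), gaussPairing, sub_add_cancel]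

lemma eulerOp_mul_of_reflC_eq {f g : CSpace N → ℂ} {w : CSpace N}
    (hg : DifferentiableAt ℂ (fun l : ℂ => g (l • w)) 1)
    (hf : DifferentiableAt ℂ (fun l : ℂ => f (l • w)) 1)
    (hgσ : ∀ α ∈ R, g (reflC α w) = g w) :
    eulerOp R μ (fun w => g w * f w) w =
      deriv (fun l : ℂ => g (l • w)) 1 * f w + g w * eulerOp R μ f w := by
  have factor : ∑ α ∈ R, (μ α : ℂ) * (g w * f w - g (reflC α w) * f (reflC α w)) =
      g w * ∑ α ∈ R, (μ α : ℂ) * (f w - f (reflC α w)) := by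
    rw [Finset.mul_sum]
    exact Finset.sum_congr rfl fun α hα => by rw [hgσ α hα]; ring
  rw [eulerOp, eulerOp, deriv_fun_mul hg hf, factor, one_smul]
  ring

lemma hasDerivAt_exp_neg_bilin_smul (w : CSpace N) (l : ℂ) :
    HasDerivAt (fun l : ℂ => Complex.exp (-bilin (l • w) (l • w) / 2))
      (Complex.exp (-bilin (l • w) (l • w) / 2) * (-l * bilin w w)) l := by
  refine HasDerivAt.cexp ?_
  have hsq : (fun l : ℂ => -bilin (l • w) (l • w) / 2) = fun l => l ^ 2 * (-bilin w w / 2) := by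
    ext l
    rw [bilin_smul_left, map_smul, smul_eq_mul]
    ring
  rw [hsq]
  convert! (hasDerivAt_pow 2 l).mul_const (-bilin w w / 2) using 1
  push_cast
  ring

/-- Multiplication by `exp(-w²/2)` absorbs the term `bilin w w` in `eulerOp_gaussPairing`. -/
lemma IsDunklKernel.isEulerSolution_exp_mul_gaussPairing (hR : IsRootSystem R)
    (hμ : IsMultiplicity R μ) (hE : IsDunklKernel R μ E) (z : CSpace N) :
    IsEulerSolution R μ z (fun w => Complex.exp (-bilin w w / 2) * gaussPairing R μ E z w) where
  differentiable w l := (hasDerivAt_exp_neg_bilin_smul w l).differentiableAt.mul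
    ((hE.isEulerKernel hR).hasDerivAt_gaussPairing hR hμ z w l).differentiableAt
  bounded r := by
    obtain ⟨C, hC⟩ := (hE.isEulerKernel hR).norm_gaussPairing_le hR hμ z r
    refine ⟨Real.exp (r ^ 2) * C, fun w hw => ?_⟩
    rw [norm_mul]
    refine mul_le_mul ((Complex.norm_exp_le_exp_norm _).trans (Real.exp_le_exp.2 ?_)) (hC w hw)
      (norm_nonneg _) (Real.exp_pos _).le
    rw [norm_div, norm_neg, Complex.norm_two]
    nlinarith [norm_bilin_le w w, norm_nonneg w]
  equation w := by
    have hderiv := hasDerivAt_exp_neg_bilin_smul w 1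
    rw [eulerOp_mul_of_reflC_eq hderiv.differentiableAt
      ((hE.isEulerKernel hR).hasDerivAt_gaussPairing hR hμ z w 1).differentiableAt
      fun α hα => by rw [bilin_reflC_reflC (hR.norm_sq α hα)], hderiv.deriv,
      hE.eulerOp_gaussPairing hR hμ, one_smul, map_add]
    ring

lemma IsDunklKernel.gaussPairing_eq (hR : IsRootSystem R) (hμ : IsMultiplicity R μ)
    (hE : IsDunklKernel R μ E) (z w : CSpace N) :
    gaussPairing R μ E z w =
      Complex.exp ((bilin z z + bilin w w) / 2) * (gaussPairing R μ E 0 0 * E z w) := by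
  have hE' := hE.isEulerKernel hR
  have separate (z w : CSpace N) : gaussPairing R μ E z w =
      Complex.exp (bilin w w / 2) * (gaussPairing R μ E z 0 * E w z) := by
    have h := hE'.eq_of_isEulerSolution hR hμ
      (hE.isEulerSolution_exp_mul_gaussPairing hR hμ z) w
    rw [bilin_comm 0, map_zero, neg_zero, zero_div, Complex.exp_zero, one_mul] at h
    rw [← h, ← mul_assoc, ← Complex.exp_add, show bilin w w / 2 + -bilin w w / 2 = 0 by ring,
      Complex.exp_zero, one_mul]
  rw [separate z w, gaussPairing_comm z 0, separate 0 z, hE'.apply_zero_right hR hμ, mul_one,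
    hE'.symm hR hμ w z, add_div, Complex.exp_add]
  ring

lemma weightTilde_one_mul_exp (x : RSpace N) :
    weightTilde R μ 1 x * Real.exp (-‖x‖ ^ 2 / 2) = gaussWeight R μ 0 x := by
  have rpow_half_sq (a c : ℝ) : (a ^ 2) ^ (c / 2) = |a| ^ c := by
    rw [← sq_abs, ← Real.rpow_natCast_mul (abs_nonneg a)]
    congr 1
    push_cast
    ring
  simp only [weightTilde, gaussWeight, Real.one_rpow, one_mul, add_zero, rpow_half_sq, mul_comm]

lemma mmsConst_eq_integral_gaussWeight : mmsConst R μ = ∫ x, gaussWeight R μ 0 x := by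
  simp only [mmsConst, weightTilde_one_mul_exp]

lemma IsEulerKernel.gaussPairing_zero_zero (hR : IsRootSystem R) (hμ : IsMultiplicity R μ)
    (hE : IsEulerKernel R μ E) : gaussPairing R μ E 0 0 = (mmsConst R μ : ℂ) := by
  rw [mmsConst_eq_integral_gaussWeight, ← integral_complex_ofReal]
  simp only [gaussPairing, hE.apply_zero_right hR hμ, one_mul]

lemma integrable_gaussWeight (hR : IsRootSystem R) (hμ : IsMultiplicity R μ) :
    Integrable (gaussWeight R μ 0) := by
  have h := ((HasExpGrowth.const (V := RSpace N) (1 : ℂ)).integrable_mul_gaussWeight hR hμ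
    aestronglyMeasurable_const le_rfl zero_le_one).re
  simpa only [one_mul, RCLike.re_to_complex, Complex.ofReal_re] using h

lemma exists_gaussWeight_ne_zero (hR : IsRootSystem R) : ∃ x, gaussWeight R μ 0 x ≠ 0 := by
  obtain ⟨x, hx⟩ := Module.Dual.exists_forall_ne_zero_of_forall_exists (K := ℝ)
    (fun α : R => innerₛₗ ℝ (α : RSpace N)) (fun α => ⟨α, by simpa using hR.ne_zero α α.2⟩)
  refine ⟨x, mul_ne_zero (Real.exp_ne_zero _) (Finset.prod_ne_zero_iff.2 fun α hα => ?_)⟩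
  have inner_ne_zero : (inner ℝ α x : ℝ) ≠ 0 := hx ⟨α, hα⟩
  rw [add_zero]
  exact (Real.rpow_pos_of_pos (sq_pos_of_ne_zero inner_ne_zero) _).ne'

lemma mmsConst_pos (hR : IsRootSystem R) (hμ : IsMultiplicity R μ) : 0 < mmsConst R μ := by
  have hcont := (continuous_gaussWeight (N := N) hμ).comp (Continuous.prodMk_right (0 : ℝ))
  have nonneg : 0 ≤ gaussWeight R μ 0 := fun x => gaussWeight_nonneg le_rfl x
  rw [mmsConst_eq_integral_gaussWeight,
    integral_pos_iff_support_of_nonneg nonneg (integrable_gaussWeight hR hμ)]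
  exact hcont.isOpen_support.measure_pos _ (exists_gaussWeight_ne_zero hR)

end GaussPairing

/-! ### Dunkl operators on homogeneous polynomials -/

section Polynomials

variable {R : Finset (RSpace N)} {μ : RSpace N → ℝ} {f g : RSpace N → ℂ} {n : ℕ}

lemma diffQuot_add (α : RSpace N) (hf : Differentiable ℝ f) (hg : Differentiable ℝ g)
    (x : RSpace N) :
    diffQuot α (fun x => f x + g x) x = diffQuot α f x + diffQuot α g x := by
  unfold diffQuot
  split_ifs with hx
  · rw [fderiv_fun_add (hf x) (hg x), add_apply]
    ring
  · ring

lemma diffQuot_const_mul (α : RSpace N) (hf : Differentiable ℝ f) (c : ℂ) (x : RSpace N) :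
    diffQuot α (fun x => c * f x) x = c * diffQuot α f x := by
  unfold diffQuot
  split_ifs with hx
  · rw [fderiv_const_mul (hf x), smul_apply, smul_eq_mul]
    ring
  · ring

lemma hasFDerivAt_ofReal_inner (v x : RSpace N) :
    HasFDerivAt (fun x => (inner ℝ v x : ℂ)) (Complex.ofRealCLM.comp (innerSL ℝ v)) x :=
  Complex.ofRealCLM.hasFDerivAt.comp x (innerSL ℝ v).hasFDerivAt

lemma differentiable_ofReal_inner (v : RSpace N) : Differentiable ℝ fun x => (inner ℝ v x : ℂ) :=
  fun x => (hasFDerivAt_ofReal_inner v x).differentiableAt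

lemma fderiv_ofReal_inner (v x ξ : RSpace N) :
    fderiv ℝ (fun x => (inner ℝ v x : ℂ)) x ξ = inner ℝ v ξ := by
  rw [(hasFDerivAt_ofReal_inner v x).fderiv]
  rfl

lemma diffQuot_inner {α : RSpace N} (hα : ‖α‖ ^ 2 = 2) (v x : RSpace N) :
    diffQuot α (fun x => (inner ℝ v x : ℂ)) x = inner ℝ α v := by
  unfold diffQuot
  split_ifs with hx
  · rw [fderiv_ofReal_inner, hα, real_inner_comm, div_self two_ne_zero, Complex.ofReal_one, one_mul]
  · rw [div_eq_iff (Complex.ofReal_ne_zero.2 hx), rootRefl_apply hα]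
    simp only [inner_sub_right, inner_smul_right, real_inner_comm α v]
    push_cast
    ring

lemma dunklOp_add (ξ : RSpace N) (hf : Differentiable ℝ f) (hg : Differentiable ℝ g) :
    dunklOp R μ ξ (fun x => f x + g x) = fun x => dunklOp R μ ξ f x + dunklOp R μ ξ g x := by
  ext x
  simp only [dunklOp, diffQuot_add _ hf hg, mul_add, Finset.sum_add_distrib,
    fderiv_fun_add (hf x) (hg x), add_apply]
  ring

lemma dunklOp_const_mul (ξ : RSpace N) (hf : Differentiable ℝ f) (c : ℂ) :
    dunklOp R μ ξ (fun x => c * f x) = fun x => c * dunklOp R μ ξ f x := by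
  ext x
  simp only [dunklOp, diffQuot_const_mul _ hf, mul_left_comm _ c, mul_add, ← Finset.mul_sum,
    fderiv_const_mul (hf x), smul_apply, smul_eq_mul]

lemma dunklOp_const (ξ : RSpace N) (c : ℂ) : dunklOp R μ ξ (fun _ => c) = 0 := by
  ext x
  simp [dunklOp, diffQuot]

lemma dunklOp_sum {ι : Type*} (s : Finset ι) (ξ : RSpace N) {f : ι → RSpace N → ℂ}
    (hf : ∀ i, Differentiable ℝ (f i)) :
    dunklOp R μ ξ (fun x => ∑ i ∈ s, f i x) = fun x => ∑ i ∈ s, dunklOp R μ ξ (f i) x := by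
  classical
  induction s using Finset.induction_on with
  | empty => exact dunklOp_const ξ 0
  | insert i s hi ih =>
    simp only [Finset.sum_insert hi]
    rw [dunklOp_add ξ (hf i) (.fun_sum fun i _ => hf i), ih]

/-- The Dunkl operators of `f` at `x` as a linear function of the direction. -/
noncomputable def dunklOpₗ (R : Finset (RSpace N)) (μ : RSpace N → ℝ) (f : RSpace N → ℂ)
    (x : RSpace N) : RSpace N →ₗ[ℝ] ℂ where
  toFun ξ := dunklOp R μ ξ f x
  map_add' ξ η := by
    simp only [dunklOp, map_add, inner_add_right, Complex.ofReal_add, mul_add, add_mul,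
      Finset.sum_add_distrib]
    ring
  map_smul' c ξ := by
    simp only [dunklOp, map_smul, inner_smul_right, Complex.ofReal_mul, Complex.real_smul, mul_add,
      Finset.mul_sum, RingHom.id_apply]
    congr 1
    exact Finset.sum_congr rfl fun α _ => by ring

lemma dunklOp_eq_sum {ι : Type*} [Fintype ι] (b : OrthonormalBasis ι ℝ (RSpace N)) (ξ : RSpace N)
    (f : RSpace N → ℂ) (x : RSpace N) :
    dunklOp R μ ξ f x = ∑ i, (inner ℝ (b i) ξ : ℂ) * dunklOp R μ (b i) f x := by
  have h := congrArg (dunklOpₗ R μ f x) (b.sum_repr' ξ)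
  simp only [map_sum, map_smul, Complex.real_smul] at h
  exact h.symm

lemma dunklOp_rootRefl_left {α : RSpace N} (hα : ‖α‖ ^ 2 = 2) (ξ : RSpace N) (f : RSpace N → ℂ)
    (x : RSpace N) : dunklOp R μ (rootRefl α ξ) f x =
      dunklOp R μ ξ f x - (inner ℝ α ξ : ℂ) * dunklOp R μ α f x := by
  rw [rootRefl_apply hα, ← Complex.real_smul]
  exact ((dunklOpₗ R μ f x).map_sub _ _).trans (congrArg _ ((dunklOpₗ R μ f x).map_smul _ _))

lemma dunklOp_inner_mul (hR : IsRootSystem R) (ξ v : RSpace N) (hf : Differentiable ℝ f) :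
    dunklOp R μ ξ (fun x => (inner ℝ v x : ℂ) * f x) = fun x =>
      (inner ℝ v x : ℂ) * dunklOp R μ ξ f x + (inner ℝ ξ v : ℂ) * f x +
        (1 / 2) * ∑ α ∈ R, (μ α : ℂ) * (inner ℝ α ξ : ℂ) * (inner ℝ α v : ℂ) *
          f (rootRefl α x) := by
  ext x
  have hv := differentiable_ofReal_inner v
  have diffQuot_inner_mul (α : RSpace N) (hα : α ∈ R) :
      diffQuot α (fun x => (inner ℝ v x : ℂ) * f x) x =
        (inner ℝ v x : ℂ) * diffQuot α f x + (inner ℝ α v : ℂ) * f (rootRefl α x) := by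
    have hα2 := hR.norm_sq α hα
    rw [diffQuot_mul hα2 (hv x) (hf x), diffQuot_inner hα2]
    ring
  simp only [dunklOp]
  rw [Finset.sum_congr rfl fun α hα => by rw [diffQuot_inner_mul α hα, mul_add,
    mul_left_comm, ← mul_assoc _ (inner ℝ α v : ℂ)], fderiv_fun_mul (hv x) (hf x)]
  simp only [add_apply, smul_apply, smul_eq_mul, fderiv_ofReal_inner, mul_add,
    Finset.sum_add_distrib, ← Finset.mul_sum, real_inner_comm ξ v]
  ring

lemma rootRefl_rootRefl_apply {α : RSpace N} (hα : ‖α‖ ^ 2 = 2) (β x : RSpace N) :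
    rootRefl (rootRefl β α) (rootRefl β x) = rootRefl β (rootRefl α x) := by
  rw [rootRefl_apply (α := rootRefl β α) (by rw [LinearIsometryEquiv.norm_map, hα]),
    inner_rootRefl_rootRefl, rootRefl_apply hα x, map_sub, map_smul]

lemma dunklOp_comp_rootRefl (hR : IsRootSystem R) (hμ : IsMultiplicity R μ) {β : RSpace N}
    (hβ : β ∈ R) (ξ : RSpace N) (hf : Differentiable ℝ f) (x : RSpace N) :
    dunklOp R μ ξ (fun x => f (rootRefl β x)) x = dunklOp R μ (rootRefl β ξ) f (rootRefl β x) := by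
  have fderiv_comp (v : RSpace N) : fderiv ℝ (fun x => f (rootRefl β x)) x v =
      fderiv ℝ f (rootRefl β x) (rootRefl β v) := by
    have h : HasFDerivAt (fun x => f (rootRefl β x)) _ x :=
      (hf (rootRefl β x)).hasFDerivAt.comp x (rootRefl β).toContinuousLinearEquiv.hasFDerivAt
    rw [h.fderiv]
    rfl
  have diffQuot_comp (α : RSpace N) (hα : α ∈ R) :
      diffQuot α (fun x => f (rootRefl β x)) x = diffQuot (rootRefl β α) f (rootRefl β x) := by
    unfold diffQuot
    rw [inner_rootRefl_rootRefl, fderiv_comp, LinearIsometryEquiv.norm_map,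
      rootRefl_rootRefl_apply (hR.norm_sq α hα)]
  rw [dunklOp, dunklOp, fderiv_comp]
  congr 2
  refine Eq.trans (Finset.sum_congr rfl fun α hα => ?_) (sum_rootRefl hR hβ _)
  rw [diffQuot_comp α hα, hμ.rootRefl_eq hβ hα, inner_rootRefl_rootRefl]

/-- The homogeneous polynomial functions of degree `n` on `ℝᴺ` with complex coefficients, spanned
by the products of `n` linear forms. -/
noncomputable def homogPoly (N : ℕ) : ℕ → Submodule ℂ (RSpace N → ℂ)
  | 0 => Submodule.span ℂ {fun _ => 1}
  | n + 1 => Submodule.span ℂ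
      {f | ∃ v : RSpace N, ∃ p ∈ homogPoly N n, f = fun x => (inner ℝ v x : ℂ) * p x}

lemma inner_mul_mem_homogPoly (v : RSpace N) (hf : f ∈ homogPoly N n) :
    (fun x => (inner ℝ v x : ℂ) * f x) ∈ homogPoly N (n + 1) :=
  Submodule.subset_span ⟨v, f, hf, rfl⟩

lemma exists_eq_const_of_mem_homogPoly_zero (hf : f ∈ homogPoly N 0) : ∃ c, f = fun _ => c := by
  obtain ⟨c, rfl⟩ := Submodule.mem_span_singleton.1 hf
  exact ⟨c, by ext; simp⟩

lemma add_mem_homogPoly (hf : f ∈ homogPoly N n) (hg : g ∈ homogPoly N n) :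
    (fun x => f x + g x) ∈ homogPoly N n := add_mem hf hg

lemma const_mul_mem_homogPoly (c : ℂ) (hf : f ∈ homogPoly N n) :
    (fun x => c * f x) ∈ homogPoly N n := Submodule.smul_mem _ c hf

lemma sum_mem_homogPoly {ι : Type*} (s : Finset ι) {f : ι → RSpace N → ℂ}
    (hf : ∀ i ∈ s, f i ∈ homogPoly N n) : (fun x => ∑ i ∈ s, f i x) ∈ homogPoly N n := by
  simpa only [Finset.sum_fn] using Submodule.sum_mem _ hf

lemma homogPoly_succ_induction {C : (RSpace N → ℂ) → Prop}
    (inner_mul : ∀ v, ∀ p ∈ homogPoly N n, C fun x => (inner ℝ v x : ℂ) * p x)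
    (add : ∀ p ∈ homogPoly N (n + 1), ∀ q ∈ homogPoly N (n + 1), C p → C q →
      C fun x => p x + q x)
    (const_mul : ∀ c : ℂ, ∀ p ∈ homogPoly N (n + 1), C p → C fun x => c * p x)
    (hf : f ∈ homogPoly N (n + 1)) : C f := by
  refine Submodule.span_induction (p := fun f _ => C f) ?_ ?_ ?_ ?_ hf
  · rintro _ ⟨v, p, hp, rfl⟩
    exact inner_mul v p hp
  · simpa using! inner_mul 0 0 (Submodule.zero_mem _)
  · exact fun p q hp hq => add p hp q hq
  · exact fun c p hp => const_mul c p hp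

lemma differentiable_of_mem_homogPoly (hf : f ∈ homogPoly N n) : Differentiable ℝ f := by
  induction n generalizing f with
  | zero =>
    obtain ⟨c, rfl⟩ := exists_eq_const_of_mem_homogPoly_zero hf
    exact differentiable_const c
  | succ n ih =>
    exact homogPoly_succ_induction
      (fun v p hp => (differentiable_ofReal_inner v).fun_mul (ih hp))
      (fun _ _ _ _ hp hq => hp.fun_add hq) (fun c _ _ hp => hp.const_mul c) hf

lemma comp_rootRefl_mem_homogPoly (α : RSpace N) (hf : f ∈ homogPoly N n) :
    (fun x => f (rootRefl α x)) ∈ homogPoly N n := by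
  induction n generalizing f with
  | zero =>
    obtain ⟨c, rfl⟩ := exists_eq_const_of_mem_homogPoly_zero hf
    exact hf
  | succ n ih =>
    refine homogPoly_succ_induction
      (C := fun p => (fun x => p (rootRefl α x)) ∈ homogPoly N (n + 1)) (fun v p hp => ?_)
      (fun _ _ _ _ => add_mem_homogPoly) (fun c _ _ => const_mul_mem_homogPoly c) hf
    have inner_rootRefl (x : RSpace N) :
        (inner ℝ v (rootRefl α x) : ℝ) = inner ℝ (rootRefl α v) x := by
      rw [← inner_rootRefl_rootRefl α (rootRefl α v), rootRefl_involutive]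
    simpa only [inner_rootRefl] using inner_mul_mem_homogPoly (rootRefl α v) (ih hp)

lemma dunklOp_eq_zero_of_mem_homogPoly_zero (ξ : RSpace N) (hf : f ∈ homogPoly N 0) :
    dunklOp R μ ξ f = 0 := by
  obtain ⟨c, rfl⟩ := exists_eq_const_of_mem_homogPoly_zero hf
  exact dunklOp_const ξ c

lemma dunklOp_mem_homogPoly (hR : IsRootSystem R) (ξ : RSpace N) (hf : f ∈ homogPoly N (n + 1)) :
    dunklOp R μ ξ f ∈ homogPoly N n := by
  have mem_of_inner_mul_mem (n : ℕ) (h : ∀ v, ∀ p ∈ homogPoly N n,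
      (fun x => (inner ℝ v x : ℂ) * dunklOp R μ ξ p x) ∈ homogPoly N n) :
      ∀ f ∈ homogPoly N (n + 1), dunklOp R μ ξ f ∈ homogPoly N n := by
    refine fun f => homogPoly_succ_induction (C := fun f => dunklOp R μ ξ f ∈ homogPoly N n)
      (fun v p hp => ?_) (fun p hp q hq hTp hTq => ?_) (fun c p hp hTp => ?_)
    · rw [dunklOp_inner_mul hR ξ v (differentiable_of_mem_homogPoly hp)]
      exact add_mem_homogPoly (add_mem_homogPoly (h v p hp) (const_mul_mem_homogPoly _ hp))
        (const_mul_mem_homogPoly _ (sum_mem_homogPoly _ fun α _ =>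
          const_mul_mem_homogPoly _ (comp_rootRefl_mem_homogPoly α hp)))
    · rw [dunklOp_add ξ (differentiable_of_mem_homogPoly hp) (differentiable_of_mem_homogPoly hq)]
      exact add_mem_homogPoly hTp hTq
    · rw [dunklOp_const_mul ξ (differentiable_of_mem_homogPoly hp)]
      exact const_mul_mem_homogPoly c hTp
  induction n generalizing f with
  | zero =>
    refine mem_of_inner_mul_mem 0 (fun v p hp => ?_) f hf
    simp only [dunklOp_eq_zero_of_mem_homogPoly_zero ξ hp, Pi.zero_apply, mul_zero]
    exact Submodule.zero_mem _
  | succ n ih =>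
    exact mem_of_inner_mul_mem (n + 1) (fun v p hp => inner_mul_mem_homogPoly v (ih hp)) f hf

lemma differentiable_dunklOp_of_mem_homogPoly (hR : IsRootSystem R) (ξ : RSpace N)
    (hf : f ∈ homogPoly N n) : Differentiable ℝ (dunklOp R μ ξ f) := by
  cases n with
  | zero =>
    rw [dunklOp_eq_zero_of_mem_homogPoly_zero ξ hf]
    exact differentiable_const 0
  | succ n => exact differentiable_of_mem_homogPoly (dunklOp_mem_homogPoly hR ξ hf)

lemma dunklOp_dunklOp_inner_mul (hR : IsRootSystem R) (hμ : IsMultiplicity R μ)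
    (v ξ η : RSpace N) (hf : f ∈ homogPoly N n) (x : RSpace N) :
    dunklOp R μ ξ (dunklOp R μ η fun x => (inner ℝ v x : ℂ) * f x) x =
      (inner ℝ v x : ℂ) * dunklOp R μ ξ (dunklOp R μ η f) x +
        ((inner ℝ ξ v : ℂ) * dunklOp R μ η f x + (inner ℝ η v : ℂ) * dunklOp R μ ξ f x) +
      (1 / 2) * ∑ α ∈ R, (μ α : ℂ) * (inner ℝ α v : ℂ) *
        ((inner ℝ α ξ : ℂ) * dunklOp R μ η f (rootRefl α x) +
          (inner ℝ α η : ℂ) * dunklOp R μ ξ f (rootRefl α x) -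
          (inner ℝ α ξ : ℂ) * (inner ℝ α η : ℂ) * dunklOp R μ α f (rootRefl α x)) := by
  have hf' := differentiable_of_mem_homogPoly hf
  have hTf : Differentiable ℝ (dunklOp R μ η f) := differentiable_dunklOp_of_mem_homogPoly hR η hf
  have hrefl (α : RSpace N) : Differentiable ℝ fun x => f (rootRefl α x) :=
    differentiable_of_mem_homogPoly (comp_rootRefl_mem_homogPoly α hf)
  have hmul := (differentiable_ofReal_inner v).fun_mul hTf
  have hsum : Differentiable ℝ fun x => ∑ α ∈ R, (μ α : ℂ) * (inner ℝ α η : ℂ) *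
      (inner ℝ α v : ℂ) * f (rootRefl α x) := .fun_sum fun α _ => (hrefl α).const_mul _
  have dunklOp_refl (α : RSpace N) (hα : α ∈ R) :
      dunklOp R μ ξ (fun x => f (rootRefl α x)) x = dunklOp R μ ξ f (rootRefl α x) -
        (inner ℝ α ξ : ℂ) * dunklOp R μ α f (rootRefl α x) := by
    rw [dunklOp_comp_rootRefl hR hμ hα ξ hf', dunklOp_rootRefl_left (hR.norm_sq α hα)]
  rw [dunklOp_inner_mul hR η v hf', dunklOp_add ξ (hmul.fun_add (hf'.const_mul _))
    (hsum.const_mul _), dunklOp_add ξ hmul (hf'.const_mul _), dunklOp_inner_mul hR ξ v hTf,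
    dunklOp_const_mul ξ hf', dunklOp_const_mul ξ hsum,
    dunklOp_sum R ξ fun α => (hrefl α).const_mul _]
  simp only [dunklOp_const_mul ξ (hrefl _), add_assoc, Finset.mul_sum,
    add_left_comm _ ((inner ℝ η v : ℂ) * _), add_right_inj]
  rw [← Finset.sum_add_distrib]
  refine Finset.sum_congr rfl fun α hα => ?_
  rw [dunklOp_refl α hα]
  ring

lemma dunklOp_comm (hR : IsRootSystem R) (hμ : IsMultiplicity R μ) (ξ η : RSpace N)
    (hf : f ∈ homogPoly N n) :
    dunklOp R μ ξ (dunklOp R μ η f) = dunklOp R μ η (dunklOp R μ ξ f) := by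
  induction n generalizing f with
  | zero =>
    rw [dunklOp_eq_zero_of_mem_homogPoly_zero ξ hf, dunklOp_eq_zero_of_mem_homogPoly_zero η hf]
    exact (dunklOp_const ξ 0).trans (dunklOp_const η 0).symm
  | succ n ih =>
    have hT (ζ : RSpace N) {p : RSpace N → ℂ} (hp : p ∈ homogPoly N (n + 1)) :=
      differentiable_dunklOp_of_mem_homogPoly (μ := μ) hR ζ hp
    refine homogPoly_succ_induction (C := fun f => dunklOp R μ ξ (dunklOp R μ η f) =
      dunklOp R μ η (dunklOp R μ ξ f)) (fun v p hp => ?_) (fun p hp q hq hTp hTq => ?_)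
      (fun c p hp hTp => ?_) hf
    · ext x
      rw [dunklOp_dunklOp_inner_mul hR hμ v ξ η hp, dunklOp_dunklOp_inner_mul hR hμ v η ξ hp,
        ih hp, add_comm ((inner ℝ ξ v : ℂ) * _)]
      congr 2
      exact Finset.sum_congr rfl fun α _ => by ring
    · have hp' := differentiable_of_mem_homogPoly hp
      have hq' := differentiable_of_mem_homogPoly hq
      rw [dunklOp_add _ hp' hq', dunklOp_add _ hp' hq', dunklOp_add _ (hT _ hp) (hT _ hq),
        dunklOp_add _ (hT _ hp) (hT _ hq), hTp, hTq]
    · have hp' := differentiable_of_mem_homogPoly hp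
      rw [dunklOp_const_mul _ hp', dunklOp_const_mul _ hp', dunklOp_const_mul _ (hT _ hp),
        dunklOp_const_mul _ (hT _ hp), hTp]

lemma fderiv_self_of_mem_homogPoly (hf : f ∈ homogPoly N n) (x : RSpace N) :
    fderiv ℝ f x x = n * f x := by
  induction n generalizing f with
  | zero =>
    obtain ⟨c, rfl⟩ := exists_eq_const_of_mem_homogPoly_zero hf
    simp
  | succ n ih =>
    refine homogPoly_succ_induction (C := fun p => fderiv ℝ p x x = ((n + 1 : ℕ) : ℂ) * p x)
      (fun v p hp => ?_) (fun p hp q hq hDp hDq => ?_) (fun c p hp hDp => ?_) hf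
    · rw [fderiv_fun_mul (differentiable_ofReal_inner v x) (differentiable_of_mem_homogPoly hp x)]
      simp only [add_apply, smul_apply, smul_eq_mul, fderiv_ofReal_inner, ih hp, Nat.cast_succ]
      ring
    · rw [fderiv_fun_add (differentiable_of_mem_homogPoly hp x)
        (differentiable_of_mem_homogPoly hq x), add_apply, hDp, hDq, mul_add]
    · rw [fderiv_const_mul (differentiable_of_mem_homogPoly hp x), smul_apply, hDp, smul_eq_mul,
        mul_left_comm]

lemma dunklOp_self_of_mem_homogPoly (hR : IsRootSystem R) (hf : f ∈ homogPoly N n)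
    (x : RSpace N) : dunklOp R μ x f x =
      n * f x + (1 / 2) * ∑ α ∈ R, (μ α : ℂ) * (f x - f (rootRefl α x)) := by
  rw [dunklOp, fderiv_self_of_mem_homogPoly hf]
  congr 2
  refine Finset.sum_congr rfl fun α hα => ?_
  rw [mul_assoc, inner_mul_diffQuot (hR.norm_sq α hα)]

lemma dunklOp_dunklOp_self (hR : IsRootSystem R) (ξ : RSpace N) (hf : f ∈ homogPoly N n)
    (x : RSpace N) :
    dunklOp R μ ξ (fun y => dunklOp R μ y f y) x = dunklOp R μ ξ (dunklOp R μ x f) x +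
      dunklOp R μ ξ f x + (1 / 2) * ∑ α ∈ R, (μ α : ℂ) * (inner ℝ α ξ : ℂ) *
        dunklOp R μ α f (rootRefl α x) := by
  let b := EuclideanSpace.basisFun (Fin N) ℝ
  have hT (i : Fin N) : Differentiable ℝ (dunklOp R μ (b i) f) :=
    differentiable_dunklOp_of_mem_homogPoly hR _ hf
  rw [show (fun y => dunklOp R μ y f y) = _ from funext fun y => dunklOp_eq_sum b y f y,
    show dunklOp R μ x f = _ from funext fun y => dunklOp_eq_sum b x f y,
    dunklOp_sum _ _ fun i => (differentiable_ofReal_inner _).fun_mul (hT i),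
    dunklOp_sum _ _ fun i => (hT i).const_mul _]
  simp only [dunklOp_inner_mul hR ξ _ (hT _), dunklOp_const_mul ξ (hT _), Finset.sum_add_distrib,
    ← Finset.mul_sum]
  rw [Finset.sum_comm]
  simp only [mul_assoc, ← Finset.mul_sum, fun v i => real_inner_comm (b i) v, ← dunklOp_eq_sum b]

lemma continuous_uncurry_dunklOp_of_mem_homogPoly (hR : IsRootSystem R)
    (hf : f ∈ homogPoly N n) :
    Continuous fun q : RSpace N × RSpace N => dunklOp R μ q.1 f q.2 := by
  have hT (ξ : RSpace N) : Continuous (dunklOp R μ ξ f) :=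
    (differentiable_dunklOp_of_mem_homogPoly hR ξ hf).continuous
  rw [funext fun q : RSpace N × RSpace N =>
    dunklOp_eq_sum (EuclideanSpace.basisFun (Fin N) ℝ) q.1 f q.2]
  fun_prop

section EigenDefect

variable {h : RSpace N → ℂ} {y : RSpace N}

/-- The amount by which `f` and `g` fail to solve the eigenvalue equation
`T_ξ f = ⟨ξ, y⟩ g`, at the point `x`. -/
noncomputable def eigenDefect (R : Finset (RSpace N)) (μ : RSpace N → ℝ) (y : RSpace N)
    (f g : RSpace N → ℂ) (ξ x : RSpace N) : ℂ :=
  dunklOp R μ ξ f x + -(inner ℝ ξ y : ℂ) * g x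

lemma eigenDefect_mem_homogPoly (hR : IsRootSystem R) (hf : f ∈ homogPoly N (n + 1))
    (hg : g ∈ homogPoly N n) (ξ : RSpace N) : eigenDefect R μ y f g ξ ∈ homogPoly N n :=
  add_mem_homogPoly (dunklOp_mem_homogPoly hR ξ hf) (const_mul_mem_homogPoly _ hg)

lemma eigenDefect_rootRefl_left {α : RSpace N} (hα : ‖α‖ ^ 2 = 2) (ξ x : RSpace N) :
    eigenDefect R μ y f g (rootRefl α ξ) x =
      eigenDefect R μ y f g ξ x - (inner ℝ α ξ : ℂ) * eigenDefect R μ y f g α x := by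
  rw [eigenDefect, eigenDefect, eigenDefect, dunklOp_rootRefl_left hα, rootRefl_apply hα,
    inner_sub_left, real_inner_smul_left]
  push_cast
  ring

lemma exists_norm_eigenDefect_le (hR : IsRootSystem R) (hf : f ∈ homogPoly N (n + 1))
    (hg : g ∈ homogPoly N n) (a b : ℝ) :
    BddAbove ((fun q : RSpace N × RSpace N => ‖eigenDefect R μ y f g q.1 q.2‖) ''
      (Metric.sphere 0 a ×ˢ Metric.sphere 0 b)) := by
  have hT := continuous_uncurry_dunklOp_of_mem_homogPoly (μ := μ) hR hf
  have hg' := (differentiable_of_mem_homogPoly hg).continuous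
  have hcont : Continuous fun q : RSpace N × RSpace N => eigenDefect R μ y f g q.1 q.2 :=
    hT.add (by fun_prop)
  exact ((isCompact_sphere _ _).prod (isCompact_sphere _ _)).bddAbove_image
    hcont.norm.continuousOn

lemma eigenDefect_reflection_equation (hR : IsRootSystem R) (hμ : IsMultiplicity R μ)
    (hf : f ∈ homogPoly N (n + 1)) (hg : g ∈ homogPoly N n)
    (radial : ∀ x, dunklOp R μ x f x = (inner ℝ y x : ℂ) * g x)
    (eigen : ∀ ξ x, dunklOp R μ ξ g x = (inner ℝ ξ y : ℂ) * h x) (ξ x : RSpace N) :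
    (n + 1) * eigenDefect R μ y f g ξ x + (1 / 2) * ∑ α ∈ R, (μ α : ℂ) *
      (eigenDefect R μ y f g ξ x - eigenDefect R μ y f g (rootRefl α ξ) (rootRefl α x)) = 0 := by
  set u := eigenDefect R μ y f g with hu
  have hg' := differentiable_of_mem_homogPoly hg
  have euler := dunklOp_self_of_mem_homogPoly (μ := μ) hR
    (eigenDefect_mem_homogPoly (μ := μ) (y := y) hR hf hg ξ) x
  have radial_defect : dunklOp R μ x (u ξ) x = dunklOp R μ ξ (dunklOp R μ x f) x -
      (inner ℝ ξ y : ℂ) * dunklOp R μ x g x := by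
    rw [show u ξ = fun x => dunklOp R μ ξ f x + -(inner ℝ ξ y : ℂ) * g x from rfl,
      dunklOp_add x (differentiable_dunklOp_of_mem_homogPoly hR ξ hf) (hg'.const_mul _),
      dunklOp_const_mul x hg', dunklOp_comm hR hμ x ξ hf]
    ring
  have radial_apply := dunklOp_dunklOp_self (μ := μ) hR ξ hf x
  simp only [radial, dunklOp_inner_mul hR ξ y hg', eigen] at radial_apply
  have sum_eq : ∑ α ∈ R, (μ α : ℂ) * (u ξ x - u (rootRefl α ξ) (rootRefl α x)) =
      ∑ α ∈ R, (μ α : ℂ) * (u ξ x - u ξ (rootRefl α x)) +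
      (∑ α ∈ R, (μ α : ℂ) * (inner ℝ α ξ : ℂ) * dunklOp R μ α f (rootRefl α x) -
        ∑ α ∈ R, (μ α : ℂ) * (inner ℝ α ξ : ℂ) * (inner ℝ α y : ℂ) * g (rootRefl α x)) := by
    rw [← Finset.sum_sub_distrib, ← Finset.sum_add_distrib]
    refine Finset.sum_congr rfl fun α hα => ?_
    rw [hu, eigenDefect_rootRefl_left (hR.norm_sq α hα), eigenDefect.eq_1 R μ y f g α]
    ring
  have defect_apply : u ξ x = dunklOp R μ ξ f x + -(inner ℝ ξ y : ℂ) * g x := rfl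
  rw [eigen, real_inner_comm y x] at radial_defect
  rw [sum_eq, mul_add, mul_sub]
  linear_combination -euler + radial_defect - radial_apply + defect_apply

/-- The defect vanishes by the maximum principle for its reflection equation. -/
lemma dunklOp_eq_of_radial (hR : IsRootSystem R) (hμ : IsMultiplicity R μ)
    (hf : f ∈ homogPoly N (n + 1)) (hg : g ∈ homogPoly N n)
    (radial : ∀ x, dunklOp R μ x f x = (inner ℝ y x : ℂ) * g x)
    (eigen : ∀ ξ x, dunklOp R μ ξ g x = (inner ℝ ξ y : ℂ) * h x) (ξ x : RSpace N) :
    dunklOp R μ ξ f x = (inner ℝ ξ y : ℂ) * g x := by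
  have norm_le : ‖eigenDefect R μ y f g ξ x‖ ≤ 0 := by
    refine norm_le_of_norm_smul_add_sum_sub_le (s := R) (k := fun α => μ α / 2)
      (fun α hα => div_nonneg (hμ.nonneg α hα) zero_le_two)
      (σ := fun α q => (rootRefl α q.1, rootRefl α q.2)) (fun α _ q hq => ?_)
      (exists_norm_eigenDefect_le hR hf hg ‖ξ‖ ‖x‖) n.cast_add_one_pos (fun q _ => ?_)
      (x := (ξ, x)) (by simp)
    · simpa using hq
    · have key := eigenDefect_reflection_equation hR hμ hf hg radial eigen q.1 q.2
      rw [Finset.mul_sum] at key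
      simp only [Complex.real_smul]
      push_cast
      rw [mul_zero, norm_le_zero_iff, ← key]
      congr 1
      exact Finset.sum_congr rfl fun α _ => by ring
  have defect_eq : dunklOp R μ ξ f x + -(inner ℝ ξ y : ℂ) * g x = 0 := norm_le_zero_iff.1 norm_le
  linear_combination defect_eq

end EigenDefect

end Polynomials

/-! ### Existence of the Dunkl kernel -/

section Existence

variable {R : Finset (RSpace N)} {μ : RSpace N → ℝ} {n : ℕ} {q : CSpace N → CSpace N → ℂ}
  {a : ℕ → CSpace N → CSpace N → ℂ}

/-- Multiplication by the monomial `zᵢ wⱼ` on the functions of `(z, w) ∈ ℂᴺ × ℂᴺ`. -/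
def mulCoord (i j : Fin N) :
    (CSpace N → CSpace N → ℂ) →ₗ[ℂ] (CSpace N → CSpace N → ℂ) where
  toFun q z w := z i * w j * q z w
  map_add' p q := by ext; simp [mul_add]
  map_smul' c q := by ext; simp [mul_left_comm]

lemma mulCoord_apply (i j : Fin N) (q : CSpace N → CSpace N → ℂ) (z w : CSpace N) :
    mulCoord i j q z w = z i * w j * q z w := rfl

/-- The polynomial functions on `ℂᴺ × ℂᴺ` that are homogeneous of degree `n` in each of the two
arguments: the home of the `n`-th term of the Dunkl kernel. -/
noncomputable def bihomogPoly (N : ℕ) : ℕ → Submodule ℂ (CSpace N → CSpace N → ℂ)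
  | 0 => Submodule.span ℂ {fun _ _ => 1}
  | n + 1 => ⨆ i, ⨆ j, (bihomogPoly N n).map (mulCoord i j)

instance finiteDimensional_bihomogPoly (n : ℕ) : FiniteDimensional ℂ (bihomogPoly N n) := by
  induction n with
  | zero => rw [bihomogPoly]; infer_instance
  | succ n ih => rw [bihomogPoly]; infer_instance

lemma exists_eq_const_of_mem_bihomogPoly_zero (hq : q ∈ bihomogPoly N 0) :
    ∃ c, q = fun _ _ => c := by
  obtain ⟨c, rfl⟩ := Submodule.mem_span_singleton.1 hq
  exact ⟨c, by ext; simp⟩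

lemma mulCoord_mem_bihomogPoly (i j : Fin N) (hq : q ∈ bihomogPoly N n) :
    mulCoord i j q ∈ bihomogPoly N (n + 1) :=
  Submodule.mem_iSup_of_mem i (Submodule.mem_iSup_of_mem j (Submodule.mem_map_of_mem hq))

lemma bihomogPoly_succ_induction {C : (CSpace N → CSpace N → ℂ) → Prop}
    (mulCoord : ∀ i j, ∀ q ∈ bihomogPoly N n, C (mulCoord i j q)) (zero : C 0)
    (add : ∀ p q, C p → C q → C (p + q)) (hq : q ∈ bihomogPoly N (n + 1)) : C q := by
  refine Submodule.iSup_induction _ (motive := C) hq (fun i p hp => ?_) zero add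
  refine Submodule.iSup_induction _ (motive := C) hp (fun j p hp => ?_) zero add
  obtain ⟨q, hq, rfl⟩ := Submodule.mem_map.1 hp
  exact mulCoord i j q hq

lemma differentiable_of_mem_bihomogPoly (hq : q ∈ bihomogPoly N n) :
    Differentiable ℂ fun p : CSpace N × CSpace N => q p.1 p.2 := by
  induction n generalizing q with
  | zero =>
    obtain ⟨c, rfl⟩ := exists_eq_const_of_mem_bihomogPoly_zero hq
    exact differentiable_const c
  | succ n ih =>
    refine bihomogPoly_succ_induction
      (C := fun q => Differentiable ℂ fun p : CSpace N × CSpace N => q p.1 p.2)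
      (fun i j q hq => ?_) (differentiable_const 0) (fun p q hp hq => hp.add hq) hq
    have := ih hq
    simp only [mulCoord_apply]
    fun_prop

lemma comp_toC_mem_homogPoly (hq : q ∈ bihomogPoly N n) (w : CSpace N) :
    (fun x => q (toC x) w) ∈ homogPoly N n := by
  induction n generalizing q with
  | zero =>
    obtain ⟨c, rfl⟩ := exists_eq_const_of_mem_bihomogPoly_zero hq
    exact Submodule.mem_span_singleton.2 ⟨c, by ext; simp⟩
  | succ n ih =>
    refine bihomogPoly_succ_induction
      (C := fun q => (fun x => q (toC x) w) ∈ homogPoly N (n + 1))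
      (fun i j q hq => ?_) (Submodule.zero_mem _) (fun p q hp hq => add_mem hp hq) hq
    have := inner_mul_mem_homogPoly (EuclideanSpace.single i 1)
      (const_mul_mem_homogPoly (w j) (ih hq))
    simpa [mulCoord_apply, toC_apply, EuclideanSpace.inner_single_left, mul_assoc] using this

lemma linearMap_mul_mem_bihomogPoly (L : CSpace N →ₗ[ℂ] ℂ) (j : Fin N)
    (hq : q ∈ bihomogPoly N n) : (fun z w => L z * w j * q z w) ∈ bihomogPoly N (n + 1) := by
  have h : (fun z w => L z * w j * q z w) =
      ∑ i, L (EuclideanSpace.single i 1) • mulCoord i j q := by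
    ext z w
    have hL : L z = ∑ i, z i * L (EuclideanSpace.single i 1) := by
      conv_lhs => rw [← (EuclideanSpace.basisFun (Fin N) ℂ).sum_repr z]
      simp
    simp only [hL, Finset.sum_apply, Pi.smul_apply, mulCoord_apply, smul_eq_mul, Finset.sum_mul]
    exact Finset.sum_congr rfl fun i _ => by ring
  rw [h]
  exact Submodule.sum_mem _ fun i _ => Submodule.smul_mem _ _ (mulCoord_mem_bihomogPoly i j hq)

lemma bilin_mul_mem_bihomogPoly (hq : q ∈ bihomogPoly N n) :
    (fun z w => bilin z w * q z w) ∈ bihomogPoly N (n + 1) := by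
  have h : (fun z w => bilin z w * q z w) = ∑ i, mulCoord i i q := by
    ext z w
    simp [bilin_apply, mulCoord_apply, Finset.sum_mul]
  rw [h]
  exact Submodule.sum_mem _ fun i _ => mulCoord_mem_bihomogPoly i i hq

lemma comp_reflC_mem_bihomogPoly (α : RSpace N) (hq : q ∈ bihomogPoly N n) :
    (fun z w => q (reflC α z) w) ∈ bihomogPoly N n := by
  induction n generalizing q with
  | zero =>
    obtain ⟨c, rfl⟩ := exists_eq_const_of_mem_bihomogPoly_zero hq
    exact hq
  | succ n ih =>
    refine bihomogPoly_succ_induction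
      (C := fun q => (fun z w => q (reflC α z) w) ∈ bihomogPoly N (n + 1))
      (fun i j q hq => ?_) (Submodule.zero_mem _) (fun p q hp hq => add_mem hp hq) hq
    exact linearMap_mul_mem_bihomogPoly
      ((EuclideanSpace.proj i : CSpace N →L[ℂ] ℂ) ∘L reflC α).toLinearMap j (ih hq)

/-- The operator `c + ½ ∑ μ(α) (1 - σ_α)`, the reflections acting on the first argument. On
functions homogeneous of degree `c` in the first argument it is `x ↦ T_x f x`. -/
noncomputable def radialOp (R : Finset (RSpace N)) (μ : RSpace N → ℝ) (c : ℂ) :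
    (CSpace N → CSpace N → ℂ) →ₗ[ℂ] (CSpace N → CSpace N → ℂ) where
  toFun q z w := c * q z w + (1 / 2) * ∑ α ∈ R, (μ α : ℂ) * (q z w - q (reflC α z) w)
  map_add' p q := by
    ext z w
    simp only [Pi.add_apply, add_sub_add_comm, mul_add, Finset.sum_add_distrib]
    ring
  map_smul' a q := by
    ext z w
    simp only [Pi.smul_apply, smul_eq_mul, RingHom.id_apply, ← mul_sub, mul_left_comm _ a,
      ← Finset.mul_sum, mul_add]

lemma radialOp_apply (c : ℂ) (q : CSpace N → CSpace N → ℂ) (z w : CSpace N) :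
    radialOp R μ c q z w =
      c * q z w + (1 / 2) * ∑ α ∈ R, (μ α : ℂ) * (q z w - q (reflC α z) w) := rfl

lemma radialOp_mem_bihomogPoly (c : ℂ) (hq : q ∈ bihomogPoly N n) :
    radialOp R μ c q ∈ bihomogPoly N n := by
  have h : radialOp R μ c q = c • q + (1 / 2 : ℂ) • ∑ α ∈ R, (μ α : ℂ) •
      (q - fun z w => q (reflC α z) w) := by
    ext z w
    simp [radialOp_apply]
  rw [h]
  exact add_mem (Submodule.smul_mem _ _ hq) (Submodule.smul_mem _ _ (Submodule.sum_mem _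
    fun α _ => Submodule.smul_mem _ _ (sub_mem hq (comp_reflC_mem_bihomogPoly α hq))))

lemma norm_le_of_norm_radialOp_le (hR : IsRootSystem R) (hμ : IsMultiplicity R μ)
    (hq : q ∈ bihomogPoly N n) {c : ℝ} (hc : 0 < c) (z w : CSpace N) {C : ℝ}
    (h : ∀ z', ‖z'‖ = ‖z‖ → ‖radialOp R μ c q z' w‖ ≤ c * C) : ‖q z w‖ ≤ C := by
  have hqc : Continuous fun z => q z w :=
    (differentiable_left (differentiable_of_mem_bihomogPoly hq) w).continuous
  refine norm_le_of_norm_smul_add_sum_sub_le (s := R) (k := fun α => μ α / 2)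
    (fun α hα => div_nonneg (hμ.nonneg α hα) zero_le_two) (σ := fun α z => reflC α z)
    (S := Metric.sphere 0 ‖z‖) (f := fun z => q z w) (fun α hα z' hz' => ?_)
    ((isCompact_sphere 0 ‖z‖).bddAbove_image hqc.norm.continuousOn) hc (fun z' hz' => ?_) (by simp)
  · rw [mem_sphere_zero_iff_norm] at hz' ⊢
    rw [norm_reflC (hR.norm_sq α hα), hz']
  · refine (congrArg norm ?_).trans_le (h z' (mem_sphere_zero_iff_norm.1 hz'))
    simp only [radialOp_apply, Complex.real_smul, Complex.ofReal_div, Complex.ofReal_ofNat,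
      Finset.mul_sum]
    congr 1
    exact Finset.sum_congr rfl fun α _ => by ring

/-- The maximum principle makes the operator injective, and the space is finite dimensional. -/
lemma exists_radialOp_eq (hR : IsRootSystem R) (hμ : IsMultiplicity R μ) {c : ℝ} (hc : 0 < c)
    {f : CSpace N → CSpace N → ℂ} (hf : f ∈ bihomogPoly N n) :
    ∃ q ∈ bihomogPoly N n, radialOp R μ c q = f := by
  set T : bihomogPoly N n →ₗ[ℂ] bihomogPoly N n :=
    (radialOp R μ c).restrict fun q hq => radialOp_mem_bihomogPoly (c : ℂ) hq
  have injective : Function.Injective T := by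
    rw [injective_iff_map_eq_zero]
    intro q hq
    have hq' : radialOp R μ c q.1 = 0 := congrArg Subtype.val hq
    refine Subtype.ext (funext fun z => funext fun w => norm_le_zero_iff.1 ?_)
    exact norm_le_of_norm_radialOp_le hR hμ q.2 hc z w fun z' _ => by simp [hq']
  obtain ⟨q, hq⟩ := LinearMap.injective_iff_surjective.1 injective ⟨f, hf⟩
  exact ⟨q.1, q.2, congrArg Subtype.val hq⟩

/-- `a n` is the bihomogeneous part of degree `n` of the Dunkl kernel: the parts are determined by
the recursion that the equation `T^z_z E(z,w) = ⟨z,w⟩ E(z,w)` imposes on them. -/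
structure IsKernelTerms (R : Finset (RSpace N)) (μ : RSpace N → ℝ)
    (a : ℕ → CSpace N → CSpace N → ℂ) : Prop where
  zero : a 0 = fun _ _ => 1
  mem : ∀ n, a n ∈ bihomogPoly N n
  succ : ∀ n z w, radialOp R μ ((n + 1 : ℕ) : ℝ) (a (n + 1)) z w = bilin z w * a n z w

lemma exists_isKernelTerms (hR : IsRootSystem R) (hμ : IsMultiplicity R μ) :
    ∃ a, IsKernelTerms R μ a := by
  have exists_next (n : ℕ) (q : CSpace N → CSpace N → ℂ) (hq : q ∈ bihomogPoly N n) :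
      ∃ q' ∈ bihomogPoly N (n + 1),
        radialOp R μ ((n + 1 : ℕ) : ℝ) q' = fun z w => bilin z w * q z w :=
    exists_radialOp_eq hR hμ (by positivity) (bilin_mul_mem_bihomogPoly hq)
  choose! next next_mem radialOp_next using exists_next
  set a : ℕ → CSpace N → CSpace N → ℂ := fun n => Nat.rec (fun _ _ => 1) (fun n q => next n q) n
  have mem (n : ℕ) : a n ∈ bihomogPoly N n := by
    induction n with
    | zero => exact Submodule.mem_span_singleton_self _
    | succ n ih => exact next_mem n _ ih
  exact ⟨a, rfl, mem, fun n z w => congrFun₂ (radialOp_next n _ (mem n)) z w⟩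

lemma hasSum_dunklOp_comp_toC (hR : IsRootSystem R) {ι : Type*} {b : ι → CSpace N → ℂ}
    {f : CSpace N → ℂ} (hb : ∀ i, Differentiable ℂ (b i)) (hf : Differentiable ℂ f)
    (hsum : ∀ z, HasSum (fun i => b i z) (f z))
    (hderiv : ∀ z v, HasSum (fun i => fderiv ℂ (b i) z v) (fderiv ℂ f z v)) (ξ x : RSpace N) :
    HasSum (fun i => dunklOp R μ ξ (fun x => b i (toC x)) x)
      (dunklOp R μ ξ (fun x => f (toC x)) x) := by
  unfold dunklOp
  simp only [fderiv_comp_toC hf, fderiv_comp_toC (hb _)]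
  refine (hderiv _ _).add (HasSum.mul_left _ (hasSum_sum fun α hα => HasSum.mul_left _ ?_))
  simp only [diffQuot_comp_toC (hR.norm_sq α hα) hf, diffQuot_comp_toC (hR.norm_sq α hα) (hb _)]
  split_ifs
  · exact hderiv _ _
  · exact ((hsum _).sub (hsum _)).div_const _

lemma fderiv_left_apply {E : CSpace N → CSpace N → ℂ}
    (hE : Differentiable ℂ fun p : CSpace N × CSpace N => E p.1 p.2) (z w v : CSpace N) :
    fderiv ℂ (fun z => E z w) z v =
      fderiv ℂ (fun p : CSpace N × CSpace N => E p.1 p.2) (z, w) (v, 0) := by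
  have h := HasFDerivAt.comp (f := fun z => (z, w)) z (hE (z, w)).hasFDerivAt
    (hasFDerivAt_prodMk_left z w)
  exact congrArg (· v) h.fderiv

namespace IsKernelTerms

lemma differentiable (ha : IsKernelTerms R μ a) (n : ℕ) :
    Differentiable ℂ fun p : CSpace N × CSpace N => a n p.1 p.2 :=
  differentiable_of_mem_bihomogPoly (ha.mem n)

lemma norm_le (hR : IsRootSystem R) (hμ : IsMultiplicity R μ) (ha : IsKernelTerms R μ a) (n : ℕ)
    (z w : CSpace N) : ‖a n z w‖ ≤ (‖z‖ * ‖w‖) ^ n / n.factorial := by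
  induction n generalizing z with
  | zero => simp [ha.zero]
  | succ n ih =>
    refine norm_le_of_norm_radialOp_le hR hμ (ha.mem (n + 1)) (c := (n + 1 : ℕ)) (by positivity) z w
      fun z' hz' => ?_
    rw [ha.succ, norm_mul]
    refine (mul_le_mul (norm_bilin_le z' w) (ih z') (norm_nonneg _) (by positivity)).trans_eq ?_
    rw [hz', Nat.factorial_succ]
    push_cast
    field_simp
    ring

lemma dunklOp_self (hR : IsRootSystem R) (ha : IsKernelTerms R μ a) (n : ℕ) (x y : RSpace N) :
    dunklOp R μ x (fun x => a (n + 1) (toC x) (toC y)) x =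
      (inner ℝ y x : ℂ) * a n (toC x) (toC y) := by
  rw [dunklOp_self_of_mem_homogPoly hR (comp_toC_mem_homogPoly (ha.mem (n + 1)) (toC y)),
    real_inner_comm, ← bilin_toC, ← ha.succ n, radialOp_apply, Complex.ofReal_natCast]
  congr 2
  exact Finset.sum_congr rfl fun α hα => by rw [toC_rootRefl (hR.norm_sq α hα)]

lemma dunklOp_eq (hR : IsRootSystem R) (hμ : IsMultiplicity R μ) (ha : IsKernelTerms R μ a)
    (n : ℕ) (ξ x y : RSpace N) : dunklOp R μ ξ (fun x => a (n + 1) (toC x) (toC y)) x =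
      (inner ℝ ξ y : ℂ) * a n (toC x) (toC y) := by
  have mem (n : ℕ) := comp_toC_mem_homogPoly (ha.mem n) (toC y)
  induction n generalizing ξ x with
  | zero =>
    refine dunklOp_eq_of_radial hR hμ (mem 1) (mem 0) (fun x => ha.dunklOp_self hR 0 x y)
      (h := 0) (fun ξ x => ?_) ξ x
    simp [dunklOp_eq_zero_of_mem_homogPoly_zero ξ (mem 0)]
  | succ n ih =>
    exact dunklOp_eq_of_radial hR hμ (mem (n + 2)) (mem (n + 1))
      (fun x => ha.dunklOp_self hR (n + 1) x y) ih ξ x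

lemma hasSum (hR : IsRootSystem R) (hμ : IsMultiplicity R μ) (ha : IsKernelTerms R μ a)
    (z w : CSpace N) : HasSum (fun n => a n z w) (∑' n, a n z w) :=
  (Summable.of_norm_bounded (Real.summable_pow_div_factorial (‖z‖ * ‖w‖))
    fun n => ha.norm_le hR hμ n z w).hasSum

lemma summable_fderiv_and_hasFDerivAt (hR : IsRootSystem R) (hμ : IsMultiplicity R μ)
    (ha : IsKernelTerms R μ a) (p : CSpace N × CSpace N) :
    Summable (fun n => fderiv ℂ (fun p : CSpace N × CSpace N => a n p.1 p.2) p) ∧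
      HasFDerivAt (fun p : CSpace N × CSpace N => ∑' n, a n p.1 p.2)
        (∑' n, fderiv ℂ (fun p : CSpace N × CSpace N => a n p.1 p.2) p) p := by
  refine summable_fderiv_and_hasFDerivAt_tsum_of_entire ha.differentiable
    (u := fun r n => (r * r) ^ n / n.factorial) (fun r => Real.summable_pow_div_factorial (r * r))
    (fun r n p hp => (ha.norm_le hR hμ n p.1 p.2).trans ?_) p
  have h₁ : ‖p.1‖ ≤ r := (norm_fst_le p).trans hp
  have h₂ : ‖p.2‖ ≤ r := (norm_snd_le p).trans hp
  have hr : 0 ≤ r := (norm_nonneg p).trans hp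
  gcongr

lemma differentiable_tsum (hR : IsRootSystem R) (hμ : IsMultiplicity R μ)
    (ha : IsKernelTerms R μ a) :
    Differentiable ℂ fun p : CSpace N × CSpace N => ∑' n, a n p.1 p.2 :=
  fun p => (ha.summable_fderiv_and_hasFDerivAt hR hμ p).2.differentiableAt

lemma tsum_zero_left (hR : IsRootSystem R) (hμ : IsMultiplicity R μ) (ha : IsKernelTerms R μ a)
    (w : CSpace N) : ∑' n, a n 0 w = 1 := by
  rw [tsum_eq_single 0 fun n hn => ?_, ha.zero]
  simpa [hn] using ha.norm_le hR hμ n 0 w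

lemma dunklOp_tsum (hR : IsRootSystem R) (hμ : IsMultiplicity R μ) (ha : IsKernelTerms R μ a)
    (ξ x y : RSpace N) : dunklOp R μ ξ (fun x => ∑' n, a n (toC x) (toC y)) x =
      (inner ℝ ξ y : ℂ) * ∑' n, a n (toC x) (toC y) := by
  set E : CSpace N → CSpace N → ℂ := fun z w => ∑' n, a n z w
  have hE : Differentiable ℂ fun p : CSpace N × CSpace N => E p.1 p.2 :=
    ha.differentiable_tsum hR hμ
  have hasSum_fderiv (z v : CSpace N) :
      HasSum (fun n => fderiv ℂ (fun z => a n z (toC y)) z v)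
        (fderiv ℂ (fun z => E z (toC y)) z v) := by
    obtain ⟨summable, hasFDerivAt⟩ := ha.summable_fderiv_and_hasFDerivAt hR hμ (z, toC y)
    simp only [fderiv_left_apply hE, fderiv_left_apply (ha.differentiable _)]
    rw [hasFDerivAt.fderiv]
    exact summable.hasSum.mapL (ContinuousLinearMap.apply ℂ ℂ ((v, 0) : CSpace N × CSpace N))
  have hasSum_dunklOp := hasSum_dunklOp_comp_toC (μ := μ) hR
    (fun n => differentiable_left (ha.differentiable n) (toC y)) (differentiable_left hE (toC y))
    (fun z => ha.hasSum hR hμ z (toC y)) hasSum_fderiv ξ x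
  rw [← hasSum_nat_add_iff' 1] at hasSum_dunklOp
  simp only [ha.dunklOp_eq hR hμ, Finset.sum_range_one, ha.zero, dunklOp_const, Pi.zero_apply,
    sub_zero] at hasSum_dunklOp
  exact hasSum_dunklOp.unique ((ha.hasSum hR hμ _ _).mul_left _)

lemma isDunklKernel (hR : IsRootSystem R) (hμ : IsMultiplicity R μ) (ha : IsKernelTerms R μ a) :
    IsDunklKernel R μ fun z w => ∑' n, a n z w where
  holomorphic := ha.differentiable_tsum hR hμ
  real_valued x y := by
    have euler := isEulerKernel_of_eigen (E := fun z w => ∑' n, a n z w) hR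
      (ha.differentiable_tsum hR hμ) (fun x y ξ => ha.dunklOp_tsum hR hμ ξ x y)
      fun y => ha.tsum_zero_left hR hμ (toC y)
    simpa only [conjC_toC, Complex.conj_eq_iff_im] using euler.conj_eq hR hμ (toC x) (toC y)
  eigen x y ξ := ha.dunklOp_tsum hR hμ ξ x y
  normalized y := ha.tsum_zero_left hR hμ (toC y)

end IsKernelTerms

theorem isDunklKernel_dunklKernel (hR : IsRootSystem R) (hμ : IsMultiplicity R μ) :
    IsDunklKernel R μ (dunklKernel R μ) := by
  obtain ⟨a, ha⟩ := exists_isKernelTerms hR hμ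
  have h : ∃ E, IsDunklKernel R μ E := ⟨_, ha.isDunklKernel hR hμ⟩
  rw [dunklKernel, dif_pos h]
  exact h.choose_spec

end Existence

/-! ### The Segal-Bargmann transform -/

section SegalBargmannTransform

variable {R : Finset (RSpace N)} {μ : RSpace N → ℝ} {c s t : ℝ}

lemma isEulerKernel_dunklKernel (hR : IsRootSystem R) (hμ : IsMultiplicity R μ) :
    IsEulerKernel R μ (dunklKernel R μ) :=
  (isDunklKernel_dunklKernel hR hμ).isEulerKernel hR

lemma weightTilde_nonneg (ht : 0 ≤ t) (x : RSpace N) : 0 ≤ weightTilde R μ t x :=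
  mul_nonneg (Real.rpow_nonneg ht _)
    (Finset.prod_nonneg fun _ _ => Real.rpow_nonneg (abs_nonneg _) _)

lemma weight_nonneg (ht : 0 ≤ t) (x : RSpace N) : 0 ≤ weight R μ t x :=
  mul_nonneg (inv_nonneg.2 (integral_nonneg fun x =>
    mul_nonneg (weightTilde_nonneg zero_le_one x) (Real.exp_nonneg _))) (weightTilde_nonneg ht x)

lemma continuous_weight (hμ : IsMultiplicity R μ) (t : ℝ) : Continuous (weight R μ t) := by
  refine continuous_const.mul (continuous_const.mul (continuous_finsetProd _ fun α hα => ?_))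
  exact Continuous.rpow_const (by fun_prop) fun _ => .inr (hμ.nonneg α hα)

lemma prod_abs_inner_smul_rpow (hc : 0 < c) (x : RSpace N) :
    ∏ α ∈ R, |(inner ℝ α (c • x) : ℝ)| ^ μ α =
      c ^ (2 * gammaConst R μ) * ∏ α ∈ R, |(inner ℝ α x : ℝ)| ^ μ α := by
  have sum_eq : 2 * gammaConst R μ = ∑ α ∈ R, μ α := by rw [gammaConst]; ring
  rw [sum_eq, Real.rpow_sum_of_pos hc, ← Finset.prod_mul_distrib]
  refine Finset.prod_congr rfl fun α _ => ?_
  rw [inner_smul_right, abs_mul, abs_of_pos hc, Real.mul_rpow hc.le (abs_nonneg _)]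

lemma weight_smul (hc : 0 < c) (hs : 0 ≤ s) (x : RSpace N) :
    weight R μ s x = c ^ N * weight R μ (c ^ 2 * s) (c • x) := by
  have powers_cancel :
      c ^ N * (c ^ 2) ^ (-(gammaConst R μ + (N : ℝ) / 2)) * c ^ (2 * gammaConst R μ) = 1 := by
    rw [← Real.rpow_natCast c N, ← Real.rpow_natCast_mul hc.le, ← Real.rpow_add hc,
      ← Real.rpow_add hc]
    convert Real.rpow_zero c using 2
    push_cast
    ring
  rw [weight, weight, weightTilde, weightTilde, prod_abs_inner_smul_rpow hc,
    Real.mul_rpow (sq_nonneg c) hs]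
  linear_combination -((mmsConst R μ)⁻¹ * (s ^ (-(gammaConst R μ + (N : ℝ) / 2)) *
    ∏ α ∈ R, |(inner ℝ α x : ℝ)| ^ μ α)) * powers_cancel

lemma measurePreserving_smul (hμ : IsMultiplicity R μ) (hc : 0 < c) (hs : 0 ≤ s) :
    MeasurePreserving (fun x : RSpace N => c • x) (weightMeasure R μ s)
      (weightMeasure R μ (c ^ 2 * s)) := by
  have measurable_smul : Measurable fun x : RSpace N => c • x := by fun_prop
  have measurable_weight : Measurable fun x => ENNReal.ofReal (weight R μ (c ^ 2 * s) x) :=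
    (continuous_weight hμ _).measurable.ennreal_ofReal
  refine ⟨measurable_smul, Measure.ext fun A hA => ?_⟩
  rw [Measure.map_apply measurable_smul hA, weightMeasure,
    withDensity_apply _ (measurable_smul hA), weightMeasure, withDensity_apply _ hA]
  simp only [weight_smul (R := R) (μ := μ) hc hs, ENNReal.ofReal_mul (pow_nonneg hc.le N)]
  rw [lintegral_const_mul _ (f := fun x => ENNReal.ofReal (weight R μ (c ^ 2 * s) (c • x)))
      (measurable_weight.comp measurable_smul),
    ← setLIntegral_map hA measurable_weight measurable_smul, Measure.map_addHaar_smul _ hc.ne',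
    Measure.restrict_smul, lintegral_smul_measure, smul_eq_mul, ← mul_assoc,
    ← ENNReal.ofReal_mul (pow_nonneg hc.le N), abs_of_pos (by positivity)]
  simp [hc.ne']

lemma measurableEmbedding_smul (hc : c ≠ 0) : MeasurableEmbedding fun x : RSpace N => c • x :=
  (Homeomorph.smulOfNeZero c hc).measurableEmbedding

lemma inv_sqrt_sq_mul_mul (hc : 0 < c) (s : ℝ) :
    ((Real.sqrt (c ^ 2 * s) : ℝ) : ℂ)⁻¹ * c = ((Real.sqrt s : ℝ) : ℂ)⁻¹ := by
  have hc' : (c : ℂ) ≠ 0 := Complex.ofReal_ne_zero.2 hc.ne'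
  rw [Real.sqrt_mul (sq_nonneg c), Real.sqrt_sq hc.le, Complex.ofReal_mul, mul_inv,
    mul_right_comm, inv_mul_cancel₀ hc', one_mul]

lemma sqC_eq_bilin (z : CSpace N) : sqC z = bilin z z := by
  simp [sqC, bilin_apply, sq]

lemma kernelA_smul (hc : 0 < c) (s : ℝ) (z : CSpace N) (q : RSpace N) :
    kernelA R μ (c ^ 2 * s) ((c : ℂ) • z) (c • q) = kernelA R μ s z q := by
  have hc' : (c : ℂ) ^ 2 ≠ 0 := pow_ne_zero 2 (Complex.ofReal_ne_zero.2 hc.ne')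
  have exponent : -(c ^ 2 * bilin z z) / (2 * (c ^ 2 * s)) - (c * ‖q‖ : ℂ) ^ 2 / (4 * (c ^ 2 * s)) =
      -bilin z z / (2 * s) - (‖q‖ : ℂ) ^ 2 / (4 * s) := by
    rw [← mul_neg, mul_left_comm 2, mul_left_comm 4, mul_pow, mul_div_mul_left _ _ hc',
      mul_div_mul_left _ _ hc']
  have bilin_smul : bilin ((c : ℂ) • z) ((c : ℂ) • z) = c ^ 2 * bilin z z := by
    rw [map_smul, bilin_smul_left, smul_eq_mul]
    ring
  rw [kernelA, kernelA, toC_smul, smul_smul, smul_smul, inv_sqrt_sq_mul_mul hc, sqC_eq_bilin,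
    sqC_eq_bilin, bilin_smul, norm_smul, Real.norm_of_nonneg hc.le, Complex.ofReal_mul,
    Complex.ofReal_mul, Complex.ofReal_pow, exponent]

lemma sbKernel_smul (hc : 0 < c) (s : ℝ) (z w : CSpace N) :
    sbKernel R μ (c ^ 2 * s) ((c : ℂ) • z) ((c : ℂ) • w) = sbKernel R μ s z w := by
  rw [sbKernel, sbKernel, conjC_smul, Complex.conj_ofReal, smul_smul, smul_smul,
    inv_sqrt_sq_mul_mul hc]

lemma transformA_dilReal (hμ : IsMultiplicity R μ) (hc : 0 < c) (hs : 0 ≤ s) (ψ : RSpace N → ℂ)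
    (z : CSpace N) :
    transformA R μ s (dilReal c ψ) z = transformA R μ (c ^ 2 * s) ψ ((c : ℂ) • z) := by
  rw [transformA, transformA, ← (measurePreserving_smul hμ hc hs).integral_comp
    (measurableEmbedding_smul hc.ne')]
  simp only [kernelA_smul hc, dilReal]

lemma transformA_congr_ae {ψ φ : RSpace N → ℂ} (h : ψ =ᵐ[weightMeasure R μ t] φ) (z : CSpace N) :
    transformA R μ t ψ z = transformA R μ t φ z :=
  integral_congr_ae (h.mono fun _ hq => congrArg _ hq)

lemma measurePreserving_sqrt_smul (hμ : IsMultiplicity R μ) (ht : 0 < t) :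
    MeasurePreserving (fun x : RSpace N => √t • x) (weightMeasure R μ 1) (weightMeasure R μ t) := by
  simpa [Real.sq_sqrt ht.le] using measurePreserving_smul (R := R) hμ (Real.sqrt_pos.2 ht)
    zero_le_one

lemma kernelA_sqrt_smul (ht : 0 < t) (z : CSpace N) (q : RSpace N) :
    kernelA R μ t z (√t • q) = kernelA R μ 1 ((√t : ℂ)⁻¹ • z) q := by
  have h := kernelA_smul (R := R) (μ := μ) (Real.sqrt_pos.2 ht) 1 ((√t : ℂ)⁻¹ • z) q
  rwa [Real.sq_sqrt ht.le, mul_one,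
    smul_inv_smul₀ (Complex.ofReal_ne_zero.2 (Real.sqrt_pos.2 ht).ne')] at h

lemma integrable_weightMeasure_iff (hμ : IsMultiplicity R μ) (ht : 0 ≤ t) (f : RSpace N → ℂ) :
    Integrable f (weightMeasure R μ t) ↔ Integrable fun q => (weight R μ t q : ℂ) * f q := by
  rw [weightMeasure, integrable_withDensity_iff_integrable_smul'
    (continuous_weight hμ t).measurable.ennreal_ofReal (by simp)]
  simp only [ENNReal.toReal_ofReal (weight_nonneg ht _), Complex.real_smul]

lemma integral_weightMeasure (hμ : IsMultiplicity R μ) (ht : 0 ≤ t) (f : RSpace N → ℂ) :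
    ∫ q, f q ∂(weightMeasure R μ t) = ∫ q, (weight R μ t q : ℂ) * f q := by
  rw [weightMeasure, integral_withDensity_eq_integral_toReal_smul
    (continuous_weight hμ t).measurable.ennreal_ofReal (by simp)]
  simp only [ENNReal.toReal_ofReal (weight_nonneg ht _), Complex.real_smul]

lemma weight_mul_kernelA_mul_kernelA (hR : IsRootSystem R) (hμ : IsMultiplicity R μ)
    (z w : CSpace N) (q : RSpace N) :
    (weight R μ 1 q : ℂ) * (kernelA R μ 1 z q * kernelA R μ 1 w q) =
      Complex.exp (-((bilin z z + bilin w w) / 2)) * (mmsConst R μ : ℂ)⁻¹ *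
        (dunklKernel R μ (toC q) z * dunklKernel R μ (toC q) w * (gaussWeight R μ 0 q : ℂ)) := by
  have hE := isEulerKernel_dunklKernel hR hμ
  have exp_mul_exp : Complex.exp (-bilin z z / 2 - (‖q‖ : ℂ) ^ 2 / 4) *
      Complex.exp (-bilin w w / 2 - (‖q‖ : ℂ) ^ 2 / 4) =
      Complex.exp (-((bilin z z + bilin w w) / 2)) * Complex.exp (-(‖q‖ : ℂ) ^ 2 / 2) := by
    rw [← Complex.exp_add, ← Complex.exp_add]
    congr 1
    ring
  rw [← weightTilde_one_mul_exp, weight, kernelA, kernelA, sqC_eq_bilin, sqC_eq_bilin,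
    hE.symm hR hμ (toC q) z, hE.symm hR hμ (toC q) w]
  push_cast
  simp only [Real.sqrt_one, Complex.ofReal_one, inv_one, one_smul, mul_one]
  linear_combination ((mmsConst R μ : ℂ)⁻¹ * (weightTilde R μ 1 q : ℂ) *
    dunklKernel R μ z (toC q) * dunklKernel R μ w (toC q)) * exp_mul_exp

lemma integrable_kernelA_mul_kernelA (hR : IsRootSystem R) (hμ : IsMultiplicity R μ) (ht : 0 < t)
    (z w : CSpace N) :
    Integrable (fun q => kernelA R μ t z q * kernelA R μ t w q) (weightMeasure R μ t) := by
  rw [← (measurePreserving_sqrt_smul hμ ht).integrable_comp_emb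
    (measurableEmbedding_smul (Real.sqrt_pos.2 ht).ne')]
  simp only [Function.comp_def, kernelA_sqrt_smul ht]
  rw [integrable_weightMeasure_iff hμ zero_le_one]
  simp only [weight_mul_kernelA_mul_kernelA hR hμ]
  exact ((isEulerKernel_dunklKernel hR hμ).integrable_gaussPairing hR hμ _ _).const_mul _

lemma integral_kernelA_mul_kernelA (hR : IsRootSystem R) (hμ : IsMultiplicity R μ) (ht : 0 < t)
    (z w : CSpace N) :
    ∫ q, kernelA R μ t z q * kernelA R μ t w q ∂(weightMeasure R μ t) =
      dunklKernel R μ ((√t : ℂ)⁻¹ • z) ((√t : ℂ)⁻¹ • w) := by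
  have hE := isDunklKernel_dunklKernel hR hμ
  have hmms : (mmsConst R μ : ℂ) ≠ 0 := Complex.ofReal_ne_zero.2 (mmsConst_pos hR hμ).ne'
  rw [← (measurePreserving_sqrt_smul hμ ht).integral_comp
    (measurableEmbedding_smul (Real.sqrt_pos.2 ht).ne')]
  simp only [kernelA_sqrt_smul ht]
  rw [integral_weightMeasure hμ zero_le_one]
  simp only [weight_mul_kernelA_mul_kernelA hR hμ]
  rw [integral_const_mul, ← gaussPairing, hE.gaussPairing_eq hR hμ,
    (hE.isEulerKernel hR).gaussPairing_zero_zero hR hμ, Complex.exp_neg]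
  field_simp [Complex.exp_ne_zero]

lemma conj_kernelA (hR : IsRootSystem R) (hμ : IsMultiplicity R μ) (t : ℝ) (z : CSpace N)
    (q : RSpace N) : conj (kernelA R μ t z q) = kernelA R μ t (conjC z) q := by
  rw [kernelA, kernelA, map_mul, (isEulerKernel_dunklKernel hR hμ).conj_eq hR hμ, conjC_smul,
    conjC_smul, conjC_toC, ← Complex.exp_conj, sqC_eq_bilin, sqC_eq_bilin, ← conj_bilin]
  simp [Complex.conj_ofNat]

lemma continuous_kernelA (hR : IsRootSystem R) (hμ : IsMultiplicity R μ) (t : ℝ) (z : CSpace N) :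
    Continuous (kernelA R μ t z) := by
  have continuous_smul_toC : Continuous fun q : RSpace N => (√t : ℂ)⁻¹ • toC q :=
    (continuous_const_smul _).comp continuous_toC
  exact Continuous.mul (by fun_prop)
    ((differentiable_right (isEulerKernel_dunklKernel hR hμ).holomorphic _).continuous.comp
      continuous_smul_toC)

lemma memLp_kernelA (hR : IsRootSystem R) (hμ : IsMultiplicity R μ) (ht : 0 < t) (z : CSpace N) :
    MemLp (kernelA R μ t z) 2 (weightMeasure R μ t) := by
  rw [memLp_two_iff_integrable_sq_norm (continuous_kernelA hR hμ t z).aestronglyMeasurable]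
  refine (integrable_kernelA_mul_kernelA hR hμ ht z (conjC z)).norm.congr (.of_forall fun q => ?_)
  simp [← conj_kernelA hR hμ, sq]

lemma integrable_kernelA_mul (hR : IsRootSystem R) (hμ : IsMultiplicity R μ) (ht : 0 < t)
    (ψ : L2Weight R μ t) (z : CSpace N) :
    Integrable (fun q => kernelA R μ t z q * ψ q) (weightMeasure R μ t) :=
  (memLp_kernelA hR hμ ht z).integrable_mul (Lp.memLp ψ)

/-- The vector of `L²(ω_{μ,t})` that represents the functional `ψ ↦ A_{μ,t} ψ(z)`, namely the
function `q ↦ A_{μ,t}(z*, q)`. -/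
noncomputable def kernelVector (hR : IsRootSystem R) (hμ : IsMultiplicity R μ) (ht : 0 < t)
    (z : CSpace N) : L2Weight R μ t :=
  (memLp_kernelA hR hμ ht (conjC z)).toLp _

lemma coeFn_kernelVector (hR : IsRootSystem R) (hμ : IsMultiplicity R μ) (ht : 0 < t)
    (z : CSpace N) :
    kernelVector hR hμ ht z =ᵐ[weightMeasure R μ t] kernelA R μ t (conjC z) :=
  (memLp_kernelA hR hμ ht (conjC z)).coeFn_toLp

lemma inner_kernelVector (hR : IsRootSystem R) (hμ : IsMultiplicity R μ) (ht : 0 < t)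
    (z : CSpace N) (ψ : L2Weight R μ t) :
    inner ℂ (kernelVector hR hμ ht z) ψ = transformA R μ t ψ z := by
  rw [L2.inner_def, transformA]
  refine integral_congr_ae ((coeFn_kernelVector hR hμ ht z).mono fun q hq => ?_)
  simp only [hq, ← conj_kernelA hR hμ, RCLike.inner_apply, Complex.conj_conj, mul_comm]

lemma inner_kernelVector_kernelVector (hR : IsRootSystem R) (hμ : IsMultiplicity R μ) (ht : 0 < t)
    (z w : CSpace N) :
    inner ℂ (kernelVector hR hμ ht z) (kernelVector hR hμ ht w) = sbKernel R μ t w z := by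
  rw [inner_kernelVector, transformA_congr_ae (coeFn_kernelVector hR hμ ht w), transformA,
    integral_kernelA_mul_kernelA hR hμ ht, (isEulerKernel_dunklKernel hR hμ).symm hR hμ, sbKernel]

lemma sbMatrixTotal_eq (hR : IsRootSystem R) (hμ : IsMultiplicity R μ) (ht : 0 < t) :
    sbMatrixTotal R μ t = sbMatrix R μ t := by
  have h := posSemidef_gram_smul_id (𝕜 := ℂ) (kernelVector hR hμ ht)
  simp only [inner_kernelVector_kernelVector] at h
  exact if_pos h

lemma kernel_segalBargmann_apply_one (hR : IsRootSystem R) (hμ : IsMultiplicity R μ) (ht : 0 < t)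
    (z w : CSpace N) : RKHS.kernel (SegalBargmann R μ t) z w 1 = sbKernel R μ t w z := by
  rw [kernel_segalBargmann, sbMatrixTotal_eq hR hμ ht]
  simp [sbMatrix]

theorem exists_transformA_clm (hR : IsRootSystem R) (hμ : IsMultiplicity R μ) (ht : 0 < t) :
    ∃ A : L2Weight R μ t →L[ℂ] SegalBargmann R μ t, ∀ ψ z, A ψ z = transformA R μ t ψ z := by
  obtain ⟨A, hA⟩ := exists_clm_apply_eq_inner (H := SegalBargmann R μ t) (kernelVector hR hμ ht)
    fun z w => by
      rw [inner_kernelVector_kernelVector, kernel_segalBargmann_apply_one hR hμ ht]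
  exact ⟨A, fun ψ z => by rw [hA, inner_kernelVector]⟩

theorem exists_dilReal_clm (hμ : IsMultiplicity R μ) (hc : 0 < c) (hs : 0 ≤ s) :
    ∃ δ : L2Weight R μ (c ^ 2 * s) →L[ℂ] L2Weight R μ s,
      ∀ ψ, δ ψ =ᵐ[weightMeasure R μ s] dilReal c ψ :=
  ⟨(Lp.compMeasurePreservingₗᵢ ℂ _ (measurePreserving_smul hμ hc hs)).toContinuousLinearMap,
    fun ψ => Lp.coeFn_compMeasurePreserving ψ _⟩

theorem exists_dilComplex_clm (hR : IsRootSystem R) (hμ : IsMultiplicity R μ) (hc : 0 < c)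
    (hs : 0 < s) : ∃ D : SegalBargmann R μ (c ^ 2 * s) →L[ℂ] SegalBargmann R μ s,
      ∀ f, D f = dilComplex (c : ℂ) f := by
  have ht : 0 < c ^ 2 * s := by positivity
  obtain ⟨D, hD⟩ := exists_clm_apply_eq_inner (H := SegalBargmann R μ s)
    (fun z : CSpace N => RKHS.kerFun (SegalBargmann R μ (c ^ 2 * s)) ((c : ℂ) • z) (1 : ℂ))
    fun z w => by
      rw [RKHS.kerFun_inner, RKHS.kerFun_apply, kernel_segalBargmann_apply_one hR hμ ht,
        kernel_segalBargmann_apply_one hR hμ hs, sbKernel_smul hc]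
      simp
  exact ⟨D, fun f => funext fun z => by rw [hD, RKHS.kerFun_inner]; simp [dilComplex]⟩

end SegalBargmannTransform

end Dunkl

/-- The four arrows of the diagram are bounded operators between the Hilbert spaces, given by
the stated formulas (which determine them), and the diagram commutes. -/
theorem mainTheorem5 {N : ℕ} (R : Finset (Dunkl.RSpace N)) (hR : Dunkl.IsRootSystem R)
    (μ : Dunkl.RSpace N → ℝ) (hμ : Dunkl.IsMultiplicity R μ)
    (s t : ℝ) (hs : 0 < s) (ht : 0 < t) :
    ∃ (A_t : Dunkl.L2Weight R μ t →L[ℂ] Dunkl.SegalBargmann R μ t)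
      (A_s : Dunkl.L2Weight R μ s →L[ℂ] Dunkl.SegalBargmann R μ s)
      (δ : Dunkl.L2Weight R μ t →L[ℂ] Dunkl.L2Weight R μ s)
      (D : Dunkl.SegalBargmann R μ t →L[ℂ] Dunkl.SegalBargmann R μ s),
      (∀ (ψ : Dunkl.L2Weight R μ t) (z : Dunkl.CSpace N),
        MeasureTheory.Integrable (fun q => Dunkl.kernelA R μ t z q * ψ q)
          (Dunkl.weightMeasure R μ t) ∧
        A_t ψ z = Dunkl.transformA R μ t ψ z) ∧
      (∀ (ψ : Dunkl.L2Weight R μ s) (z : Dunkl.CSpace N),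
        MeasureTheory.Integrable (fun q => Dunkl.kernelA R μ s z q * ψ q)
          (Dunkl.weightMeasure R μ s) ∧
        A_s ψ z = Dunkl.transformA R μ s ψ z) ∧
      (∀ ψ : Dunkl.L2Weight R μ t,
        (δ ψ : Dunkl.RSpace N → ℂ) =ᵐ[Dunkl.weightMeasure R μ s]
          Dunkl.dilReal (Real.sqrt (t / s)) ψ) ∧
      (∀ f : Dunkl.SegalBargmann R μ t,
        (D f : Dunkl.CSpace N → ℂ) = Dunkl.dilComplex (Real.sqrt (t / s) : ℂ) f) ∧
      D ∘L A_t = A_s ∘L δ := by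
  have hc : 0 < √(t / s) := Real.sqrt_pos.2 (div_pos ht hs)
  have ht_eq : t = √(t / s) ^ 2 * s := by
    rw [Real.sq_sqrt (div_pos ht hs).le, div_mul_cancel₀ _ hs.ne']
  generalize √(t / s) = c at hc ht_eq
  subst ht_eq
  obtain ⟨A_t, hA_t⟩ := Dunkl.exists_transformA_clm hR hμ ht
  obtain ⟨A_s, hA_s⟩ := Dunkl.exists_transformA_clm hR hμ hs
  obtain ⟨δ, hδ⟩ := Dunkl.exists_dilReal_clm hμ hc hs.le
  obtain ⟨D, hD⟩ := Dunkl.exists_dilComplex_clm hR hμ hc hs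
  refine ⟨A_t, A_s, δ, D, fun ψ z => ⟨Dunkl.integrable_kernelA_mul hR hμ ht ψ z, hA_t ψ z⟩,
    fun ψ z => ⟨Dunkl.integrable_kernelA_mul hR hμ hs ψ z, hA_s ψ z⟩, hδ, hD,
    ContinuousLinearMap.ext fun ψ => RKHS.ext fun z => ?_⟩
  calc D (A_t ψ) z = Dunkl.transformA R μ (c ^ 2 * s) ψ ((c : ℂ) • z) := by
        rw [hD, Dunkl.dilComplex, hA_t]
    _ = Dunkl.transformA R μ s (Dunkl.dilReal c ψ) z :=
        (Dunkl.transformA_dilReal hμ hc hs.le ψ z).symm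
    _ = A_s (δ ψ) z := by rw [hA_s, Dunkl.transformA_congr_ae (hδ ψ)]
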